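/- Let $\mathbb{S}=\{x\in\mathbb{R}^3:|x|=1\}$ with surface measure $d\omega$, surface gradient $\nabla^*$ and Beltrami operator $\Delta^*=\nabla^*\cdot\nabla^*$ (both in the weak sense). For $\mathbf m\in L^2(\mathbb{S},\mathbb{R}^3)$ and $x\notin\mathbb{S}$ put $$V[\mathbf m](x)=\frac1{4\pi}\int_{\mathbb{S}}\mathbf m(y)\cdot\frac{x-y}{|x-y|^3}\,d\omega(y).$$ Fix $R>1$. Two magnetizations are equivalent from outside if their potentials $V$ agree on $\{|x|=R\}$. For $Q\in L^2(\mathbb{S})$ and $d\in\mathbb{S}$, the pair $(Q,d)$ stands for the magnetization $x\mapsto Q(x)\,(3(x\cdot d)x-d)$. Supports are essential supports: the complement in $\mathbb{S}$ of the largest open set on which the function vanishes almost everywhere. $H_1(\mathbb{S})$ is the space of square-integrable functions on $\mathbb{S}$ with square-integrable weak surface gradient, and $H_1(\mathbb{S},\mathbb{R}^3)$ is taken componentwise. Let $\Gamma\subset\mathbb{S}$ have closure $\overline\Gamma\neq\mathbb{S}$, and let $\overline{\mathbf m}\in H_1(\mathbb{S},\mathbb{R}^3)$ with $\operatorname{supp}\overline{\mathbf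 m}\subset\Gamma$. Let $\overline m_1,\overline m_2,\overline m_3$ be the scalars of the spherical Helmholtz decomposition $$\overline{\mathbf m}(x)=x\,\overline m_1(x)+\nabla^*\overline m_2(x)+x\times\nabla^*\overline m_3(x),\qquad \int_{\mathbb{S}}\overline m_2\,d\omega=\int_{\mathbb{S}}\overline m_3\,d\omega=0,$$ so that $\overline m_1(x)=x\cdot\overline{\mathbf m}(x)$, and put $\overline{\mathbf h}=\nabla^*\overline m_1$ and $\overline g=2\Delta^*\overline m_2-\overline m_1$. Then these functions exist, with $\overline g\in L^2(\mathbb{S})$ and $\overline{\mathbf h}\in L^2(\mathbb{S},\mathbb{R}^3)$. Define, for $d=(d_1,d_2,d_3)$, $$\begin{aligned}T_{\overline g,\overline{\mathbf h},\overline m_1}(d)=&\sum_{i,j,k,l=1}^3 d_id_jd_kd_l\int_{\mathbb{S}}y_iy_jy_ky_l|\overline g(y)|^2d\omega(y)+\sum_{i,j,k,l=1}^3 d_id_jd_kd_l\int_{\mathbb{S}}y_iy_j\overline h_k(y)\overline h_l(y)\,d\omega(y)\\&+2\sum_{i,j,k,l=1}^3 d_id_jd_kd_l\int_{\mathbb{S}}y_iy_jy_k\overline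 h_l(y)\overline g(y)\,d\omega(y)-2\sum_{i,j=1}^3 d_id_j\int_{\mathbb{S}}y_iy_j\overline m_1(y)\overline g(y)\,d\omega(y)\\&-2\sum_{i,j=1}^3 d_id_j\int_{\mathbb{S}}y_i\overline h_j(y)\overline m_1(y)\,d\omega(y)+\int_{\mathbb{S}}|\overline m_1(y)|^2d\omega(y).\end{aligned}$$ Then the following two statements are equivalent. 1. There exist $Q\in H_1(\mathbb{S})$ with $\operatorname{supp}Q\subset\Gamma$ and $d\in\mathbb{S}$ such that $(Q,d)$ is equivalent from outside to $\overline{\mathbf m}$. 2. There exists $d\in\mathbb{S}$ such that $T_{\overline g,\overline{\mathbf h},\overline m_1}(d)=0$ and the function $x\mapsto\dfrac{x\cdot\overline{\mathbf m}(x)}{2\,x\cdot d}$ (defined for almost every $x\in\mathbb{S}$) belongs to $H_1(\mathbb{S})$. -/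

import Mathlib

open MeasureTheory
open scoped Topology ContDiff

noncomputable section

namespace DipoleSphere

/-- Euclidean space `ℝ³`. -/
abbrev E3 : Type := EuclideanSpace ℝ (Fin 3)

/-- The unit sphere of `ℝ³`. -/
abbrev S2 : Type := Metric.sphere (0 : E3) 1

/-- The surface measure `dω` on the unit sphere (total mass `4π`). -/
def omega : Measure S2 := (volume : Measure E3).toSphere

/-- The vector product on `ℝ³`. -/
def cross (v w : E3) : E3 := WithLp.toLp 2 (crossProduct v.ofLp w.ofLp)

/-- The support of a function on the sphere that is given up to null sets: the complement of the
largest open set on which it vanishes almost everywhere. -/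
def supp {F : Type*} [Zero F] (f : S2 → F) : Set S2 :=
  {x | ∀ U ∈ 𝓝 x, ¬ ∀ᵐ y ∂omega, y ∈ U → f y = 0}

/-- The surface gradient at a point `x` of the sphere of (the restriction to the sphere of) a smooth
function `φ` on `ℝ³`: the tangential part of the Euclidean gradient. -/
def surfGrad (φ : E3 → ℝ) (x : S2) : E3 :=
  gradient φ x - inner ℝ (x : E3) (gradient φ x) • (x : E3)

/-- The surface divergence at a point `x` of the sphere of (the restriction to the sphere of) a smooth
vector field `Φ` on `ℝ³`: the trace of the derivative of `Φ` over the tangent plane at `x`, that is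
the trace over `ℝ³` minus the contribution of the unit normal `x`. -/
def surfDiv (Φ : E3 → E3) (x : S2) : ℝ :=
  (∑ i : Fin 3, (fderiv ℝ Φ x (EuclideanSpace.single i 1)) i)
    - inner ℝ (x : E3) (fderiv ℝ Φ x (x : E3))

/-- `h` is the weak surface gradient `∇* f`: `f` and `h` are square-integrable, `h` is tangential, and
`∫ f (∇* · Φ) dω = - ∫ h · Φ dω` for all smooth tangential vector fields `Φ`. (The smooth vector fields
on the sphere are the restrictions of the smooth vector fields on `ℝ³`.) -/
structure IsWeakGrad (f : S2 → ℝ) (h : S2 → E3) : Prop where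
  memLp_fun : MemLp f 2 omega
  memLp_grad : MemLp h 2 omega
  tangential : ∀ᵐ (x : S2) ∂omega, inner ℝ (x : E3) (h x) = 0
  integral_eq : ∀ Φ : E3 → E3, ContDiff ℝ ∞ Φ → (∀ x : S2, inner ℝ (x : E3) (Φ x) = 0) →
    ∫ x, f x * surfDiv Φ x ∂omega = - ∫ x, inner ℝ (h x) (Φ x) ∂omega

/-- `g` is the weak surface divergence `∇* · h` of the tangential field `h`: both are
square-integrable and `∫ h · ∇* φ dω = - ∫ g φ dω` for all smooth functions `φ`. -/
structure IsWeakDiv (h : S2 → E3) (g : S2 → ℝ) : Prop where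
  memLp_field : MemLp h 2 omega
  tangential : ∀ᵐ (x : S2) ∂omega, inner ℝ (x : E3) (h x) = 0
  memLp_div : MemLp g 2 omega
  integral_eq : ∀ φ : E3 → ℝ, ContDiff ℝ ∞ φ →
    ∫ x, inner ℝ (h x) (surfGrad φ x) ∂omega = - ∫ x : S2, g x * φ x ∂omega

/-- `g` is the weak Beltrami derivative `Δ* f = ∇* · ∇* f`. -/
def IsWeakBeltrami (f g : S2 → ℝ) : Prop :=
  ∃ h : S2 → E3, IsWeakGrad f h ∧ IsWeakDiv h g

/-- The Sobolev space `H₁` of scalar functions on the sphere. -/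
def MemH1 (f : S2 → ℝ) : Prop := ∃ h : S2 → E3, IsWeakGrad f h

/-- The Sobolev space `H₁` of `ℝ³`-valued functions on the sphere. -/
def MemH1Vec (f : S2 → E3) : Prop := ∀ i : Fin 3, MemH1 (fun x => f x i)

/-- `f₁, f₂, f₃` are the scalars of the spherical Helmholtz decomposition of `f`:
`f = x f₁ + ∇* f₂ + x × ∇* f₃` with `∫ f₂ dω = ∫ f₃ dω = 0`. -/
def IsHelmholtz (f : S2 → E3) (f₁ f₂ f₃ : S2 → ℝ) : Prop :=
  MemLp f₁ 2 omega ∧ (∫ x, f₂ x ∂omega = 0) ∧ (∫ x, f₃ x ∂omega = 0) ∧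
    ∃ h₂ h₃ : S2 → E3, IsWeakGrad f₂ h₂ ∧ IsWeakGrad f₃ h₃ ∧
      ∀ᵐ x ∂omega, f x = f₁ x • (x : E3) + h₂ x + cross x (h₃ x)

/-- The magnetic potential `V[m]` of a magnetization `m` on the unit sphere. -/
def potential (m : S2 → E3) (x : E3) : ℝ :=
  1 / (4 * Real.pi) * ∫ y : S2, inner ℝ (m y) (x - y) / ‖x - y‖ ^ 3 ∂omega

/-- Equality of the potentials of two magnetizations on the sphere of radius `R` about the origin;
for `R > 1` this is equivalence from outside. -/
def EquivOn (R : ℝ) (m m' : S2 → E3) : Prop :=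
  ∀ x : E3, ‖x‖ = R → potential m x = potential m' x

/-- The dipole induced magnetization with susceptibility `Q` and dipole direction `d`. -/
def induced (Q : S2 → ℝ) (d : S2) (x : S2) : E3 :=
  Q x • ((3 * inner ℝ (x : E3) (d : E3)) • (x : E3) - (d : E3))

/-- The fourth-order polynomial `T_{g,h,m₁}`, as a function of `d = (d₁, d₂, d₃)`. -/
def polyT (g : S2 → ℝ) (h : S2 → E3) (m₁ : S2 → ℝ) (d : E3) : ℝ :=
  (∑ i : Fin 3, ∑ j : Fin 3, ∑ k : Fin 3, ∑ l : Fin 3, d i * d j * d k * d l *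
      ∫ y : S2, y.1 i * y.1 j * y.1 k * y.1 l * |g y| ^ 2 ∂omega)
  + (∑ i : Fin 3, ∑ j : Fin 3, ∑ k : Fin 3, ∑ l : Fin 3, d i * d j * d k * d l *
      ∫ y : S2, y.1 i * y.1 j * h y k * h y l ∂omega)
  + 2 * (∑ i : Fin 3, ∑ j : Fin 3, ∑ k : Fin 3, ∑ l : Fin 3, d i * d j * d k * d l *
      ∫ y : S2, y.1 i * y.1 j * y.1 k * h y l * g y ∂omega)
  - 2 * (∑ i : Fin 3, ∑ j : Fin 3, d i * d j *
      ∫ y : S2, y.1 i * y.1 j * m₁ y * g y ∂omega)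
  - 2 * (∑ i : Fin 3, ∑ j : Fin 3, d i * d j *
      ∫ y : S2, y.1 i * h y j * m₁ y ∂omega)
  + ∫ y : S2, |m₁ y| ^ 2 ∂omega

/-- The function `P_{m,d}(x) = (x · m(x)) / (2 x · d)`. It is meant up to null sets; on the null set
`x · d = 0` the value below is `0`. -/
def ratioP (m : S2 → E3) (d : S2) (x : S2) : ℝ :=
  inner ℝ (x : E3) (m x) / (2 * inner ℝ (x : E3) (d : E3))

/-- The functions that enter the polynomial for the magnetization `m`: `m₁` and `m₂` are the first two
Helmholtz scalars of `m`, `h = ∇* m₁` and `g = 2 Δ* m₂ - m₁`. -/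
def IsPolyData (m : S2 → E3) (g : S2 → ℝ) (h : S2 → E3) (m₁ : S2 → ℝ) : Prop :=
  ∃ m₂ m₃ b : S2 → ℝ, IsHelmholtz m m₁ m₂ m₃ ∧ IsWeakGrad m₁ h ∧ IsWeakBeltrami m₂ b ∧
    g = fun x => 2 * b x - m₁ x

end DipoleSphere

end

namespace DipoleSphere

/-! Split a field `u` on the sphere into its normal part `u₁ = y · u` and its tangential part, with
weak surface divergence `w`. Integrating the tangential part by parts gives, off the sphere,
`V[u](x) = (|x|² - 1)/2 ∫ u₁ |x - y|⁻³ - ∫ (u₁/2 + w) |x - y|⁻¹`, up to the factor `1/(4π)`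
(`dipolePotential_eq`). So `V[u]` depends on `u₁` and `w` only.

Let `u` be the difference of the two magnetizations. It vanishes on the complement of the closure of
`Γ`, which is nonempty and open. If `V[u]` vanishes on `|x| = R`, it vanishes beyond that sphere by
the maximum principle, and then in the unit ball by analytic continuation through the hole in the
support. The representation at `x` and at its inversion `x/|x|²` gives two independent equations for
the two integrals, so both vanish near the origin (except at the origin itself). Expanding the
kernels recovers all moments of the densities, whence `u₁ = 0` and `w = 0`
(`ae_eq_zero_of_dipolePotential_eq_zero`).

With `k = ∇* Q` and `b` the surface divergence of the tangential part of `m`, equivalence therefore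
means `2 (d · x) Q = x · m` and `2 (d · x) Q - d · k = b` (`equivOn_induced_iff`). The first
equation forces `Q = ratioP m d`. For the second, `polyT` is the squared `L²` norm of `(d · y)² g +
(d · y)(d · h) - m₁` (`polyT_eq_integral_sq`). Inserting `m₁ = 2 (d · y) Q` and its gradient turns
this function into `-2 (d · y)²` times the defect of the second equation. As `d · y ≠ 0` almost
everywhere, `T(d) = 0` is exactly that equation (`polyT_eq_zero_iff`).

Existence of the Helmholtz scalars comes from orthogonal projection onto the closure of the smooth
gradients. A Poincaré inequality shows that the limits are still weak gradients. A tangential field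
orthogonal to all gradients and all rotated gradients is zero, by induction on its moments. The
Beltrami derivative of `m₂` is in `L²` because it is the divergence of the tangential part of an
`H₁` field. -/

instance : IsFiniteMeasure omega := by unfold omega; infer_instance

/-! ### Polar coordinates and pointwise geometry of the sphere -/

/-- Lebesgue measure is `dω` times `r² dr`. The Bochner integral of a product function factorizes
without integrability, so none is assumed. -/
lemma integral_eq_of_polar (F : E3 → ℝ) (η : ℝ → ℝ) (f : S2 → ℝ)
    (h : ∀ (r : ℝ) (y : S2), 0 < r → F (r • (y : E3)) = η r * f y) :
    ∫ x, F x = (∫ r in Set.Ioi (0 : ℝ), r ^ 2 * η r) * ∫ y, f y ∂omega := by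
  calc
    ∫ x, F x = ∫ x : ({(0)}ᶜ : Set E3), F x.1 ∂((volume : Measure E3).comap (↑)) := by
      rw [integral_subtype_comap (measurableSet_singleton _).compl fun x ↦ F x,
        restrict_compl_singleton]
    _ = ∫ x, f x.1 * η x.2 ∂omega.prod (.volumeIoiPow (Module.finrank ℝ E3 - 1)) := by
      have := (volume : Measure E3).measurePreserving_homeomorphUnitSphereProd.integral_comp
        (Homeomorph.measurableEmbedding _) (fun p : S2 × Set.Ioi (0 : ℝ) => f p.1 * η p.2)
      rw [omega, ← this]
      refine integral_congr_ae (Filter.Eventually.of_forall fun x => ?_)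
      have hx : (x : E3) ≠ 0 := x.2
      have h2 := h ‖(x : E3)‖ ((homeomorphUnitSphereProd E3) x).1 (norm_pos_iff.2 hx)
      have h3 : ‖(x : E3)‖ • (((homeomorphUnitSphereProd E3) x).1 : E3) = x := by
        simp [smul_smul, hx]
      rw [h3] at h2
      simp only [h2, homeomorphUnitSphereProd_apply_snd_coe]
      ring
    _ = (∫ y, f y ∂omega) * ∫ x : Set.Ioi (0 : ℝ), η x ∂.volumeIoiPow (Module.finrank ℝ E3 - 1) :=
      integral_prod_mul f (fun x : Set.Ioi (0 : ℝ) => η x)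
    _ = _ := by
      rw [mul_comm]
      congr 1
      have h2 : Module.finrank ℝ E3 - 1 = 2 := by simp
      simp only [Measure.volumeIoiPow, ENNReal.ofReal, h2]
      rw [integral_withDensity_eq_integral_smul, integral_subtype_comap measurableSet_Ioi
        fun a ↦ Real.toNNReal (a ^ 2) • η a]
      · refine setIntegral_congr_fun measurableSet_Ioi fun x hx => ?_
        simp only [NNReal.smul_def, smul_eq_mul]
        rw [Real.coe_toNNReal _ (by positivity)]
      · exact (measurable_subtype_coe.pow_const _).real_toNNReal

lemma norm_coe (y : S2) : ‖(y : E3)‖ = 1 := by simp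

lemma inner_self_coe (y : S2) : inner ℝ (y : E3) (y : E3) = 1 := by
  rw [real_inner_self_eq_norm_sq, norm_coe]; norm_num

lemma abs_inner_le (ξ : E3) (y : S2) : |inner ℝ ξ (y : E3)| ≤ ‖ξ‖ := by
  simpa [norm_coe] using abs_real_inner_le_norm ξ (y : E3)

/-- The cone over the great circle orthogonal to `d` lies in a plane, which is Lebesgue null. This
permits division by `x · d`. -/
lemma ae_inner_ne_zero (d : S2) : ∀ᵐ y : S2 ∂omega, inner ℝ (y : E3) (d : E3) ≠ 0 := by
  have hm : MeasurableSet {y : S2 | inner ℝ (y : E3) (d : E3) = 0} :=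
    (isClosed_eq (by fun_prop) continuous_const).measurableSet
  have h0 : omega {y : S2 | inner ℝ (y : E3) (d : E3) = 0} = 0 := by
    rw [omega, Measure.toSphere_apply' _ hm]
    have h1 : (volume : Measure E3) ((ℝ ∙ (d : E3))ᗮ : Submodule ℝ E3) = 0 := by
      refine Measure.addHaar_submodule _ _ fun h => ?_
      have : (d : E3) ∈ (ℝ ∙ (d : E3))ᗮ := h ▸ Submodule.mem_top
      rw [Submodule.mem_orthogonal_singleton_iff_inner_right, inner_self_coe] at this
      exact one_ne_zero this
    rw [measure_mono_null _ h1, mul_zero]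
    rintro _ ⟨r, -, _, ⟨y, hy, rfl⟩, rfl⟩
    simp only [SetLike.mem_coe, Submodule.mem_orthogonal_singleton_iff_inner_left, inner_smul_left]
    rw [show inner ℝ (y : E3) (d : E3) = 0 from hy, mul_zero]
  rw [ae_iff]; simpa using h0

lemma inner_eq_sum (v w : E3) : inner ℝ v w = v 0 * w 0 + v 1 * w 1 + v 2 * w 2 := by
  simp [PiLp.inner_apply, Fin.sum_univ_three]; ring

@[simp] lemma cross_zero_coord (v w : E3) : cross v w 0 = v 1 * w 2 - v 2 * w 1 := by
  simp [cross, crossProduct]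
@[simp] lemma cross_one_coord (v w : E3) : cross v w 1 = v 2 * w 0 - v 0 * w 2 := by
  simp [cross, crossProduct]
@[simp] lemma cross_two_coord (v w : E3) : cross v w 2 = v 0 * w 1 - v 1 * w 0 := by
  simp [cross, crossProduct]

lemma surfDiv_eq_of_hasFDerivAt {Φ : E3 → E3} {L : E3 →L[ℝ] E3} {x : S2} (h : HasFDerivAt Φ L x) :
    surfDiv Φ x = L (EuclideanSpace.single 0 1) 0 + L (EuclideanSpace.single 1 1) 1
      + L (EuclideanSpace.single 2 1) 2 - inner ℝ (x : E3) (L x) := by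
  simp [surfDiv, h.fderiv, Fin.sum_univ_three]

lemma inner_surfGrad_of_tangential (φ : E3 → ℝ) (x : S2) {v : E3} (hv : inner ℝ (x : E3) v = 0) :
    inner ℝ v (surfGrad φ x) = fderiv ℝ φ x v := by
  rw [surfGrad, inner_sub_right, inner_smul_right, real_inner_comm (x : E3) v, hv, mul_zero, sub_zero,
    real_inner_comm, gradient, InnerProductSpace.toDual_symm_apply]

lemma inner_coe_surfGrad (φ : E3 → ℝ) (x : S2) : inner ℝ (x : E3) (surfGrad φ x) = 0 := by
  rw [surfGrad, inner_sub_right, inner_smul_right, inner_self_coe]; ring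

lemma inner_surfGrad (φ : E3 → ℝ) (x : S2) (v : E3) :
    inner ℝ v (surfGrad φ x) = fderiv ℝ φ x (v - inner ℝ (x : E3) v • (x : E3)) := by
  rw [← inner_surfGrad_of_tangential φ x, inner_sub_left, inner_smul_left, inner_coe_surfGrad]
  · simp
  · rw [inner_sub_right, inner_smul_right, inner_self_coe]; ring

/-! ### The divergence theorem and explicit tangential fields -/

lemma integral_divergence_eq_zero {Ψ : E3 → E3} (hΨ : ContDiff ℝ 1 Ψ) (hc : HasCompactSupport Ψ) :
    ∫ x, ∑ i : Fin 3, (fderiv ℝ Ψ x (EuclideanSpace.single i 1)) i = 0 := by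
  have hcont (i : Fin 3) : Continuous fun x => fderiv ℝ Ψ x (EuclideanSpace.single i 1) :=
    (hΨ.continuous_fderiv one_ne_zero).clm_apply continuous_const
  have hint (i : Fin 3) : Integrable fun x => fderiv ℝ Ψ x (EuclideanSpace.single i 1) :=
    (hcont i).integrable_of_hasCompactSupport
      ((hc.fderiv ℝ).mono' fun x hx => subset_tsupport _ fun h => hx (by simp [h]))
  have hzero (i : Fin 3) : ∫ x, fderiv ℝ Ψ x (EuclideanSpace.single i 1) = 0 := by
    have := integral_smul_fderiv_eq_neg_fderiv_smul_of_integrable (𝕜 := ℝ) (μ := (volume : Measure E3))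
      (f := fun _ => 1) (g := Ψ) (v := EuclideanSpace.single i 1) (by simp) (by simpa using hint i)
      (by simpa using hΨ.continuous.integrable_of_hasCompactSupport hc)
      (fun x _ => differentiableAt_const _) (fun x _ => hΨ.differentiable one_ne_zero x)
    simpa using this
  rw [integral_finsetSum]
  · refine Finset.sum_eq_zero fun i _ => ?_
    have := (EuclideanSpace.proj (𝕜 := ℝ) i : E3 →L[ℝ] ℝ).integral_comp_comm (hint i)
    simpa [hzero i] using this
  · exact fun i _ => (EuclideanSpace.proj (𝕜 := ℝ) i : E3 →L[ℝ] ℝ).integrable_comp (hint i)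

/-- The divergence theorem on the sphere. -/
theorem integral_surfDiv_eq_zero {Φ : E3 → E3} (hΦ : ContDiff ℝ ∞ Φ)
    (ht : ∀ x : S2, inner ℝ (x : E3) (Φ x) = 0) : ∫ x, surfDiv Φ x ∂omega = 0 := by
  let η : ContDiffBump (1 : ℝ) := ⟨1 / 4, 1 / 2, by norm_num, by norm_num⟩
  -- Extend `Φ` constantly along rays and cut off to the shell `1/2 < |x| < 3/2`. The Euclidean
  -- divergence at `r y` is `(η r / r) * surfDiv Φ y`: the gradient of the cutoff is radial and
  -- meets the tangential `Φ`.
  set Ψ : E3 → E3 := fun x => η ‖x‖ • Φ (‖x‖⁻¹ • x) with hΨ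
  have hη0 : ∀ r, r ≤ 1 / 2 → η r = 0 := fun r hr => η.zero_of_le_dist (by
    rw [Real.dist_eq, abs_of_nonpos (by linarith)]; simp only [η]; linarith)
  have hη2 : ∀ r, 3 / 2 ≤ r → η r = 0 := fun r hr => η.zero_of_le_dist (by
    rw [Real.dist_eq, abs_of_nonneg (by linarith)]; simp only [η]; linarith)
  have hsmooth : ContDiff ℝ 1 Ψ := by
    rw [contDiff_iff_contDiffAt]
    intro x
    by_cases hx : x = 0
    · have : Ψ =ᶠ[𝓝 x] fun _ => 0 := by
        filter_upwards [Metric.ball_mem_nhds x (by norm_num : (0 : ℝ) < 1 / 2)] with y hy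
        rw [hx, mem_ball_zero_iff] at hy
        simp [hΨ, hη0 _ hy.le]
      exact contDiffAt_const.congr_of_eventuallyEq this
    · have h1 : ContDiffAt ℝ 1 (fun x : E3 => ‖x‖) x := contDiffAt_norm ℝ hx
      refine ContDiffAt.smul (η.contDiff.contDiffAt.comp x h1) ?_
      exact (hΦ.of_le (by simp)).contDiffAt.comp x
        ((h1.inv (norm_ne_zero_iff.2 hx)).smul contDiffAt_id)
  have hcomp : HasCompactSupport Ψ := HasCompactSupport.intro (isCompact_closedBall 0 2) fun x hx => by
    rw [mem_closedBall_zero_iff, not_le] at hx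
    simp [hΨ, hη2 ‖x‖ (by linarith)]
  have hpolar := integral_eq_of_polar
    (fun x => ∑ i : Fin 3, (fderiv ℝ Ψ x (EuclideanSpace.single i 1)) i) (fun r => η r / r)
    (surfDiv Φ) ?_
  · rw [integral_divergence_eq_zero hsmooth hcomp] at hpolar
    refine (mul_eq_zero.1 hpolar.symm).resolve_left (ne_of_gt ?_)
    have hcont : Continuous fun r : ℝ => r * η r := continuous_id.mul η.continuous
    have heq : ∀ r ∈ Set.Ioi (0 : ℝ), r ^ 2 * (η r / r) = r * η r := fun r hr => by
      field_simp [(Set.mem_Ioi.1 hr).ne']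
    rw [setIntegral_congr_fun measurableSet_Ioi heq,
      setIntegral_eq_integral_of_forall_compl_eq_zero fun r hr => by
        rw [hη0 r (by rw [Set.mem_Ioi, not_lt] at hr; linarith), mul_zero]]
    refine hcont.integral_pos_of_hasCompactSupport_nonneg_nonzero (η.hasCompactSupport.mul_left)
      (fun r => ?_) (x := 1) ?_
    · rcases le_total r (1 / 2) with h | h
      · simp [hη0 r h]
      · exact mul_nonneg (by linarith) η.nonneg
    · rw [η.one_of_mem_closedBall (Metric.mem_closedBall_self η.rIn_pos.le)]; norm_num
  · intro r y hr
    have hx : r • (y : E3) ≠ 0 := smul_ne_zero hr.ne' (norm_ne_zero_iff.1 (by simp))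
    have hnr : ‖r • (y : E3)‖ = r := by rw [norm_smul, norm_coe, mul_one, Real.norm_of_nonneg hr.le]
    have h1 : HasFDerivAt (fun x : E3 => ‖x‖) (innerSL ℝ (y : E3)) (r • (y : E3)) := by
      have := (hasStrictFDerivAt_norm_sq (r • (y : E3))).hasFDerivAt.sqrt
        (by simpa using ⟨hr.ne', norm_ne_zero_iff.1 (by simp)⟩)
      simp only [Real.sqrt_sq (norm_nonneg _), hnr] at this
      refine this.congr_fderiv ?_
      ext v
      simp [Real.sqrt_sq hr.le]
      field_simp
    have h2 : HasFDerivAt (fun x : E3 => ‖x‖⁻¹ • x)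
        (r⁻¹ • (ContinuousLinearMap.id ℝ E3 - (innerSL ℝ (y : E3)).smulRight (y : E3)))
        (r • (y : E3)) := by
      have h3 := ((hasDerivAt_inv (by rw [hnr]; exact hr.ne')).comp_hasFDerivAt _ h1).smul
        (hasFDerivAt_id (𝕜 := ℝ) (r • (y : E3)))
      refine h3.congr_fderiv ?_
      ext1 v
      simp only [hnr, neg_smul, add_apply, smul_apply,
        ContinuousLinearMap.smulRight_apply, neg_apply, innerSL_apply_apply,
        smul_eq_mul, sub_apply, ContinuousLinearMap.id_apply,
        Function.comp_apply, id_eq]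
      match_scalars <;> field_simp
    have hN : ‖r • (y : E3)‖⁻¹ • r • (y : E3) = y := by
      rw [hnr, smul_smul, inv_mul_cancel₀ hr.ne', one_smul]
    have h4 : HasFDerivAt Φ (fderiv ℝ Φ y) (‖r • (y : E3)‖⁻¹ • r • (y : E3)) := by
      rw [hN]; exact (hΦ.differentiable (by simp) y).hasFDerivAt
    have h5 : HasDerivAt η (deriv η r) ‖r • (y : E3)‖ := by
      rw [hnr]; exact ((η.contDiff (n := 1)).differentiable one_ne_zero r).hasDerivAt
    have h6 : HasFDerivAt Ψ _ (r • (y : E3)) := (h5.comp_hasFDerivAt _ h1).smul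
      (HasFDerivAt.comp (f := fun x : E3 => ‖x‖⁻¹ • x) _ h4 h2)
    have h7 := ht y
    rw [h6.fderiv, surfDiv_eq_of_hasFDerivAt (hΦ.differentiable (by simp) y).hasFDerivAt, hN]
    rw [inner_eq_sum] at h7 ⊢
    simp only [Fin.sum_univ_three, Function.comp_apply, hnr, add_apply, smul_apply,
      ContinuousLinearMap.comp_apply, ContinuousLinearMap.smulRight_apply, sub_apply,
      ContinuousLinearMap.id_apply, innerSL_apply_apply, map_smul, map_sub, PiLp.add_apply,
      PiLp.sub_apply, PiLp.smul_apply, smul_eq_mul, EuclideanSpace.inner_single_right,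
      conj_trivial, one_mul]
    linear_combination (deriv η r) * h7

lemma surfDiv_smul {φ : E3 → ℝ} {Ψ : E3 → E3} {x : S2} (hφ : DifferentiableAt ℝ φ x)
    (hΨ : DifferentiableAt ℝ Ψ x) :
    surfDiv (fun y => φ y • Ψ y) x = φ x * surfDiv Ψ x + inner ℝ (Ψ x) (surfGrad φ x) := by
  have h := hφ.hasFDerivAt.smul hΨ.hasFDerivAt
  have h1 : fderiv ℝ φ x (Ψ x) = Ψ x 0 * fderiv ℝ φ x (EuclideanSpace.single 0 1)
      + Ψ x 1 * fderiv ℝ φ x (EuclideanSpace.single 1 1)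
      + Ψ x 2 * fderiv ℝ φ x (EuclideanSpace.single 2 1) := by
    conv_lhs => rw [← (EuclideanSpace.basisFun (Fin 3) ℝ).sum_repr (Ψ x)]
    simp [Fin.sum_univ_three]
  rw [inner_surfGrad, map_sub, map_smul, h1, surfDiv_eq_of_hasFDerivAt hΨ.hasFDerivAt,
    surfDiv_eq_of_hasFDerivAt (Φ := fun y => φ y • Ψ y) h]
  simp only [add_apply, smul_apply, ContinuousLinearMap.smulRight_apply,
    PiLp.add_apply, PiLp.smul_apply, smul_eq_mul, inner_add_right, inner_smul_right]
  ring

/-- The tangential part, on the unit sphere, of the constant field `ξ`, as a smooth field. -/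
noncomputable def tangentField (ξ : E3) (y : E3) : E3 := inner ℝ y y • ξ - inner ℝ ξ y • y

lemma tangentField_coe (ξ : E3) (y : S2) :
    tangentField ξ y = ξ - inner ℝ ξ (y : E3) • (y : E3) := by
  rw [tangentField, inner_self_coe, one_smul]

lemma contDiff_tangentField (ξ : E3) : ContDiff ℝ ∞ (tangentField ξ) :=
  ((contDiff_id.inner ℝ contDiff_id).smul contDiff_const).sub
    ((contDiff_const.inner ℝ contDiff_id).smul contDiff_id)

/-- The factor `inner ℝ y y` in `tangentField` makes this hold on all of `ℝ³`, not only on the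
sphere. -/
lemma inner_tangentField (ξ y : E3) : inner ℝ y (tangentField ξ y) = 0 := by
  rw [tangentField, inner_sub_right, inner_smul_right, inner_smul_right, real_inner_comm ξ y]; ring

/-- `tangentField ξ` is the surface gradient of `ξ · y`, a spherical harmonic of degree one, with
Beltrami eigenvalue `-2`. -/
lemma surfDiv_tangentField (ξ : E3) (y : S2) :
    surfDiv (tangentField ξ) y = - 2 * inner ℝ ξ (y : E3) := by
  have h1 : HasFDerivAt (fun y : E3 => inner ℝ y y) (2 • innerSL ℝ (y : E3)) (y : E3) := by
    simpa [real_inner_self_eq_norm_sq] using (hasStrictFDerivAt_norm_sq (y : E3)).hasFDerivAt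
  have h2 : HasFDerivAt (fun y : E3 => inner ℝ ξ y) (innerSL ℝ ξ) (y : E3) :=
    (innerSL ℝ ξ).hasFDerivAt
  have h3 := (h1.smul_const ξ).sub (h2.smul (hasFDerivAt_id (𝕜 := ℝ) (y : E3)))
  have h4 := inner_self_coe y
  rw [surfDiv_eq_of_hasFDerivAt (Φ := tangentField ξ) h3]
  simp only [sub_apply, add_apply, smul_apply, ContinuousLinearMap.smulRight_apply,
    PiLp.add_apply, PiLp.sub_apply, PiLp.smul_apply, smul_eq_mul, inner_add_right, inner_sub_right,
    inner_smul_right, innerSL_apply_apply, ContinuousLinearMap.id_apply, id_eq, h4,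
    EuclideanSpace.inner_single_right, conj_trivial, one_mul, nsmul_eq_mul, real_inner_comm ξ]
  rw [inner_eq_sum] at h4 ⊢
  simp
  ring

/-- The rotated gradient `y × ∇φ(y)`. -/
noncomputable def rotGrad (φ : E3 → ℝ) (y : E3) : E3 := cross y (gradient φ y)

lemma inner_self_cross (y v : E3) : inner ℝ y (cross y v) = 0 := by
  rw [inner_eq_sum]; simp; ring

lemma cross_comm_inner (v w u : E3) : inner ℝ (cross v w) u = - inner ℝ w (cross v u) := by
  rw [inner_eq_sum, inner_eq_sum]; simp; ring

lemma rotGrad_coe (φ : E3 → ℝ) (y : S2) : rotGrad φ y = cross y (surfGrad φ y) := by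
  ext i; fin_cases i <;> simp [rotGrad, surfGrad] <;> ring

/-- The vector product as a bilinear map. -/
noncomputable def crossL : E3 →L[ℝ] E3 →L[ℝ] E3 :=
  LinearMap.toContinuousLinearMap <| (LinearMap.toContinuousLinearMap.toLinearMap) ∘ₗ
    LinearMap.mk₂ ℝ cross
      (fun _ _ _ => by ext i; fin_cases i <;> simp <;> ring)
      (fun _ _ _ => by ext i; fin_cases i <;> simp <;> ring)
      (fun _ _ _ => by ext i; fin_cases i <;> simp <;> ring)
      (fun _ _ _ => by ext i; fin_cases i <;> simp <;> ring)

lemma crossL_apply (v w : E3) : crossL v w = cross v w := rfl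

lemma contDiff_gradient {φ : E3 → ℝ} (hφ : ContDiff ℝ ∞ φ) : ContDiff ℝ ∞ (gradient φ) :=
  (InnerProductSpace.toDual ℝ E3).symm.contDiff.comp (hφ.fderiv_right (by simp))

lemma contDiff_rotGrad {φ : E3 → ℝ} (hφ : ContDiff ℝ ∞ φ) : ContDiff ℝ ∞ (rotGrad φ) :=
  (crossL.contDiff).clm_apply (contDiff_gradient hφ)

/-- Differentiating `y × ∇φ` gives `w ↦ w × ∇φ`, which is skew, and `w ↦ y × (Hess φ) w`, a skew map
after a symmetric one. Both have trace zero, and their normal contributions at `x` vanish. -/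
lemma surfDiv_rotGrad {φ : E3 → ℝ} (hφ : ContDiff ℝ ∞ φ) (x : S2) : surfDiv (rotGrad φ) x = 0 := by
  have hg := ((contDiff_gradient hφ).differentiable (by simp) (x : E3)).hasFDerivAt
  have h := (crossL.hasFDerivAt (x := (x : E3))).clm_apply hg
  have hsymm (v w : E3) : inner ℝ v (fderiv ℝ (gradient φ) x w)
      = inner ℝ w (fderiv ℝ (gradient φ) x v) := by
    have h2 (v w : E3) : inner ℝ v (fderiv ℝ (gradient φ) x w) = fderiv ℝ (fderiv ℝ φ) x w v := by
      have h3 : HasFDerivAt (gradient φ)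
          ((InnerProductSpace.toDual ℝ E3).symm.toContinuousLinearEquiv.toContinuousLinearMap ∘SL
            fderiv ℝ (fderiv ℝ φ) x) (x : E3) :=
        (InnerProductSpace.toDual ℝ E3).symm.toContinuousLinearEquiv.hasFDerivAt.comp _
          (((hφ.fderiv_right (m := ∞) (by simp)).differentiable (by simp) (x : E3)).hasFDerivAt)
      rw [h3.fderiv, real_inner_comm]
      exact InnerProductSpace.toDual_symm_apply
    rw [h2, h2]
    exact (hφ.contDiffAt.isSymmSndFDerivAt
      (by simpa using WithTop.coe_le_coe.2 (le_top : (2 : ℕ∞) ≤ ⊤))).eq _ _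
  rw [surfDiv_eq_of_hasFDerivAt (Φ := rotGrad φ) h]
  have h01 := hsymm (EuclideanSpace.single 0 1) (EuclideanSpace.single 1 1)
  have h02 := hsymm (EuclideanSpace.single 0 1) (EuclideanSpace.single 2 1)
  have h12 := hsymm (EuclideanSpace.single 1 1) (EuclideanSpace.single 2 1)
  simp only [EuclideanSpace.inner_single_left, conj_trivial, one_mul] at h01 h02 h12
  simp only [add_apply, ContinuousLinearMap.comp_apply, ContinuousLinearMap.flip_apply,
    crossL_apply, inner_add_right, inner_self_cross, PiLp.add_apply, cross_zero_coord,
    cross_one_coord, cross_two_coord]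
  simp [h01, h02, h12]

/-! ### Integrability on the sphere -/

section Integrability

variable {F : Type*} [NormedAddCommGroup F]

instance : omega.Regular := by unfold omega; infer_instance

lemma exists_norm_le_of_continuous {f : S2 → F} (hf : Continuous f) : ∃ C, ∀ x, ‖f x‖ ≤ C := by
  obtain ⟨C, hC⟩ := isCompact_univ.exists_bound_of_continuousOn hf.continuousOn
  exact ⟨C, fun x => hC x trivial⟩

lemma memLp_of_continuous [SecondCountableTopology F] {f : S2 → F} (hf : Continuous f)
    (p : ENNReal) : MemLp f p omega := by
  obtain ⟨C, hC⟩ := exists_norm_le_of_continuous hf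
  exact MemLp.of_bound hf.aestronglyMeasurable C (.of_forall hC)

lemma integrable_of_continuous [SecondCountableTopology F] {f : S2 → F} (hf : Continuous f) :
    Integrable f omega := memLp_one_iff_integrable.1 (memLp_of_continuous hf 1)

variable [NormedSpace ℝ F]

lemma memLp_smul_of_continuous {g : S2 → ℝ} {f : S2 → F} {p : ENNReal} (hg : Continuous g)
    (hf : MemLp f p omega) : MemLp (fun x => g x • f x) p omega :=
  hf.smul (memLp_of_continuous hg ⊤)

lemma memLp_mul_of_continuous {g : S2 → ℝ} {f : S2 → ℝ} {p : ENNReal} (hg : Continuous g)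
    (hf : MemLp f p omega) : MemLp (fun x => g x * f x) p omega :=
  memLp_smul_of_continuous hg hf

lemma memLp_smul_of_continuous_right [SecondCountableTopology F] {g : S2 → ℝ} {f : S2 → F}
    {p : ENNReal} (hg : MemLp g p omega) (hf : Continuous f) :
    MemLp (fun x => g x • f x) p omega :=
  (memLp_of_continuous hf ⊤).smul hg

lemma memLp_inner_of_continuous {h Φ : S2 → E3} {p : ENNReal} (hh : MemLp h p omega)
    (hΦ : Continuous Φ) : MemLp (fun x => inner ℝ (h x) (Φ x)) p omega := by
  obtain ⟨C, hC⟩ := exists_norm_le_of_continuous hΦ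
  refine hh.of_le_mul (c := C) (hh.1.inner hΦ.aestronglyMeasurable) (.of_forall fun x => ?_)
  rw [mul_comm]
  exact (norm_inner_le_norm _ _).trans (mul_le_mul_of_nonneg_left (hC x) (norm_nonneg _))

lemma integrable_inner_of_memLp {f g : S2 → E3} (hf : MemLp f 2 omega) (hg : MemLp g 2 omega) :
    Integrable (fun x => inner ℝ (f x) (g x)) omega :=
  (hf.norm.integrable_mul hg.norm).mono' (hf.1.inner hg.1)
    (.of_forall fun _ => norm_inner_le_norm _ _)

lemma integrable_mul_of_memLp {f g : S2 → ℝ} (hf : MemLp f 2 omega) (hg : MemLp g 2 omega) :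
    Integrable (fun x => f x * g x) omega := hf.integrable_mul hg

lemma integrable_mul_of_continuous {f g : S2 → ℝ} (hf : MemLp f 2 omega) (hg : Continuous g) :
    Integrable (fun x => f x * g x) omega := hf.integrable_mul (memLp_of_continuous hg 2)

lemma integrable_inner_of_continuous {f g : S2 → E3} (hf : MemLp f 2 omega) (hg : Continuous g) :
    Integrable (fun x => inner ℝ (f x) (g x)) omega :=
  integrable_inner_of_memLp hf (memLp_of_continuous hg 2)

lemma memLp_coord {h : S2 → E3} {p : ENNReal} (hh : MemLp h p omega) (i : Fin 3) :
    MemLp (fun x => h x i) p omega := by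
  have := hh.inner_const (𝕜 := ℝ) (EuclideanSpace.single i 1)
  simpa [EuclideanSpace.inner_single_right] using this

lemma memLp_of_coord {h : S2 → E3} {p : ENNReal} (hh : ∀ i, MemLp (fun x => h x i) p omega) :
    MemLp h p omega := by
  have : h = fun x => ∑ i : Fin 3, h x i • (EuclideanSpace.single i 1 : E3) := by
    funext x; ext i; fin_cases i <;> simp [Fin.sum_univ_three]
  rw [this]
  exact memLp_finsetSum _ fun i _ => memLp_smul_of_continuous_right (hh i) continuous_const

end Integrability

/-! ### Densities are determined by their moments -/

lemma continuous_inner_coe (ξ : E3) : Continuous fun y : S2 => inner ℝ ξ (y : E3) :=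
  continuous_const.inner continuous_subtype_val

/-- The exponential of a linear form, restricted to the sphere. -/
noncomputable def expForm (ξ : E3) : C(S2, ℝ) :=
  ⟨fun y => Real.exp (inner ℝ ξ (y : E3)), Real.continuous_exp.comp (continuous_inner_coe ξ)⟩

/-- The functions that are exponentials of linear forms make up a submonoid. -/
noncomputable def expFormSubmonoid : Submonoid C(S2, ℝ) where
  carrier := Set.range expForm
  mul_mem' := by
    rintro _ _ ⟨ξ, rfl⟩ ⟨η, rfl⟩
    exact ⟨ξ + η, by ext y; simp [expForm, inner_add_left, Real.exp_add]⟩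
  one_mem' := ⟨0, by ext y; simp [expForm]⟩

/-- Stone–Weierstrass. The form `ξ = x - y` separates `x` from `y`, as `ξ · x = ξ · y` means `|x -
y|² = 0`. -/
lemma adjoin_expForm_topologicalClosure :
    (Algebra.adjoin ℝ (expFormSubmonoid : Set C(S2, ℝ))).topologicalClosure = ⊤ := by
  refine ContinuousMap.subalgebra_topologicalClosure_eq_top_of_separatesPoints _ fun x y hxy => ?_
  refine ⟨expForm (x - y), ⟨expForm (x - y), Algebra.subset_adjoin ⟨_, rfl⟩, rfl⟩, fun h => hxy ?_⟩
  have h1 : inner ℝ ((x : E3) - y) (x : E3) = inner ℝ ((x : E3) - y) (y : E3) := Real.exp_injective h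
  rw [← sub_eq_zero, ← inner_sub_right, inner_self_eq_zero, sub_eq_zero] at h1
  exact Subtype.ext h1

/-- The exponential series may be integrated term by term, being dominated by `‖ξ‖ⁿ / n!` times `∫
|p|`. -/
lemma integral_mul_exp_eq_zero {p : S2 → ℝ} (hp : Integrable p omega)
    (h : ∀ (ξ : E3) (n : ℕ), ∫ y : S2, p y * inner ℝ ξ (y : E3) ^ n ∂omega = 0) (ξ : E3) :
    ∫ y : S2, p y * Real.exp (inner ℝ ξ (y : E3)) ∂omega = 0 := by
  have hint (n : ℕ) : Integrable (fun y : S2 => p y * inner ℝ ξ (y : E3) ^ n / n.factorial) omega :=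
    (memLp_one_iff_integrable.1 (by
      simpa [mul_comm] using memLp_mul_of_continuous ((continuous_inner_coe ξ).pow n)
        (memLp_one_iff_integrable.2 hp))).div_const _
  have hsum := hasSum_integral_of_summable_integral_norm hint ?_
  · have hexp (y : S2) : ∑' n : ℕ, p y * inner ℝ ξ (y : E3) ^ n / n.factorial
        = p y * Real.exp (inner ℝ ξ (y : E3)) := by
      rw [Real.exp_eq_exp_ℝ, ← (NormedSpace.expSeries_div_hasSum_exp _).tsum_eq, ← tsum_mul_left]
      simp [mul_div_assoc]
    simp only [hexp, integral_div, h, zero_div] at hsum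
    exact hsum.unique hasSum_zero
  · refine Summable.of_nonneg_of_le (fun n => by positivity) (fun n => ?_)
      ((Real.summable_pow_div_factorial ‖ξ‖).mul_right (∫ y, ‖p y‖ ∂omega))
    rw [← integral_const_mul]
    refine integral_mono (hint n).norm (hp.norm.const_mul _) fun y => ?_
    simp only [norm_div, norm_mul, norm_pow, Real.norm_eq_abs, Nat.abs_cast]
    have := abs_inner_le ξ y
    rw [mul_comm, mul_div_right_comm]
    gcongr

/-- Square-integrable functions on the sphere are determined by their moments. -/
theorem ae_eq_zero_of_moments {p : S2 → ℝ} (hp : MemLp p 2 omega)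
    (h : ∀ (ξ : E3) (n : ℕ), ∫ y : S2, p y * inner ℝ ξ (y : E3) ^ n ∂omega = 0) :
    ∀ᵐ y ∂omega, p y = 0 := by
  have hp1 : Integrable p omega := hp.integrable (by norm_num)
  have hspan : ∀ f ∈ Algebra.adjoin ℝ (expFormSubmonoid : Set C(S2, ℝ)),
      ∫ y, p y * f y ∂omega = 0 := by
    intro f hf
    -- Exponentials of linear forms are closed under products, so the algebra they generate is their
    -- linear span.
    rw [← Subalgebra.mem_toSubmodule, Algebra.adjoin_eq_span, Submonoid.closure_eq] at hf
    induction hf using Submodule.span_induction with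
    | mem x hx => obtain ⟨ξ, rfl⟩ := hx; exact integral_mul_exp_eq_zero hp1 h ξ
    | zero => simp
    | add f g _ _ hf hg =>
      simp only [ContinuousMap.add_apply, mul_add]
      rw [integral_add (integrable_mul_of_continuous hp f.continuous)
        (integrable_mul_of_continuous hp g.continuous), hf, hg, add_zero]
    | smul c f _ hf =>
      simp only [ContinuousMap.smul_apply, smul_eq_mul, mul_left_comm _ c]
      rw [integral_const_mul, hf, mul_zero]
  have hcont : ∀ f : C(S2, ℝ), ∫ y, p y * f y ∂omega = 0 := by
    intro f
    have hmem : f ∈ closure (Algebra.adjoin ℝ (expFormSubmonoid : Set C(S2, ℝ)) : Set C(S2, ℝ)) := by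
      rw [← Subalgebra.topologicalClosure_coe, adjoin_expForm_topologicalClosure]; trivial
    by_contra hne
    have hpos : 0 < ∫ y, ‖p y‖ ∂omega + 1 := by positivity
    obtain ⟨g, hg, hfg⟩ := Metric.mem_closure_iff.1 hmem
      (|∫ y, p y * f y ∂omega| / (∫ y, ‖p y‖ ∂omega + 1)) (by positivity)
    have h1 : ∫ y, p y * f y ∂omega = ∫ y, p y * (f y - g y) ∂omega := by
      simp only [mul_sub]
      rw [integral_sub (integrable_mul_of_continuous hp f.continuous)
        (integrable_mul_of_continuous hp g.continuous), hspan g hg, sub_zero]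
    have h2 : ‖∫ y, p y * (f y - g y) ∂omega‖ ≤ ∫ y, ‖p y‖ * dist f g ∂omega := by
      refine norm_integral_le_of_norm_le (hp1.norm.mul_const _) (.of_forall fun y => ?_)
      rw [norm_mul]
      gcongr
      rw [dist_eq_norm]
      exact (f - g).norm_coe_le_norm y
    rw [integral_mul_const, ← h1, Real.norm_eq_abs] at h2
    rw [lt_div_iff₀ hpos] at hfg
    nlinarith [dist_nonneg (x := f) (y := g)]
  have hzero : hp.toLp p = 0 := by
    refine Dense.eq_zero_of_inner_left ℝ
      (ContinuousMap.toLp_denseRange (p := 2) ℝ omega ℝ (by norm_num)) ?_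
    rintro _ ⟨f, rfl⟩
    rw [L2.inner_def, ← hcont f]
    refine integral_congr_ae ?_
    filter_upwards [hp.coeFn_toLp, ContinuousMap.coeFn_toLp (p := 2) (𝕜 := ℝ) omega f] with y h1 h2
    rw [h1, h2]
    simp [mul_comm]
  filter_upwards [hp.coeFn_toLp, Lp.coeFn_zero ℝ 2 omega] with y h1 h2
  rw [← h1, hzero, h2]; rfl

lemma ae_eq_zero_of_integral_contDiff {p : S2 → ℝ} (hp : MemLp p 2 omega)
    (h : ∀ φ : E3 → ℝ, ContDiff ℝ ∞ φ → ∫ y : S2, p y * φ y ∂omega = 0) :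
    ∀ᵐ y ∂omega, p y = 0 :=
  ae_eq_zero_of_moments hp fun ξ n => h (fun y => inner ℝ ξ y ^ n)
    ((contDiff_const.inner ℝ contDiff_id).pow n)

/-- Tangential square-integrable fields are determined by their moments. -/
theorem ae_eq_zero_of_vector_moments {k : S2 → E3} (hk : MemLp k 2 omega)
    (h : ∀ (ξ e : E3) (n : ℕ), ∫ y : S2, inner ℝ e (k y) * inner ℝ ξ (y : E3) ^ n ∂omega = 0) :
    ∀ᵐ y ∂omega, k y = 0 := by
  have h1 (i : Fin 3) : ∀ᵐ y ∂omega, k y i = 0 := by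
    refine ae_eq_zero_of_moments (memLp_coord hk i) fun ξ n => ?_
    have := h ξ (EuclideanSpace.single i 1) n
    simpa [EuclideanSpace.inner_single_left] using this
  filter_upwards [h1 0, h1 1, h1 2] with y h0 h1 h2
  ext i; fin_cases i <;> simp [h0, h1, h2]

/-! ### Calculus of weak surface gradients and divergences -/

lemma continuous_gradient {φ : E3 → ℝ} (hφ : ContDiff ℝ ∞ φ) : Continuous (gradient φ) :=
  (contDiff_gradient hφ).continuous

lemma continuous_surfGrad {φ : E3 → ℝ} (hφ : ContDiff ℝ ∞ φ) : Continuous (surfGrad φ) := by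
  have h : Continuous fun x : S2 => gradient φ x :=
    (continuous_gradient hφ).comp continuous_subtype_val
  exact h.sub ((continuous_subtype_val.inner h).fun_smul continuous_subtype_val)

lemma continuous_surfDiv {Φ : E3 → E3} (hΦ : ContDiff ℝ ∞ Φ) : Continuous (surfDiv Φ) := by
  have h : Continuous fun x : S2 => fderiv ℝ Φ x :=
    (hΦ.continuous_fderiv (by simp)).comp continuous_subtype_val
  refine Continuous.sub (continuous_finsetSum _ fun i _ => ?_)
    (continuous_subtype_val.inner (h.clm_apply continuous_subtype_val))
  exact (EuclideanSpace.proj (𝕜 := ℝ) i).continuous.comp (h.clm_apply continuous_const)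

lemma continuous_coe_comp {F : Type*} [NormedAddCommGroup F] [NormedSpace ℝ F] {φ : E3 → F}
    (hφ : ContDiff ℝ ∞ φ) : Continuous fun x : S2 => φ x :=
  hφ.continuous.comp continuous_subtype_val

lemma norm_cross_le (v w : E3) : ‖cross v w‖ ≤ ‖v‖ * ‖w‖ := by
  refine abs_le_of_sq_le_sq' ?_ (by positivity) |>.2
  rw [mul_pow, ← real_inner_self_eq_norm_sq, ← real_inner_self_eq_norm_sq,
    ← real_inner_self_eq_norm_sq, inner_eq_sum, inner_eq_sum, inner_eq_sum]
  simp only [cross_zero_coord, cross_one_coord, cross_two_coord]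
  nlinarith [sq_nonneg (v 0 * w 0 + v 1 * w 1 + v 2 * w 2)]

lemma memLp_cross {h : S2 → E3} (hh : MemLp h 2 omega) :
    MemLp (fun x : S2 => cross x (h x)) 2 omega := by
  refine hh.of_le ?_ (.of_forall fun x => ?_)
  · have : Continuous fun p : E3 × E3 => crossL p.1 p.2 :=
      (crossL.continuous.comp continuous_fst).clm_apply continuous_snd
    exact this.comp_aestronglyMeasurable
      (continuous_subtype_val.aestronglyMeasurable.prodMk hh.1)
  · simpa using norm_cross_le (x : E3) (h x)

lemma cross_cross_of_tangential {x : S2} {v : E3} (hv : inner ℝ (x : E3) v = 0) :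
    cross x (cross x v) = - v := by
  have h := inner_self_coe x
  rw [inner_eq_sum] at h hv
  ext i
  fin_cases i <;> simp
  · linear_combination (x : E3) 0 * hv - v 0 * h
  · linear_combination (x : E3) 1 * hv - v 1 * h
  · linear_combination (x : E3) 2 * hv - v 2 * h

lemma surfGrad_inner (d : E3) (x : S2) :
    surfGrad (fun y => inner ℝ d y) x = tangentField d x := by
  have : gradient (fun y => inner ℝ d y) (x : E3) = d := by
    refine HasGradientAt.gradient ?_
    exact (innerSL ℝ d).hasFDerivAt
  rw [surfGrad, this, tangentField_coe, real_inner_comm]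

lemma inner_tangentField_of_tangential (ξ : E3) {x : S2} {v : E3} (hv : inner ℝ (x : E3) v = 0) :
    inner ℝ v (tangentField ξ x) = inner ℝ ξ v := by
  rw [tangentField_coe, inner_sub_right, inner_smul_right, real_inner_comm (x : E3) v, hv,
    real_inner_comm]
  ring

lemma IsWeakGrad.congr {f f' : S2 → ℝ} {h h' : S2 → E3} (H : IsWeakGrad f h)
    (hf : f =ᵐ[omega] f') (hh : h =ᵐ[omega] h') : IsWeakGrad f' h' where
  memLp_fun := (memLp_congr_ae hf).1 H.memLp_fun
  memLp_grad := (memLp_congr_ae hh).1 H.memLp_grad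
  tangential := by filter_upwards [H.tangential, hh] with x h1 h2; rw [← h2, h1]
  integral_eq Φ hΦ ht := by
    have h1 := H.integral_eq Φ hΦ ht
    rw [integral_congr_ae (g := fun x => f' x * surfDiv Φ x)
      (by filter_upwards [hf] with x h2; rw [h2]), integral_congr_ae (f := fun x => inner ℝ (h x) _)
      (g := fun x : S2 => inner ℝ (h' x) (Φ x)) (by filter_upwards [hh] with x h2; rw [h2])] at h1
    exact h1

lemma IsWeakDiv.congr {h h' : S2 → E3} {g g' : S2 → ℝ} (H : IsWeakDiv h g)
    (hh : h =ᵐ[omega] h') (hg : g =ᵐ[omega] g') : IsWeakDiv h' g' where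
  memLp_field := (memLp_congr_ae hh).1 H.memLp_field
  memLp_div := (memLp_congr_ae hg).1 H.memLp_div
  tangential := by filter_upwards [H.tangential, hh] with x h1 h2; rw [← h2, h1]
  integral_eq φ hφ := by
    have h1 := H.integral_eq φ hφ
    rw [integral_congr_ae (g := fun x => inner ℝ (h' x) (surfGrad φ x))
      (by filter_upwards [hh] with x h2; rw [h2]), integral_congr_ae (f := fun x : S2 => g x * φ x)
      (g := fun x : S2 => g' x * φ x) (by filter_upwards [hg] with x h2; rw [h2])] at h1
    exact h1

/-- Testing with `(ξ · y)ⁿ tangentField e` reads off the moments of `e · h`, because `h` is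
tangential. -/
lemma IsWeakGrad.unique {f : S2 → ℝ} {h h' : S2 → E3} (H : IsWeakGrad f h)
    (H' : IsWeakGrad f h') : h =ᵐ[omega] h' := by
  have hk : MemLp (fun x => h x - h' x) 2 omega := H.memLp_grad.sub H'.memLp_grad
  have : ∀ᵐ x ∂omega, h x - h' x = 0 := by
    refine ae_eq_zero_of_vector_moments hk fun ξ e n => ?_
    have hsm : ContDiff ℝ ∞ fun y : E3 => inner ℝ ξ y ^ n • tangentField e y :=
      ((contDiff_const.inner ℝ contDiff_id).pow n).smul (contDiff_tangentField e)
    have htan : ∀ x : S2, inner ℝ (x : E3) (inner ℝ ξ (x : E3) ^ n • tangentField e (x : E3)) = 0 :=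
      fun x => by rw [inner_smul_right, inner_tangentField, mul_zero]
    have h1 := H.integral_eq _ hsm htan
    rw [H'.integral_eq _ hsm htan, neg_inj] at h1
    have h2 : ∫ y : S2, inner ℝ e (h y - h' y) * inner ℝ ξ (y : E3) ^ n ∂omega
        = ∫ x : S2, (inner ℝ (h x) (inner ℝ ξ (x : E3) ^ n • tangentField e (x : E3))
          - inner ℝ (h' x) (inner ℝ ξ (x : E3) ^ n • tangentField e (x : E3))) ∂omega := by
      refine integral_congr_ae ?_
      filter_upwards [H.tangential, H'.tangential] with x h3 h4
      rw [inner_smul_right, inner_smul_right, inner_tangentField_of_tangential e h3,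
        inner_tangentField_of_tangential e h4, inner_sub_right]
      ring
    rw [h2, integral_sub (integrable_inner_of_continuous H.memLp_grad (continuous_coe_comp hsm))
      (integrable_inner_of_continuous H'.memLp_grad (continuous_coe_comp hsm)), h1, sub_self]
  filter_upwards [this] with x hx using sub_eq_zero.1 hx

lemma IsWeakDiv.unique {h : S2 → E3} {g g' : S2 → ℝ} (H : IsWeakDiv h g) (H' : IsWeakDiv h g') :
    g =ᵐ[omega] g' := by
  have : ∀ᵐ x ∂omega, g x - g' x = 0 := by
    refine ae_eq_zero_of_integral_contDiff (H.memLp_div.sub H'.memLp_div) fun φ hφ => ?_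
    have h1 := H.integral_eq φ hφ
    rw [H'.integral_eq φ hφ, neg_inj] at h1
    simp only [sub_mul]
    rw [integral_sub (integrable_mul_of_continuous H.memLp_div (continuous_coe_comp hφ))
      (integrable_mul_of_continuous H'.memLp_div (continuous_coe_comp hφ)), h1, sub_self]
  filter_upwards [this] with x hx using sub_eq_zero.1 hx

lemma IsWeakGrad.add {f f' : S2 → ℝ} {h h' : S2 → E3} (H : IsWeakGrad f h)
    (H' : IsWeakGrad f' h') : IsWeakGrad (fun x => f x + f' x) (fun x => h x + h' x) where
  memLp_fun := H.memLp_fun.add H'.memLp_fun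
  memLp_grad := H.memLp_grad.add H'.memLp_grad
  tangential := by
    filter_upwards [H.tangential, H'.tangential] with x h1 h2
    rw [inner_add_right, h1, h2, add_zero]
  integral_eq Φ hΦ ht := by
    simp only [add_mul, inner_add_left]
    rw [integral_add (integrable_mul_of_continuous H.memLp_fun (continuous_surfDiv hΦ))
      (integrable_mul_of_continuous H'.memLp_fun (continuous_surfDiv hΦ)),
      integral_add (integrable_inner_of_continuous H.memLp_grad (continuous_coe_comp hΦ))
      (integrable_inner_of_continuous H'.memLp_grad (continuous_coe_comp hΦ)),
      H.integral_eq Φ hΦ ht, H'.integral_eq Φ hΦ ht, neg_add]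

lemma IsWeakDiv.sub {h h' : S2 → E3} {g g' : S2 → ℝ} (H : IsWeakDiv h g) (H' : IsWeakDiv h' g') :
    IsWeakDiv (fun x => h x - h' x) (fun x => g x - g' x) where
  memLp_field := H.memLp_field.sub H'.memLp_field
  memLp_div := H.memLp_div.sub H'.memLp_div
  tangential := by
    filter_upwards [H.tangential, H'.tangential] with x h1 h2
    rw [inner_sub_right, h1, h2, sub_zero]
  integral_eq φ hφ := by
    simp only [sub_mul, inner_sub_left]
    rw [integral_sub (integrable_mul_of_continuous H.memLp_div (continuous_coe_comp hφ))
      (integrable_mul_of_continuous H'.memLp_div (continuous_coe_comp hφ)),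
      integral_sub (integrable_inner_of_continuous H.memLp_field (continuous_surfGrad hφ))
      (integrable_inner_of_continuous H'.memLp_field (continuous_surfGrad hφ)),
      H.integral_eq φ hφ, H'.integral_eq φ hφ]
    ring

lemma surfDiv_smul_of_contDiff {φ : E3 → ℝ} {Ψ : E3 → E3} (hφ : ContDiff ℝ ∞ φ)
    (hΨ : ContDiff ℝ ∞ Ψ) (x : S2) :
    surfDiv (fun y => φ y • Ψ y) x = φ x * surfDiv Ψ x + inner ℝ (Ψ x) (surfGrad φ x) :=
  surfDiv_smul (hφ.differentiable (by simp) _) (hΨ.differentiable (by simp) _)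

/-- Smooth functions are weakly differentiable. -/
theorem isWeakGrad_of_contDiff {φ : E3 → ℝ} (hφ : ContDiff ℝ ∞ φ) :
    IsWeakGrad (fun x => φ x) (surfGrad φ) where
  memLp_fun := memLp_of_continuous (continuous_coe_comp hφ) 2
  memLp_grad := memLp_of_continuous (continuous_surfGrad hφ) 2
  tangential := .of_forall fun x => inner_coe_surfGrad φ x
  integral_eq Φ hΦ ht := by
    have h := integral_surfDiv_eq_zero (hφ.smul hΦ) fun x => by
      rw [Pi.smul_apply', inner_smul_right, ht x, mul_zero]
    have h1 (x : S2) : surfDiv (φ • Φ) x = _ := surfDiv_smul_of_contDiff hφ hΦ x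
    simp only [h1] at h
    rw [integral_add (integrable_of_continuous
        ((continuous_coe_comp hφ).fun_mul (continuous_surfDiv hΦ)))
      (integrable_of_continuous ((continuous_coe_comp hΦ).inner (continuous_surfGrad hφ)))] at h
    simp only [real_inner_comm] at h ⊢
    linarith

/-- The product rule. -/
theorem IsWeakGrad.mul_contDiff {f : S2 → ℝ} {h : S2 → E3} (H : IsWeakGrad f h) {φ : E3 → ℝ}
    (hφ : ContDiff ℝ ∞ φ) :
    IsWeakGrad (fun x => φ x * f x) (fun x => φ x • h x + f x • surfGrad φ x) where
  memLp_fun := memLp_mul_of_continuous (continuous_coe_comp hφ) H.memLp_fun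
  memLp_grad := (memLp_smul_of_continuous (continuous_coe_comp hφ) H.memLp_grad).add
    (memLp_smul_of_continuous_right H.memLp_fun (continuous_surfGrad hφ))
  tangential := by
    filter_upwards [H.tangential] with x h1
    rw [inner_add_right, inner_smul_right, inner_smul_right, h1, inner_coe_surfGrad]; ring
  integral_eq Φ hΦ ht := by
    have h1 := H.integral_eq (fun y => φ y • Φ y) (hφ.smul hΦ) fun x => by
      rw [inner_smul_right, ht x, mul_zero]
    have i1 := integrable_mul_of_continuous H.memLp_fun
      ((continuous_coe_comp hφ).fun_mul (continuous_surfDiv hΦ))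
    have i2 := integrable_mul_of_continuous H.memLp_fun
      ((continuous_coe_comp hΦ).inner (continuous_surfGrad hφ))
    have i3 := integrable_inner_of_continuous H.memLp_grad
      ((continuous_coe_comp hφ).fun_smul (continuous_coe_comp hΦ))
    simp only [surfDiv_smul_of_contDiff hφ hΦ, mul_add] at h1
    rw [integral_add i1 i2] at h1
    simp only [inner_add_left, inner_smul_left, inner_smul_right, conj_trivial] at h1 i3 ⊢
    rw [integral_add i3 (by simpa only [real_inner_comm] using i2)]
    simp only [real_inner_comm (surfGrad φ _), mul_assoc, mul_left_comm (φ _)] at h1 ⊢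
    linarith

/-- The map `v ↦ x × v` is skew, so it moves onto the test gradient and makes it `rotGrad φ`, which
is divergence free. -/
lemma IsWeakGrad.rot {f : S2 → ℝ} {h : S2 → E3} (H : IsWeakGrad f h) :
    IsWeakDiv (fun x => cross x (h x)) (fun _ => 0) where
  memLp_field := memLp_cross H.memLp_grad
  tangential := .of_forall fun x => inner_self_cross _ _
  memLp_div := memLp_of_continuous continuous_const 2
  integral_eq φ hφ := by
    have h1 := H.integral_eq (rotGrad φ) (contDiff_rotGrad hφ) fun x => inner_self_cross _ _
    simp only [surfDiv_rotGrad hφ, rotGrad_coe, mul_zero, integral_zero] at h1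
    simp only [cross_comm_inner, integral_neg, ← h1]
    simp

/-- The tangential part of a Sobolev field has a weak surface divergence. -/
theorem isWeakDiv_tangential {m : S2 → E3} {h : Fin 3 → S2 → E3}
    (H : ∀ i, IsWeakGrad (fun x => m x i) (h i)) :
    IsWeakDiv (fun x => m x - inner ℝ (x : E3) (m x) • (x : E3))
      (fun x => h 0 x 0 + h 1 x 1 + h 2 x 2 - 2 * inner ℝ (x : E3) (m x)) := by
  have hm : MemLp m 2 omega := memLp_of_coord fun i => (H i).memLp_fun
  have hm1 : MemLp (fun x : S2 => inner ℝ (x : E3) (m x)) 2 omega := by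
    simpa only [real_inner_comm] using memLp_inner_of_continuous hm continuous_subtype_val
  have hh (i : Fin 3) := memLp_coord (H i).memLp_grad i
  refine ⟨hm.sub (memLp_smul_of_continuous_right hm1 continuous_subtype_val),
    .of_forall fun x => ?_, (((hh 0).add (hh 1)).add (hh 2)).sub (hm1.const_mul 2), fun φ hφ => ?_⟩
  · rw [inner_sub_right, inner_smul_right, inner_self_coe]; ring
  have hcφ := continuous_coe_comp hφ
  -- The test field for the component `mᵢ` is `φ` times the tangential part of `eᵢ`, whose surface
  -- divergence is `(∇* φ)ᵢ - 2 xᵢ φ`. Summing over `i` yields the trace of the gradients and the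
  -- term with `x · m`.
  have key (i : Fin 3) : ∫ x, m x i * surfGrad φ x i ∂omega
      = - ∫ x : S2, h i x i * φ x ∂omega + 2 * ∫ x : S2, m x i * ((x : E3) i * φ x) ∂omega := by
    have hsm := hφ.fun_smul (contDiff_tangentField (EuclideanSpace.single i 1))
    have h1 := (H i).integral_eq (fun y => φ y • tangentField (EuclideanSpace.single i 1) y) hsm
      fun x => by rw [inner_smul_right, inner_tangentField, mul_zero]
    have h2 (x : S2) : surfGrad φ x i
        = surfDiv (fun y => φ y • tangentField (EuclideanSpace.single i 1) y) x
          + 2 * ((x : E3) i * φ x) := by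
      rw [surfDiv_smul_of_contDiff hφ (contDiff_tangentField _), surfDiv_tangentField,
        real_inner_comm (surfGrad φ x), inner_tangentField_of_tangential _ (inner_coe_surfGrad φ x)]
      simp [EuclideanSpace.inner_single_left]
      ring
    simp only [h2, mul_add]
    have h3 : ∫ x : S2, inner ℝ (h i x) (φ x • tangentField (EuclideanSpace.single i 1) (x : E3))
        ∂omega = ∫ x : S2, h i x i * φ x ∂omega := by
      refine integral_congr_ae ?_
      filter_upwards [(H i).tangential] with x hx
      rw [inner_smul_right, inner_tangentField_of_tangential _ hx]
      simp [EuclideanSpace.inner_single_left, mul_comm]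
    rw [integral_add (integrable_mul_of_continuous (H i).memLp_fun (continuous_surfDiv hsm)), h1, h3,
      ← integral_const_mul]
    · simp only [mul_left_comm (2 : ℝ)]
    · simp only [mul_left_comm _ (2 : ℝ)]
      refine (integrable_mul_of_continuous (H i).memLp_fun (Continuous.mul ?_ hcφ)).const_mul 2
      exact (EuclideanSpace.proj (𝕜 := ℝ) i).continuous.comp continuous_subtype_val
  have hlhs (x : S2) : inner ℝ (m x - inner ℝ (x : E3) (m x) • (x : E3)) (surfGrad φ x)
      = m x 0 * surfGrad φ x 0 + m x 1 * surfGrad φ x 1 + m x 2 * surfGrad φ x 2 := by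
    rw [inner_sub_left, inner_smul_left, inner_coe_surfGrad, inner_eq_sum]; simp
  have ig (i : Fin 3) : Integrable (fun x => m x i * surfGrad φ x i) omega :=
    integrable_mul_of_continuous (H i).memLp_fun
      ((EuclideanSpace.proj (𝕜 := ℝ) i).continuous.comp (continuous_surfGrad hφ))
  have ih (i : Fin 3) : Integrable (fun x : S2 => h i x i * φ x) omega :=
    integrable_mul_of_continuous (hh i) hcφ
  have im (i : Fin 3) : Integrable (fun x : S2 => m x i * ((x : E3) i * φ x)) omega :=
    integrable_mul_of_continuous (H i).memLp_fun
      (((EuclideanSpace.proj (𝕜 := ℝ) i).continuous.comp continuous_subtype_val).mul hcφ)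
  have hrhs (x : S2) : (h 0 x 0 + h 1 x 1 + h 2 x 2 - 2 * inner ℝ (x : E3) (m x)) * φ x
      = h 0 x 0 * φ x + h 1 x 1 * φ x + h 2 x 2 * φ x - 2 * (m x 0 * ((x : E3) 0 * φ x)
        + m x 1 * ((x : E3) 1 * φ x) + m x 2 * ((x : E3) 2 * φ x)) := by
    rw [inner_eq_sum]; ring
  simp only [hlhs, hrhs]
  rw [integral_add ((ig 0).fun_add (ig 1)) (ig 2), integral_add (ig 0) (ig 1), key 0, key 1, key 2,
    integral_sub (((ih 0).fun_add (ih 1)).fun_add (ih 2)) ((((im 0).fun_add (im 1)).fun_add (im 2)).const_mul 2),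
    integral_const_mul,
    integral_add ((ih 0).fun_add (ih 1)) (ih 2), integral_add (ih 0) (ih 1),
    integral_add ((im 0).fun_add (im 1)) (im 2), integral_add (im 0) (im 1)]
  ring

/-- The weak divergence of the product of a Sobolev function with the tangential part of a constant
field. -/
theorem IsWeakGrad.isWeakDiv_smul_tangentField {f : S2 → ℝ} {h : S2 → E3} (H : IsWeakGrad f h)
    (d : E3) : IsWeakDiv (fun x => f x • tangentField d x)
      (fun x => inner ℝ d (h x) - 2 * (f x * inner ℝ d (x : E3))) where
  memLp_field := memLp_smul_of_continuous_right H.memLp_fun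
    (continuous_coe_comp (contDiff_tangentField d))
  tangential := .of_forall fun x => by rw [inner_smul_right, inner_tangentField, mul_zero]
  memLp_div := by
    refine (H.memLp_grad.const_inner d).sub (MemLp.const_mul ?_ 2)
    simpa only [mul_comm] using memLp_mul_of_continuous (continuous_inner_coe d) H.memLp_fun
  integral_eq φ hφ := by
    have hsm := hφ.fun_smul (contDiff_tangentField d)
    have h1 := H.integral_eq (fun y => φ y • tangentField d y) hsm fun x => by
      rw [inner_smul_right, inner_tangentField, mul_zero]
    have i1 : Integrable (fun x : S2 => f x * (2 * (φ x * inner ℝ d (x : E3)))) omega :=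
      integrable_mul_of_continuous H.memLp_fun (continuous_const.mul
      ((continuous_coe_comp hφ).fun_mul (continuous_inner_coe d)))
    have i2 := integrable_inner_of_continuous H.memLp_grad (continuous_coe_comp hsm)
    have h2 : ∫ x : S2, (inner ℝ d (h x) - 2 * (f x * inner ℝ d (x : E3))) * φ x ∂omega
        = ∫ x : S2, inner ℝ (h x) (φ x • tangentField d (x : E3)) ∂omega
          - ∫ x : S2, f x * (2 * (φ x * inner ℝ d (x : E3))) ∂omega := by
      rw [← integral_sub i2 i1]
      refine integral_congr_ae ?_
      filter_upwards [H.tangential] with x hx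
      rw [inner_smul_right, inner_tangentField_of_tangential _ hx]
      ring
    rw [h2, neg_sub, sub_eq_add_neg, ← h1, add_comm,
      ← integral_add (integrable_mul_of_continuous H.memLp_fun (continuous_surfDiv hsm)) i1]
    refine integral_congr_ae (.of_forall fun x => ?_)
    simp only [surfDiv_smul_of_contDiff hφ (contDiff_tangentField d), surfDiv_tangentField,
      inner_smul_left, conj_trivial]
    ring

/-! ### Ridge functions `f (ξ · y)` as test functions -/

/-- The kernels used below are singular at `s = c`, while weak derivatives are tested with functions
smooth on `ℝ³`. A cutoff between `a` and `c` repairs this. Agreement on neighbourhoods, not merely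
at points, carries over to derivatives. -/
lemma exists_contDiff_extension {f : ℝ → ℝ} {a c : ℝ} (hac : a < c)
    (hf : ContDiffOn ℝ ∞ f (Set.Iio c)) :
    ∃ ψ : ℝ → ℝ, ContDiff ℝ ∞ ψ ∧ ∀ s ≤ a, ψ =ᶠ[𝓝 s] f := by
  obtain ⟨b, hab, hbc⟩ := exists_between hac
  obtain ⟨b', hbb', hbc'⟩ := exists_between hbc
  refine ⟨fun s => Real.smoothTransition ((b' - s) / (b' - b)) * f s, ?_, fun s hs => ?_⟩
  · rw [contDiff_iff_contDiffAt]
    intro s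
    rcases lt_or_ge s c with h | h
    · refine ContDiffAt.mul ?_ (hf.contDiffAt (Iio_mem_nhds h))
      exact Real.smoothTransition.contDiff.contDiffAt.comp s
        ((contDiffAt_const.sub contDiffAt_id).div_const _)
    · refine (contDiffAt_const (c := (0 : ℝ))).congr_of_eventuallyEq ?_
      filter_upwards [Ioi_mem_nhds (hbc'.trans_le h)] with t ht
      rw [Real.smoothTransition.zero_of_nonpos, zero_mul]
      exact div_nonpos_of_nonpos_of_nonneg (by linarith [Set.mem_Ioi.1 ht]) (by linarith)
  · filter_upwards [Iio_mem_nhds (hs.trans_lt hab)] with t ht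
    rw [Real.smoothTransition.one_of_one_le, one_mul]
    rw [one_le_div (by linarith)]
    linarith [Set.mem_Iio.1 ht]

lemma surfGrad_ridge {ψ : ℝ → ℝ} {ψ' : ℝ} (ξ : E3) (x : S2)
    (h : HasDerivAt ψ ψ' (inner ℝ ξ (x : E3))) :
    surfGrad (fun y => ψ (inner ℝ ξ y)) x = ψ' • tangentField ξ x := by
  have : gradient (fun y => ψ (inner ℝ ξ y)) (x : E3) = ψ' • ξ := by
    refine HasGradientAt.gradient (hasGradientAt_iff_hasFDerivAt.2 ?_)
    refine (h.comp_hasFDerivAt (x : E3) (innerSL ℝ ξ).hasFDerivAt).congr_fderiv ?_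
    ext v; simp
  rw [surfGrad, this, tangentField_coe, inner_smul_right, real_inner_comm, smul_sub, mul_smul]

lemma inner_le_norm_coe (ξ : E3) (y : S2) : inner ℝ ξ (y : E3) ≤ ‖ξ‖ :=
  (le_abs_self _).trans (abs_inner_le ξ y)

lemma contDiff_ridge {ψ : ℝ → ℝ} (hψ : ContDiff ℝ ∞ ψ) (ξ : E3) :
    ContDiff ℝ ∞ fun y : E3 => ψ (inner ℝ ξ y) :=
  hψ.comp (contDiff_const.inner ℝ contDiff_id)

/-- Weak divergences tested against ridge functions. -/
theorem IsWeakDiv.integral_ridge {v : S2 → E3} {w : S2 → ℝ} (H : IsWeakDiv v w) {ξ : E3} {c : ℝ}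
    (hξ : ‖ξ‖ < c) {f f' : ℝ → ℝ} (hf : ContDiffOn ℝ ∞ f (Set.Iio c))
    (hf' : ∀ s < c, HasDerivAt f (f' s) s) :
    ∫ y : S2, f' (inner ℝ ξ (y : E3)) * inner ℝ ξ (v y) ∂omega
      = - ∫ y : S2, w y * f (inner ℝ ξ (y : E3)) ∂omega := by
  obtain ⟨ψ, hψ, hψf⟩ := exists_contDiff_extension hξ hf
  have h := H.integral_eq _ (contDiff_ridge hψ ξ)
  have hs (y : S2) := inner_le_norm_coe ξ y
  simp only [fun y : S2 => (hψf _ (hs y)).eq_of_nhds] at h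
  rw [← h]
  refine integral_congr_ae ?_
  filter_upwards [H.tangential] with y hy
  rw [surfGrad_ridge ξ y ((hf' _ ((hs y).trans_lt hξ)).congr_of_eventuallyEq (hψf _ (hs y))),
    inner_smul_right, inner_tangentField_of_tangential _ hy]

/-- Weak gradients tested against the gradients of ridge functions. -/
theorem IsWeakGrad.integral_ridge {φ : S2 → ℝ} {h : S2 → E3} (H : IsWeakGrad φ h) {ξ : E3} {c : ℝ}
    (hξ : ‖ξ‖ < c) {f f' f'' : ℝ → ℝ} (hf : ContDiffOn ℝ ∞ f (Set.Iio c))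
    (hf' : ∀ s < c, HasDerivAt f (f' s) s) (hf'' : ∀ s < c, HasDerivAt f' (f'' s) s) :
    ∫ y : S2, φ y * (f'' (inner ℝ ξ (y : E3)) * (‖ξ‖ ^ 2 - inner ℝ ξ (y : E3) ^ 2)
        - 2 * inner ℝ ξ (y : E3) * f' (inner ℝ ξ (y : E3))) ∂omega
      = - ∫ y : S2, f' (inner ℝ ξ (y : E3)) * inner ℝ ξ (h y) ∂omega := by
  -- Here `ψ` extends `f'`. The test field `ψ(ξ · y) tangentField ξ` is the surface gradient of `f(ξ
  -- · y)`, and its divergence is the Beltrami derivative `f'' (|ξ|² - s²) - 2 s f'` at `s = ξ · y`.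
  obtain ⟨ψ, hψ, hψf⟩ := exists_contDiff_extension hξ
    ((hf.deriv_of_isOpen isOpen_Iio (m := ∞) (by simp)).congr
      fun s hs => (hf' s hs).deriv.symm)
  have hs (y : S2) := inner_le_norm_coe ξ y
  have hsm := (contDiff_ridge hψ ξ).fun_smul (contDiff_tangentField ξ)
  have h1 := H.integral_eq _ hsm fun x => by rw [inner_smul_right, inner_tangentField, mul_zero]
  have h2 (y : S2) : surfDiv (fun y => ψ (inner ℝ ξ y) • tangentField ξ y) y
      = f'' (inner ℝ ξ (y : E3)) * (‖ξ‖ ^ 2 - inner ℝ ξ (y : E3) ^ 2)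
        - 2 * inner ℝ ξ (y : E3) * f' (inner ℝ ξ (y : E3)) := by
    rw [surfDiv_smul_of_contDiff (contDiff_ridge hψ ξ) (contDiff_tangentField ξ),
      surfDiv_tangentField, surfGrad_ridge ξ y
        ((hf'' _ ((hs y).trans_lt hξ)).congr_of_eventuallyEq (hψf _ (hs y))),
      (hψf _ (hs y)).eq_of_nhds, inner_smul_right,
      inner_tangentField_of_tangential _ (inner_tangentField ξ y), tangentField_coe,
      inner_sub_right, inner_smul_right, real_inner_self_eq_norm_sq]
    ring
  simp only [h2] at h1
  rw [h1]
  congr 1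
  refine integral_congr_ae ?_
  filter_upwards [H.tangential] with y hy
  rw [inner_smul_right, inner_tangentField_of_tangential _ hy, (hψf _ (hs y)).eq_of_nhds]

/-! ### The Poincaré inequality -/

/-- Cauchy–Schwarz for the measure `k dω`: the quadratic polynomial `t ↦ ∫ k (G - t)²` is
nonnegative, so its discriminant is not positive. -/
lemma sq_integral_mul_le {k G : S2 → ℝ} (hk : Continuous k) (hG : Continuous G)
    (hk0 : ∀ y, 0 ≤ k y) :
    (∫ y, k y * G y ∂omega) ^ 2 ≤ (∫ y, k y ∂omega) * ∫ y, k y * G y ^ 2 ∂omega := by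
  have h (t : ℝ) : 0 ≤ (∫ y, k y ∂omega) * (t * t) + (-2 * ∫ y, k y * G y ∂omega) * t
      + ∫ y, k y * G y ^ 2 ∂omega := by
    have i1 := integrable_of_continuous (hk.fun_mul (continuous_const (y := t * t)))
    have i2 := integrable_of_continuous ((hk.fun_mul hG).fun_mul (continuous_const (y := -2 * t)))
    have i3 := integrable_of_continuous (hk.fun_mul (hG.fun_pow 2))
    have h0 : 0 ≤ ∫ y, k y * (G y - t) ^ 2 ∂omega :=
      integral_nonneg fun y => mul_nonneg (hk0 y) (sq_nonneg _)
    have h1 (y : S2) : k y * (G y - t) ^ 2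
        = k y * (t * t) + k y * G y * (-2 * t) + k y * G y ^ 2 := by ring
    simp only [h1] at h0
    rw [integral_add (i1.fun_add i2) i3, integral_add i1 i2, integral_mul_const,
      integral_mul_const] at h0
    linarith
  have := discrim_le_zero h
  rw [discrim] at this
  linarith

lemma integral_surfBeltrami_ridge {ξ : E3} {c : ℝ}
    (hξ : ‖ξ‖ < c) {f f' f'' : ℝ → ℝ} (hf : ContDiffOn ℝ ∞ f (Set.Iio c))
    (hf' : ∀ s < c, HasDerivAt f (f' s) s) (hf'' : ∀ s < c, HasDerivAt f' (f'' s) s) :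
    ∫ y : S2, (f'' (inner ℝ ξ (y : E3)) * (‖ξ‖ ^ 2 - inner ℝ ξ (y : E3) ^ 2)
        - 2 * inner ℝ ξ (y : E3) * f' (inner ℝ ξ (y : E3))) ∂omega = 0 := by
  have h := (isWeakGrad_of_contDiff (contDiff_const (c := (1 : ℝ)))).integral_ridge hξ hf hf' hf''
  simpa [surfGrad, gradient] using h

lemma sub_inner_pos {c : ℝ} (hc : 1 < c) (x y : S2) : 0 < c - inner ℝ (x : E3) (y : E3) := by
  have := inner_le_norm_coe (x : E3) y
  rw [norm_coe] at this
  linarith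

lemma sq_inner_le_one (x y : S2) : inner ℝ (x : E3) (y : E3) ^ 2 ≤ 1 := by
  have := abs_inner_le (x : E3) y
  rw [norm_coe] at this
  exact (sq_le_one_iff_abs_le_one _).2 this

lemma continuous_sub_inner (c : ℝ) (x : S2) :
    Continuous fun y : S2 => c - inner ℝ (x : E3) (y : E3) :=
  continuous_const.sub (continuous_inner_coe _)

lemma continuous_inv_sqrt_sub_inner {c : ℝ} (hc : 1 < c) (x : S2) :
    Continuous fun y : S2 => (√(c - inner ℝ (x : E3) (y : E3)))⁻¹ :=
  (continuous_sub_inner c x).sqrt.inv₀ fun y => (Real.sqrt_pos.2 (sub_inner_pos hc x y)).ne'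

lemma contDiffOn_sub (c : ℝ) : ContDiffOn ℝ ∞ (fun s : ℝ => c - s) (Set.Iio c) :=
  (contDiff_const.sub contDiff_id).contDiffOn

/-- The total mass of the kernel `(c - x · y)^(-1/2)` is bounded. -/
lemma integral_inv_sqrt_le {c : ℝ} (hc : 1 < c) (hc2 : c ≤ 2) (x : S2) :
    ∫ y : S2, (√(c - inner ℝ (x : E3) (y : E3)))⁻¹ ∂omega ≤ 4 * omega.real Set.univ := by
  have hx : ‖(x : E3)‖ < c := by rwa [norm_coe]
  have hd (s : ℝ) : HasDerivAt (fun s : ℝ => c - s) (-1) s := (hasDerivAt_id s).const_sub c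
  have h := integral_surfBeltrami_ridge hx
    (f := fun s => √(c - s)) (f' := fun s => - (√(c - s))⁻¹ / 2)
    (f'' := fun s => - ((√(c - s))⁻¹) ^ 3 / 4)
    ((contDiffOn_sub c).sqrt fun s hs => (sub_pos.2 hs).ne')
    (fun s hs => by
      convert! (hd s).sqrt (sub_pos.2 hs).ne' using 1
      field_simp)
    (fun s hs => by
      have hs' := Real.sqrt_pos.2 (sub_pos.2 hs)
      have := ((((hd s).sqrt (sub_pos.2 hs).ne').fun_inv hs'.ne').fun_neg).div_const 2
      convert! this using 1
      field_simp
      norm_num)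
  set k : S2 → ℝ := fun y => (√(c - inner ℝ (x : E3) (y : E3)))⁻¹ with hk
  have hkc : Continuous k := continuous_inv_sqrt_sub_inner hc x
  have hk0 (y : S2) : 0 < k y := inv_pos.2 (Real.sqrt_pos.2 (sub_inner_pos hc x y))
  have hk2 (y : S2) : k y ^ 2 * (c - inner ℝ (x : E3) (y : E3)) = 1 := by
    simp only [hk, inv_pow, Real.sq_sqrt (sub_inner_pos hc x y).le]
    exact inv_mul_cancel₀ (sub_inner_pos hc x y).ne'
  -- The right side is the Beltrami derivative of `√(c - s)`, which has integral zero. Its first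
  -- term is at least `-k/2` since `1 - s² ≤ 2 (c - s)`; its second is `s k = c k - √(c - s) ≥ k -
  -- 2`, using `1 < c ≤ 2`.
  have key (y : S2) : k y * (1 / 2) - 2 ≤ -(k y) ^ 3 / 4 * (‖(x : E3)‖ ^ 2 - inner ℝ (x : E3) (y : E3) ^ 2)
      - 2 * inner ℝ (x : E3) (y : E3) * (-k y / 2) := by
    have h1 := hk2 y
    have h2 := hk0 y
    have h3 := sub_inner_pos hc x y
    have h4 := sq_inner_le_one x y
    set s := inner ℝ (x : E3) (y : E3)
    have h5 : k y * (c - s) ≤ 2 := by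
      refine (abs_le_of_sq_le_sq' ?_ (by norm_num)).2
      have h6 : (k y * (c - s)) ^ 2 = c - s := by linear_combination (c - s) * h1
      nlinarith
    have h6 : (k y) ^ 3 * (1 - s ^ 2) ≤ 2 * k y := by
      have : (k y) ^ 3 * (1 - s ^ 2) ≤ (k y) ^ 3 * (2 * (c - s)) := by
        gcongr; nlinarith
      nlinarith
    rw [norm_coe]
    nlinarith
  have i0 : Integrable k omega := integrable_of_continuous hkc
  have h7 : ∫ y, (k y * (1 / 2) - 2) ∂omega ≤ 0 := by
    rw [← h]
    refine integral_mono ((i0.mul_const _).sub (integrable_const _)) ?_ key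
    refine integrable_of_continuous ?_
    have := continuous_inner_coe (x : E3)
    change Continuous fun y => -(k y) ^ 3 / 4 * (‖(x : E3)‖ ^ 2 - inner ℝ (x : E3) (y : E3) ^ 2)
      - 2 * inner ℝ (x : E3) (y : E3) * (-k y / 2)
    fun_prop
  rw [integral_sub (i0.mul_const _) (integrable_const _), integral_mul_const, integral_const,
    smul_eq_mul] at h7
  change ∫ y, k y ∂omega ≤ _
  linarith

/-- Only the part of `x` tangential at `y` contributes, and its squared length is `1 - (x · y)²`. -/
lemma sq_inner_tangential_le {x y : S2} {v : E3} (hv : inner ℝ (y : E3) v = 0) :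
    inner ℝ (x : E3) v ^ 2 ≤ (1 - inner ℝ (x : E3) (y : E3) ^ 2) * ‖v‖ ^ 2 := by
  have h1 : inner ℝ (x : E3) v = inner ℝ v (tangentField (x : E3) y) :=
    (inner_tangentField_of_tangential _ hv).symm
  have h2 : ‖tangentField (x : E3) y‖ ^ 2 = 1 - inner ℝ (x : E3) (y : E3) ^ 2 := by
    rw [← real_inner_self_eq_norm_sq,
      inner_tangentField_of_tangential _ (inner_tangentField _ (y : E3)), tangentField_coe,
      inner_sub_right, inner_smul_right, inner_self_coe]
    ring
  rw [h1, ← h2, ← mul_pow, mul_comm]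
  exact sq_le_sq' (by linarith [neg_abs_le (inner ℝ v (tangentField (x : E3) y)),
    abs_real_inner_le_norm v (tangentField (x : E3) y)]) (real_inner_le_norm _ _)

lemma contDiffOn_log_sub (c : ℝ) : ContDiffOn ℝ ∞ (fun s : ℝ => -Real.log (c - s)) (Set.Iio c) :=
  ((contDiffOn_sub c).log fun _ hs => (sub_pos.2 hs).ne').neg

lemma hasDerivAt_neg_log_sub {c s : ℝ} (hs : s < c) :
    HasDerivAt (fun s : ℝ => -Real.log (c - s)) (c - s)⁻¹ s := by
  have := (((hasDerivAt_id s).const_sub c).log (sub_pos.2 hs).ne').fun_neg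
  convert! this using 1
  field_simp
  norm_num

lemma hasDerivAt_inv_sub {c s : ℝ} (hs : s < c) :
    HasDerivAt (fun s : ℝ => (c - s)⁻¹) ((c - s)⁻¹ ^ 2) s := by
  have := ((hasDerivAt_id s).const_sub c).fun_inv (sub_pos.2 hs).ne'
  convert! this using 1
  simp

lemma surfGrad_const (a : ℝ) (x : S2) : surfGrad (fun _ => a) x = 0 := by
  simp [surfGrad, gradient]

/-- The Green representation of a Sobolev function, for the regularised logarithmic kernel. -/
lemma IsWeakGrad.green {φ : S2 → ℝ} {h : S2 → E3} (H : IsWeakGrad φ h) {c : ℝ} (hc : 1 < c)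
    (x : S2) :
    (c ^ 2 - 1) * ∫ y : S2, φ y * (c - inner ℝ (x : E3) (y : E3))⁻¹ ^ 2 ∂omega
      = ∫ y, φ y ∂omega
        + ∫ y : S2, (c - inner ℝ (x : E3) (y : E3))⁻¹ * inner ℝ (x : E3) (h y) ∂omega := by
  have h1 := H.integral_ridge (ξ := (x : E3)) (by rwa [norm_coe]) (contDiffOn_log_sub c)
    (fun s hs => hasDerivAt_neg_log_sub hs) (fun s hs => hasDerivAt_inv_sub hs)
  -- The Beltrami derivative of `-log (c - s)` is `1 - (c² - 1) (c - s)⁻²`; the last term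
  -- concentrates at `y = x` as `c` decreases to `1`.
  have h2 (y : S2) : φ y * ((c - inner ℝ (x : E3) (y : E3))⁻¹ ^ 2
      * (‖(x : E3)‖ ^ 2 - inner ℝ (x : E3) (y : E3) ^ 2)
        - 2 * inner ℝ (x : E3) (y : E3) * (c - inner ℝ (x : E3) (y : E3))⁻¹)
      = φ y - (c ^ 2 - 1) * (φ y * (c - inner ℝ (x : E3) (y : E3))⁻¹ ^ 2) := by
    have h3 := sub_inner_pos hc x y
    rw [norm_coe]
    field_simp
    ring
  simp only [h2] at h1
  rw [integral_sub (H.memLp_fun.integrable (by norm_num))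
    ((integrable_mul_of_continuous H.memLp_fun (((continuous_sub_inner c x).fun_inv₀ fun y =>
      (sub_inner_pos hc x y).ne').fun_pow 2)).const_mul _), integral_const_mul] at h1
  linarith

lemma norm_sub_sq (x y : S2) : ‖(y : E3) - x‖ ^ 2 = 2 * (1 - inner ℝ (x : E3) (y : E3)) := by
  rw [← real_inner_self_eq_norm_sq, inner_sub_left, inner_sub_right, inner_sub_right, inner_self_coe,
    inner_self_coe, real_inner_comm]
  ring

/-- Since `|x · ∇* φ| ≤ √(2 (c - s)) |∇* φ|`, the Green kernel `(c - s)⁻¹` improves to `(c -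
s)^(-1/2)`, whose mass is bounded uniformly in `1 < c ≤ 2`. -/
lemma integral_abs_mul_le_of_contDiff {φ : E3 → ℝ} (hφ : ContDiff ℝ ∞ φ)
    (h0 : ∫ x : S2, φ x ∂omega = 0) {c : ℝ} (hc : 1 < c) (x : S2) :
    ((c ^ 2 - 1) * ∫ y : S2, φ y * (c - inner ℝ (x : E3) (y : E3))⁻¹ ^ 2 ∂omega) ^ 2
      ≤ 2 * (∫ y : S2, (√(c - inner ℝ (x : E3) (y : E3)))⁻¹ * ‖surfGrad φ y‖ ∂omega) ^ 2 := by
  rw [(isWeakGrad_of_contDiff hφ).green hc x, h0, zero_add]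
  have h1 : |∫ y : S2, (c - inner ℝ (x : E3) (y : E3))⁻¹ * inner ℝ (x : E3) (surfGrad φ y) ∂omega|
      ≤ ∫ y : S2, √2 * ((√(c - inner ℝ (x : E3) (y : E3)))⁻¹ * ‖surfGrad φ y‖) ∂omega := by
    rw [← Real.norm_eq_abs]
    refine norm_integral_le_of_norm_le (integrable_of_continuous (continuous_const.fun_mul
      ((continuous_inv_sqrt_sub_inner hc x).fun_mul (continuous_surfGrad hφ).norm)))
      (.of_forall fun y => ?_)
    have h3 := sub_inner_pos hc x y
    have h4 := sq_inner_tangential_le (x := x) (inner_coe_surfGrad φ y)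
    have h5 := sq_inner_le_one x y
    set s := inner ℝ (x : E3) (y : E3)
    rw [Real.norm_eq_abs]
    refine abs_le_of_sq_le_sq ?_ (by positivity)
    rw [mul_pow, mul_pow, mul_pow, Real.sq_sqrt (by norm_num), inv_pow, inv_pow, Real.sq_sqrt h3.le,
      inv_mul_le_iff₀ (by positivity)]
    calc _ ≤ (1 - s ^ 2) * ‖surfGrad φ y‖ ^ 2 := h4
      _ ≤ (2 * (c - s)) * ‖surfGrad φ y‖ ^ 2 := by gcongr; nlinarith
      _ = _ := by field_simp
  rw [integral_const_mul] at h1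
  rw [← Real.sq_sqrt (show (0 : ℝ) ≤ 2 by norm_num), ← mul_pow, ← sq_abs]
  gcongr

/-- The regularised kernel is an approximate identity on smooth functions. -/
lemma tendsto_approx {φ : E3 → ℝ} (hφ : ContDiff ℝ ∞ φ) {ε : ℝ} (hε : 0 < ε) :
    ∃ c, 1 < c ∧ c ≤ 2 ∧ ∀ x : S2,
      |(c ^ 2 - 1) * ∫ y : S2, φ y * (c - inner ℝ (x : E3) (y : E3))⁻¹ ^ 2 ∂omega
        - omega.real Set.univ * φ x| ≤ ε := by
  set A := omega.real Set.univ with hA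
  have hA0 : 0 ≤ A := measureReal_nonneg
  obtain ⟨L, hL⟩ : ∃ L, ∀ x ∈ Metric.closedBall (0 : E3) 1, ‖fderiv ℝ φ x‖ ≤ L :=
    (isCompact_closedBall 0 1).exists_bound_of_continuousOn
      (hφ.continuous_fderiv (by simp)).continuousOn
  have hlip (x y : S2) : |φ y - φ x| ≤ L * ‖(y : E3) - x‖ :=
    (convex_closedBall (0 : E3) 1).norm_image_sub_le_of_norm_fderiv_le
      (fun z _ => hφ.differentiable (by simp) z) hL (by simp) (by simp)
  obtain ⟨e, he, heA⟩ : ∃ e, 0 < e ∧ e * A ≤ ε / 2 := ⟨ε / (2 * (A + 1)), by positivity, by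
    rw [div_mul_eq_mul_div, div_le_div_iff₀ (by positivity) (by norm_num)]; nlinarith⟩
  set B := L ^ 2 / e * (3 * (4 * A)) with hB
  have hB0 : 0 ≤ B := by positivity
  obtain ⟨δ, hδ, hδ1, hδB⟩ : ∃ δ, 0 < δ ∧ δ ≤ 1 ∧ δ * B ≤ ε / 2 := by
    refine ⟨min 1 (ε / (2 * (B + 1))), by positivity, min_le_left _ _, ?_⟩
    calc _ ≤ ε / (2 * (B + 1)) * B := by gcongr; exact min_le_right _ _
      _ ≤ ε / 2 := by
        rw [div_mul_eq_mul_div, div_le_div_iff₀ (by positivity) (by norm_num)]; nlinarith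
  -- With `c = 1 + δ²` one has `√(c - s) ≥ δ` and `c² - 1 ≤ 3 δ²`, hence `(c² - 1) (c - s)⁻¹ ≤ 3 δ
  -- (c - s)^(-1/2)`, which is small in mean.
  have hc : 1 < 1 + δ ^ 2 := by nlinarith
  refine ⟨1 + δ ^ 2, hc, by nlinarith, fun x => ?_⟩
  set c := 1 + δ ^ 2 with hcdef
  have hone := (isWeakGrad_of_contDiff (contDiff_const (c := (1 : ℝ)))).green hc x
  simp only [surfGrad_const, one_mul, inner_zero_right,
    mul_zero, integral_zero, add_zero, integral_const, smul_eq_mul, mul_one] at hone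
  have hkc : Continuous fun y : S2 => (c - inner ℝ (x : E3) (y : E3))⁻¹ :=
    (continuous_sub_inner c x).inv₀ fun y => (sub_inner_pos hc x y).ne'
  have hcφ := continuous_coe_comp hφ
  have h1 : (c ^ 2 - 1) * ∫ y : S2, φ y * (c - inner ℝ (x : E3) (y : E3))⁻¹ ^ 2 ∂omega - A * φ x
      = ∫ y : S2, (c ^ 2 - 1) * ((φ y - φ x) * (c - inner ℝ (x : E3) (y : E3))⁻¹ ^ 2) ∂omega := by
    simp only [sub_mul (φ _)]
    rw [integral_const_mul, integral_sub (integrable_of_continuous (hcφ.fun_mul (hkc.fun_pow 2)))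
      (integrable_of_continuous (continuous_const.fun_mul (hkc.fun_pow 2))), integral_const_mul, hA, ← hone]
    ring
  rw [h1]
  have h2 : |∫ y : S2, (c ^ 2 - 1) * ((φ y - φ x) * (c - inner ℝ (x : E3) (y : E3))⁻¹ ^ 2) ∂omega|
      ≤ ∫ y : S2, (e * ((c ^ 2 - 1) * (c - inner ℝ (x : E3) (y : E3))⁻¹ ^ 2)
        + L ^ 2 / e * (3 * δ) * (√(c - inner ℝ (x : E3) (y : E3)))⁻¹) ∂omega := by
    rw [← Real.norm_eq_abs]
    refine norm_integral_le_of_norm_le (integrable_of_continuous ((continuous_const.fun_mul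
      (continuous_const.fun_mul (hkc.fun_pow 2))).fun_add
      (continuous_const.fun_mul (continuous_inv_sqrt_sub_inner hc x)))) (.of_forall fun y => ?_)
    have h3 := sub_inner_pos hc x y
    -- Young's inequality replaces the Lipschitz bound by a small constant plus a multiple of `|y -
    -- x|² / 2 = 1 - s ≤ c - s`, which cancels one power of the kernel.
    have h4 : |φ y - φ x| ≤ e + L ^ 2 / e * (c - inner ℝ (x : E3) (y : E3)) := by
      have h5 := hlip x y
      have h6 := norm_sub_sq x y
      have h7 : L * ‖(y : E3) - x‖ ≤ e + L ^ 2 / e * (‖(y : E3) - x‖ ^ 2 / 2) := by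
        rw [div_mul_eq_mul_div, ← sub_le_iff_le_add', le_div_iff₀ he]
        nlinarith [sq_nonneg (L * ‖(y : E3) - x‖ - e)]
      have h8 : L ^ 2 / e * (‖(y : E3) - x‖ ^ 2 / 2) ≤ L ^ 2 / e * (c - inner ℝ (x : E3) (y : E3)) := by
        gcongr; rw [h6]; linarith
      linarith
    have h9 : δ ≤ √(c - inner ℝ (x : E3) (y : E3)) := by
      refine Real.le_sqrt_of_sq_le ?_
      have := inner_le_norm_coe (x : E3) y
      rw [norm_coe] at this
      linarith
    set t := c - inner ℝ (x : E3) (y : E3)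
    have hc1 : 0 ≤ c ^ 2 - 1 := by nlinarith
    have h10 : (c ^ 2 - 1) * t⁻¹ ≤ 3 * δ * (√t)⁻¹ := by
      have h11 : t⁻¹ = (√t)⁻¹ * (√t)⁻¹ := by rw [← mul_inv, Real.mul_self_sqrt h3.le]
      have h12 : (√t)⁻¹ ≤ δ⁻¹ := inv_anti₀ hδ h9
      have h13 : c ^ 2 - 1 ≤ 3 * δ * δ := by
        have hδ2 : δ ^ 2 ≤ 1 := by nlinarith
        rw [hcdef]
        nlinarith [mul_nonneg (sq_nonneg δ) (sub_nonneg.2 hδ2)]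
      calc (c ^ 2 - 1) * t⁻¹ ≤ 3 * δ * δ * (δ⁻¹ * (√t)⁻¹) := by rw [h11]; gcongr
        _ = _ := by field_simp
    rw [norm_mul, norm_mul, Real.norm_of_nonneg hc1,
      Real.norm_of_nonneg (show 0 ≤ t⁻¹ ^ 2 by positivity),
      Real.norm_eq_abs]
    calc _ ≤ (c ^ 2 - 1) * ((e + L ^ 2 / e * t) * t⁻¹ ^ 2) := by gcongr
      _ = e * ((c ^ 2 - 1) * t⁻¹ ^ 2) + L ^ 2 / e * ((c ^ 2 - 1) * t⁻¹) := by field_simp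
      _ ≤ _ := by rw [mul_assoc (L ^ 2 / e)]; gcongr
  rw [integral_add (integrable_of_continuous (continuous_const.fun_mul
      (continuous_const.fun_mul (hkc.fun_pow 2)))) (integrable_of_continuous
      (continuous_const.fun_mul (continuous_inv_sqrt_sub_inner hc x))), integral_const_mul e,
      integral_const_mul (L ^ 2 / e * (3 * δ)),
      integral_const_mul (c ^ 2 - 1) (fun y : S2 => (c - inner ℝ (x : E3) (y : E3))⁻¹ ^ 2),
      hone] at h2
  have h3 : L ^ 2 / e * (3 * δ) * ∫ y : S2, (√(c - inner ℝ (x : E3) (y : E3)))⁻¹ ∂omega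
      ≤ L ^ 2 / e * (3 * δ) * (4 * A) := by
    gcongr
    exact integral_inv_sqrt_le hc (by nlinarith) x
  have h4 : L ^ 2 / e * (3 * δ) * (4 * A) = δ * B := by rw [hB]; ring
  linarith

/-- The Poincaré inequality on the sphere. -/
theorem poincare {φ : E3 → ℝ} (hφ : ContDiff ℝ ∞ φ) (h0 : ∫ x : S2, φ x ∂omega = 0) :
    ∫ x : S2, φ x ^ 2 ∂omega ≤ 64 * ∫ x, ‖surfGrad φ x‖ ^ 2 ∂omega := by
  set A := omega.real Set.univ with hA
  have hApos : 0 < A := by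
    have : omega Set.univ ≠ 0 := by
      rw [Measure.measure_univ_ne_zero, omega]; exact Measure.toSphere_ne_zero _
    exact ENNReal.toReal_pos this (measure_ne_top _ _)
  have hG := (continuous_surfGrad hφ).norm
  have main (ε : ℝ) (hε : 0 < ε) : A ^ 2 * ∫ x : S2, φ x ^ 2 ∂omega
      ≤ 64 * A ^ 2 * ∫ x, ‖surfGrad φ x‖ ^ 2 ∂omega + ε := by
    obtain ⟨δ, hδ, hδA⟩ : ∃ δ, 0 < δ ∧ 2 * δ ^ 2 * A = ε :=
      ⟨√(ε / (2 * A)), by positivity, by rw [Real.sq_sqrt (by positivity)]; field_simp⟩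
    obtain ⟨c, hc, hc2, happ⟩ := tendsto_approx hφ hδ
    -- Schur's test. The factor 16 is 2 from splitting off the approximation error, 2 from `√2`, and
    -- 4 from the mass of the kernel. Integrating in `x` brings the mass again, which makes 64.
    have hpt (x : S2) : A ^ 2 * φ x ^ 2 ≤ 16 * A *
        (∫ y : S2, (√(c - inner ℝ (x : E3) (y : E3)))⁻¹ * ‖surfGrad φ y‖ ^ 2 ∂omega)
        + 2 * δ ^ 2 := by
      have h1 := integral_abs_mul_le_of_contDiff hφ h0 hc x
      have h2 := happ x
      have h3 := sq_integral_mul_le (continuous_inv_sqrt_sub_inner hc x) hG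
        (fun y => by positivity)
      have h4 := integral_inv_sqrt_le hc hc2 x
      have h5 : 0 ≤ ∫ y : S2, (√(c - inner ℝ (x : E3) (y : E3)))⁻¹ * ‖surfGrad φ y‖ ^ 2 ∂omega :=
        integral_nonneg fun y => by positivity
      have h6 := mul_le_mul_of_nonneg_right h4 h5
      have h7 := sq_le_sq' (by linarith [abs_le.1 h2]) (abs_le.1 h2).2
      nlinarith [sq_nonneg ((c ^ 2 - 1) * ∫ y : S2, φ y * (c - inner ℝ (x : E3) (y : E3))⁻¹ ^ 2 ∂omega
        + ((c ^ 2 - 1) * ∫ y : S2, φ y * (c - inner ℝ (x : E3) (y : E3))⁻¹ ^ 2 ∂omega - A * φ x))]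
    have hcont : Continuous (Function.uncurry fun x y : S2 =>
        (√(c - inner ℝ (x : E3) (y : E3)))⁻¹ * ‖surfGrad φ y‖ ^ 2) := by
      refine Continuous.mul (Continuous.inv₀ (Continuous.sqrt (continuous_const.sub
        ((continuous_subtype_val.comp continuous_fst).inner
          (continuous_subtype_val.comp continuous_snd))))
        fun p => (Real.sqrt_pos.2 (sub_inner_pos hc _ _)).ne') ((hG.comp continuous_snd).pow 2)
    have hint : Integrable (Function.uncurry fun x y : S2 =>
        (√(c - inner ℝ (x : E3) (y : E3)))⁻¹ * ‖surfGrad φ y‖ ^ 2) (omega.prod omega) :=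
      hcont.integrable_of_hasCompactSupport (HasCompactSupport.of_compactSpace _)
    have hint' : Integrable (fun x : S2 => ∫ y : S2, (√(c - inner ℝ (x : E3) (y : E3)))⁻¹
        * ‖surfGrad φ y‖ ^ 2 ∂omega) omega := hint.integral_prod_left
    have hswap := integral_integral_swap hint
    have hle : ∫ x, ∫ y : S2, (√(c - inner ℝ (x : E3) (y : E3)))⁻¹ * ‖surfGrad φ y‖ ^ 2 ∂omega ∂omega
        ≤ 4 * A * ∫ y, ‖surfGrad φ y‖ ^ 2 ∂omega := by
      rw [hswap, ← integral_const_mul]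
      refine integral_mono hint.integral_prod_right
        ((integrable_of_continuous (hG.pow 2)).const_mul _) fun y => ?_
      simp only [real_inner_comm (y : E3)]
      rw [integral_mul_const]
      gcongr
      exact integral_inv_sqrt_le hc hc2 y
    calc A ^ 2 * ∫ x : S2, φ x ^ 2 ∂omega = ∫ x : S2, A ^ 2 * φ x ^ 2 ∂omega :=
          (integral_const_mul _ _).symm
      _ ≤ ∫ x : S2, (16 * A *
        (∫ y : S2, (√(c - inner ℝ (x : E3) (y : E3)))⁻¹ * ‖surfGrad φ y‖ ^ 2 ∂omega)
        + 2 * δ ^ 2) ∂omega :=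
        integral_mono (integrable_of_continuous (continuous_const.fun_mul
          ((continuous_coe_comp hφ).fun_pow 2)))
          ((hint'.const_mul _).add (integrable_const _)) hpt
      _ = 16 * A * (∫ x, ∫ y : S2, (√(c - inner ℝ (x : E3) (y : E3)))⁻¹ * ‖surfGrad φ y‖ ^ 2
          ∂omega ∂omega) + ε := by
        rw [integral_add (hint'.const_mul _) (integrable_const _),
          integral_const_mul, integral_const, smul_eq_mul, ← hδA, mul_comm (omega.real _)]
      _ ≤ _ := by
        nlinarith
  have h := le_of_forall_pos_le_add main
  have hA2 : 0 < A ^ 2 := by positivity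
  nlinarith

/-! ### The Helmholtz decomposition -/

lemma hasFDerivAt_inner_mul_pow (e ξ : E3) (n : ℕ) (y : E3) :
    HasFDerivAt (fun y : E3 => inner ℝ e y * inner ℝ ξ y ^ n)
      (inner ℝ e y • ((n : ℝ) * inner ℝ ξ y ^ (n - 1)) • innerSL ℝ ξ
        + inner ℝ ξ y ^ n • innerSL ℝ e) y := by
  have h := (innerSL ℝ e).hasFDerivAt (x := y) |>.mul ((innerSL ℝ ξ).hasFDerivAt (x := y) |>.pow n)
  refine h.congr_fderiv ?_
  ext v
  simp [mul_assoc]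

lemma contDiff_inner_mul_pow (e ξ : E3) (n : ℕ) :
    ContDiff ℝ ∞ fun y : E3 => inner ℝ e y * inner ℝ ξ y ^ n :=
  (contDiff_const.inner ℝ contDiff_id).mul ((contDiff_const.inner ℝ contDiff_id).pow n)

/-- The left side is the product of the determinants of `(ξ, e, y)` and `(ξ, y, r)`, hence a Gram
determinant, simplified by `|y| = 1` and `y · r = 0`. -/
lemma cross_gram {e ξ r : E3} {y : S2} (hr : inner ℝ (y : E3) r = 0) :
    inner ℝ (cross ξ e) (y : E3) * inner ℝ ξ (cross y r)
      = - ((inner ℝ ξ ξ - inner ℝ ξ (y : E3) ^ 2) * inner ℝ e r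
        - (inner ℝ e ξ - inner ℝ ξ (y : E3) * inner ℝ e (y : E3)) * inner ℝ ξ r) := by
  have hy := inner_self_coe y
  simp only [inner_eq_sum, cross_zero_coord, cross_one_coord, cross_two_coord] at *
  linear_combination
    (-(e 0 * r 0 + e 1 * r 1 + e 2 * r 2) * (ξ 0 * ξ 0 + ξ 1 * ξ 1 + ξ 2 * ξ 2)
      + (e 0 * ξ 0 + e 1 * ξ 1 + e 2 * ξ 2) * (ξ 0 * r 0 + ξ 1 * r 1 + ξ 2 * r 2)) * hy
    + (-(e 0 * ξ 0 + e 1 * ξ 1 + e 2 * ξ 2) * (ξ 0 * (y : E3) 0 + ξ 1 * (y : E3) 1 + ξ 2 * (y : E3) 2)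
      + (e 0 * (y : E3) 0 + e 1 * (y : E3) 1 + e 2 * (y : E3) 2)
        * (ξ 0 * ξ 0 + ξ 1 * ξ 1 + ξ 2 * ξ 2)) * hr

lemma inner_cross_cross (ξ e y r : E3) :
    inner ℝ (cross ξ e) (cross y r)
      = inner ℝ ξ y * inner ℝ e r - inner ℝ ξ r * inner ℝ e y := by
  simp only [inner_eq_sum, cross_zero_coord, cross_one_coord, cross_two_coord]
  ring

/-- A tangential field that is orthogonal to all gradients and to all rotated gradients vanishes. -/
theorem ae_eq_zero_of_orthogonal {r : S2 → E3} (hr : MemLp r 2 omega)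
    (ht : ∀ᵐ x : S2 ∂omega, inner ℝ (x : E3) (r x) = 0)
    (hgrad : ∀ φ : E3 → ℝ, ContDiff ℝ ∞ φ → ∫ x, inner ℝ (r x) (surfGrad φ x) ∂omega = 0)
    (hrot : ∀ φ : E3 → ℝ, ContDiff ℝ ∞ φ → ∫ x : S2, inner ℝ (cross x (r x)) (surfGrad φ x) ∂omega = 0) :
    ∀ᵐ x ∂omega, r x = 0 := by
  have hp (ξ : E3) (n : ℕ) : Continuous fun y : S2 => inner ℝ ξ (y : E3) ^ n :=
    (continuous_inner_coe ξ).pow n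
  have hG (e ξ : E3) (n : ℕ) : ∫ y : S2, (inner ℝ e (y : E3)
      * ((n : ℝ) * inner ℝ ξ (y : E3) ^ (n - 1) * inner ℝ ξ (r y))
      + inner ℝ ξ (y : E3) ^ n * inner ℝ e (r y)) ∂omega = 0 := by
    rw [← hgrad _ (contDiff_inner_mul_pow e ξ n)]
    refine integral_congr_ae ?_
    filter_upwards [ht] with y hy
    rw [inner_surfGrad_of_tangential _ _ hy, (hasFDerivAt_inner_mul_pow e ξ n (y : E3)).fderiv]
    simp
  have hR (e ξ : E3) (n : ℕ) : ∫ y : S2, (inner ℝ e (y : E3)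
      * ((n : ℝ) * inner ℝ ξ (y : E3) ^ (n - 1) * inner ℝ ξ (cross y (r y)))
      + inner ℝ ξ (y : E3) ^ n * inner ℝ e (cross y (r y))) ∂omega = 0 := by
    rw [← hrot _ (contDiff_inner_mul_pow e ξ n)]
    refine integral_congr_ae (.of_forall fun y => ?_)
    simp only
    rw [inner_surfGrad_of_tangential _ _ (inner_self_cross _ _),
      (hasFDerivAt_inner_mul_pow e ξ n (y : E3)).fderiv]
    simp
  have ia (e ξ : E3) (n : ℕ) :
      Integrable (fun y : S2 => inner ℝ e (r y) * inner ℝ ξ (y : E3) ^ n) omega :=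
    integrable_mul_of_continuous (hr.const_inner e) (hp ξ n)
  have ib (e ξ : E3) (n : ℕ) : Integrable (fun y : S2 =>
      inner ℝ ξ (r y) * (inner ℝ e (y : E3) * inner ℝ ξ (y : E3) ^ n)) omega :=
    integrable_mul_of_continuous (hr.const_inner ξ) ((continuous_inner_coe e).fun_mul (hp ξ n))
  refine ae_eq_zero_of_vector_moments hr fun ξ e n => ?_
  -- Let `Mₙ = ∫ (e · r)(ξ · y)ⁿ` and, for `n ≥ 1`, `N = ∫ (ξ · r)(e · y)(ξ · y)ⁿ⁻¹`. The gradient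
  -- of `(e · y)(ξ · y)ⁿ` gives `n N + Mₙ = 0`. The rotated gradient of `((ξ × e) · y)(ξ · y)ⁿ⁻¹`
  -- gives `Mₙ = N`, modulo `Mₙ₋₂` and a moment of `ξ · r` that the gradient of `(ξ · y)ⁿ⁻¹` kills.
  -- So `(n + 1) Mₙ = 0`.
  induction n using Nat.strong_induction_on generalizing e with
  | _ n ih =>
  match n, ih with
  | 0, _ =>
    have := hG e ξ 0
    simpa using this
  | 1, _ =>
    have h1 := hG e ξ 1
    have h2 := hR (cross ξ e) ξ 0
    have e1 (y : S2) : inner ℝ e (y : E3) * (((1 : ℕ) : ℝ) * inner ℝ ξ (y : E3) ^ (1 - 1)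
        * inner ℝ ξ (r y)) + inner ℝ ξ (y : E3) ^ 1 * inner ℝ e (r y)
        = inner ℝ ξ (r y) * (inner ℝ e (y : E3) * inner ℝ ξ (y : E3) ^ 0)
        + inner ℝ e (r y) * inner ℝ ξ (y : E3) ^ 1 := by simp; ring
    have e2 (y : S2) : inner ℝ (cross ξ e) (y : E3) * (((0 : ℕ) : ℝ) * inner ℝ ξ (y : E3) ^ (0 - 1)
        * inner ℝ ξ (cross y (r y))) + inner ℝ ξ (y : E3) ^ 0 * inner ℝ (cross ξ e) (cross y (r y))
        = inner ℝ e (r y) * inner ℝ ξ (y : E3) ^ 1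
          - inner ℝ ξ (r y) * (inner ℝ e (y : E3) * inner ℝ ξ (y : E3) ^ 0) := by
      rw [inner_cross_cross]; simp; ring
    simp only [e1] at h1
    simp only [e2] at h2
    rw [integral_add (ib e ξ 0) (ia e ξ 1)] at h1
    rw [integral_sub (ia e ξ 1) (ib e ξ 0)] at h2
    linarith
  | k + 2, ih =>
    have h1 := hG e ξ (k + 2)
    have h2 := hR (cross ξ e) ξ (k + 1)
    have h3 := hG ξ ξ k
    have h0 := ih k (by omega) e
    have e1 (y : S2) : inner ℝ e (y : E3) * (((k + 2 : ℕ) : ℝ) * inner ℝ ξ (y : E3) ^ (k + 2 - 1)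
        * inner ℝ ξ (r y)) + inner ℝ ξ (y : E3) ^ (k + 2) * inner ℝ e (r y)
        = (k + 2) * (inner ℝ ξ (r y) * (inner ℝ e (y : E3) * inner ℝ ξ (y : E3) ^ (k + 1)))
        + inner ℝ e (r y) * inner ℝ ξ (y : E3) ^ (k + 2) := by
      push_cast [show k + 2 - 1 = k + 1 by omega]; ring
    have e3 (y : S2) : inner ℝ ξ (y : E3) * (((k : ℕ) : ℝ) * inner ℝ ξ (y : E3) ^ (k - 1)
        * inner ℝ ξ (r y)) + inner ℝ ξ (y : E3) ^ k * inner ℝ ξ (r y)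
        = (k + 1) * (inner ℝ ξ (r y) * inner ℝ ξ (y : E3) ^ k) := by
      rcases k with _ | k
      · simp
      · push_cast [show k + 1 - 1 = k by omega]; ring
    have e2 : ∫ y : S2, (inner ℝ (cross ξ e) (y : E3) * (((k + 1 : ℕ) : ℝ)
        * inner ℝ ξ (y : E3) ^ (k + 1 - 1) * inner ℝ ξ (cross y (r y)))
        + inner ℝ ξ (y : E3) ^ (k + 1) * inner ℝ (cross ξ e) (cross y (r y))) ∂omega
        = ∫ y : S2, ((k + 2) * (inner ℝ e (r y) * inner ℝ ξ (y : E3) ^ (k + 2))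
          + -(k + 2) * (inner ℝ ξ (r y) * (inner ℝ e (y : E3) * inner ℝ ξ (y : E3) ^ (k + 1)))
          + -((k + 1) * inner ℝ ξ ξ) * (inner ℝ e (r y) * inner ℝ ξ (y : E3) ^ k)
          + (k + 1) * inner ℝ e ξ * (inner ℝ ξ (r y) * inner ℝ ξ (y : E3) ^ k)) ∂omega := by
      refine integral_congr_ae ?_
      filter_upwards [ht] with y hy
      rw [inner_cross_cross]
      have := cross_gram (e := e) (ξ := ξ) hy
      push_cast [show k + 1 - 1 = k by omega]
      linear_combination (k + 1) * inner ℝ ξ (y : E3) ^ k * this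
    simp only [e1] at h1
    simp only [e3] at h3
    rw [e2] at h2
    rw [integral_add ((ib e ξ (k + 1)).const_mul _) (ia e ξ (k + 2)), integral_const_mul] at h1
    rw [integral_const_mul] at h3
    rw [integral_add ((((ia e ξ (k + 2)).const_mul _).fun_add
        ((ib e ξ (k + 1)).const_mul _)).fun_add ((ia e ξ k).const_mul _)) ((ia ξ ξ k).const_mul _),
      integral_add (((ia e ξ (k + 2)).const_mul _).fun_add ((ib e ξ (k + 1)).const_mul _))
        ((ia e ξ k).const_mul _),
      integral_add ((ia e ξ (k + 2)).const_mul _) ((ib e ξ (k + 1)).const_mul _),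
      integral_const_mul, integral_const_mul, integral_const_mul, integral_const_mul, h0] at h2
    have hk : (0 : ℝ) < k + 3 := by positivity
    have h4 : ∫ y : S2, inner ℝ ξ (r y) * inner ℝ ξ (y : E3) ^ k ∂omega = 0 :=
      (mul_eq_zero.1 h3).resolve_left (by positivity)
    rw [h4] at h2
    refine (mul_eq_zero.1 (?_ : ((k : ℝ) + 3) * _ = 0)).resolve_left hk.ne'
    linarith

/-- The square-integrable fields that are the surface gradient of a smooth function. -/
noncomputable def gradSubmodule : Submodule ℝ (Lp E3 2 omega) where
  carrier := {g | ∃ φ : E3 → ℝ, ContDiff ℝ ∞ φ ∧ g =ᵐ[omega] surfGrad φ}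
  zero_mem' := ⟨fun _ => 0, contDiff_const, by
    filter_upwards [Lp.coeFn_zero E3 2 omega] with x hx
    rw [hx, surfGrad_const]; rfl⟩
  add_mem' := by
    rintro a b ⟨φ, hφ, ha⟩ ⟨ψ, hψ, hb⟩
    refine ⟨φ + ψ, hφ.add hψ, ?_⟩
    filter_upwards [Lp.coeFn_add a b, ha, hb] with x h1 h2 h3
    refine ext_inner_left ℝ fun v => ?_
    rw [h1, Pi.add_apply, h2, h3, inner_add_right, inner_surfGrad, inner_surfGrad, inner_surfGrad,
      fderiv_add (hφ.differentiable (by simp) _) (hψ.differentiable (by simp) _)]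
    rfl
  smul_mem' := by
    rintro c a ⟨φ, hφ, ha⟩
    refine ⟨c • φ, contDiff_const.smul hφ, ?_⟩
    filter_upwards [Lp.coeFn_smul c a, ha] with x h1 h2
    refine ext_inner_left ℝ fun v => ?_
    rw [h1, Pi.smul_apply, h2, inner_smul_right, inner_surfGrad, inner_surfGrad,
      fderiv_const_smul (hφ.differentiable (by simp) _)]
    rfl

lemma surfGrad_sub {φ ψ : E3 → ℝ} (hφ : ContDiff ℝ ∞ φ) (hψ : ContDiff ℝ ∞ ψ) (x : S2) :
    surfGrad (fun y => φ y - ψ y) x = surfGrad φ x - surfGrad ψ x := by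
  refine ext_inner_left ℝ fun v => ?_
  rw [inner_sub_right, inner_surfGrad, inner_surfGrad, inner_surfGrad,
    fderiv_fun_sub (hφ.differentiable (by simp) _) (hψ.differentiable (by simp) _)]
  rfl

lemma tendsto_integral_mul {F : ℕ → Lp ℝ 2 omega} {f : Lp ℝ 2 omega}
    (h : Filter.Tendsto F Filter.atTop (𝓝 f)) {u : S2 → ℝ} (hu : Continuous u) :
    Filter.Tendsto (fun n => ∫ x, F n x * u x ∂omega) Filter.atTop (𝓝 (∫ x, f x * u x ∂omega)) := by
  have hu2 : MemLp u 2 omega := memLp_of_continuous hu 2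
  have key (g : Lp ℝ 2 omega) : ∫ x, g x * u x ∂omega = inner ℝ (hu2.toLp u) g := by
    rw [L2.inner_def]
    refine integral_congr_ae ?_
    filter_upwards [hu2.coeFn_toLp] with x hx
    rw [hx]; simp
  simp only [key]
  exact tendsto_const_nhds.inner h

lemma tendsto_integral_inner {F : ℕ → Lp E3 2 omega} {f : Lp E3 2 omega}
    (h : Filter.Tendsto F Filter.atTop (𝓝 f)) {u : S2 → E3} (hu : Continuous u) :
    Filter.Tendsto (fun n => ∫ x, inner ℝ (F n x) (u x) ∂omega) Filter.atTop
      (𝓝 (∫ x, inner ℝ (f x) (u x) ∂omega)) := by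
  have hu2 : MemLp u 2 omega := memLp_of_continuous hu 2
  have key (g : Lp E3 2 omega) : ∫ x, inner ℝ (g x) (u x) ∂omega = inner ℝ g (hu2.toLp u) := by
    rw [L2.inner_def]
    refine integral_congr_ae ?_
    filter_upwards [hu2.coeFn_toLp] with x hx
    rw [hx]
  simp only [key]
  exact h.inner tendsto_const_nhds

lemma measureReal_omega_pos : 0 < omega.real Set.univ := by
  have : omega Set.univ ≠ 0 := by
    rw [Measure.measure_univ_ne_zero, omega]; exact Measure.toSphere_ne_zero _
  exact ENNReal.toReal_pos this (measure_ne_top _ _)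

/-- The limits of gradients are weak gradients. -/
theorem exists_isWeakGrad_of_mem_closure {k : Lp E3 2 omega}
    (hk : k ∈ gradSubmodule.topologicalClosure) :
    ∃ f : S2 → ℝ, IsWeakGrad f k ∧ ∫ x, f x ∂omega = 0 := by
  obtain ⟨g, hg, hlim⟩ := mem_closure_iff_seq_limit.1 hk
  choose φ₀ hφ₀ hgφ₀ using hg
  -- Potentials of mean zero are needed for the Poincaré inequality, which makes them Cauchy in
  -- `L²`; the constant 8 below is `√64`.
  set φ : ℕ → E3 → ℝ := fun n y => φ₀ n y - (∫ x : S2, φ₀ n x ∂omega) / omega.real Set.univ with hφdef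
  have hφ (n : ℕ) : ContDiff ℝ ∞ (φ n) := (hφ₀ n).sub contDiff_const
  have hgφ (n : ℕ) : g n =ᵐ[omega] surfGrad (φ n) := by
    filter_upwards [hgφ₀ n] with x hx
    rw [hx, hφdef, surfGrad_sub (hφ₀ n) contDiff_const, surfGrad_const, sub_zero]
  have hmean (n : ℕ) : ∫ x : S2, φ n x ∂omega = 0 := by
    simp only [hφdef]
    rw [integral_sub (integrable_of_continuous (continuous_coe_comp (hφ₀ n))) (integrable_const _),
      integral_const, smul_eq_mul, mul_div_cancel₀ _ measureReal_omega_pos.ne', sub_self]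
  have hmem (n : ℕ) : MemLp (fun x : S2 => φ n x) 2 omega :=
    memLp_of_continuous (continuous_coe_comp (hφ n)) 2
  set F : ℕ → Lp ℝ 2 omega := fun n => (hmem n).toLp _ with hF
  have hFφ (n : ℕ) : F n =ᵐ[omega] fun x => φ n x := (hmem n).coeFn_toLp
  have hdist (n m : ℕ) : dist (F n) (F m) ≤ 8 * dist (g n) (g m) := by
    have h1 : ‖F n - F m‖ ^ 2 = ∫ x : S2, (φ n x - φ m x) ^ 2 ∂omega := by
      rw [← real_inner_self_eq_norm_sq, L2.inner_def]
      refine integral_congr_ae ?_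
      filter_upwards [Lp.coeFn_sub (F n) (F m), hFφ n, hFφ m] with x h1 h2 h3
      rw [h1, Pi.sub_apply, h2, h3, real_inner_self_eq_norm_sq, Real.norm_eq_abs, sq_abs]
    have h2 : ‖g n - g m‖ ^ 2 = ∫ x, ‖surfGrad (fun y => φ n y - φ m y) x‖ ^ 2 ∂omega := by
      rw [← real_inner_self_eq_norm_sq, L2.inner_def]
      refine integral_congr_ae ?_
      filter_upwards [Lp.coeFn_sub (g n) (g m), hgφ n, hgφ m] with x h1 h2 h3
      rw [h1, Pi.sub_apply, h2, h3, real_inner_self_eq_norm_sq, surfGrad_sub (hφ n) (hφ m)]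
    have h3 := poincare ((hφ n).sub (hφ m)) (by
      rw [integral_sub (integrable_of_continuous (continuous_coe_comp (hφ n)))
        (integrable_of_continuous (continuous_coe_comp (hφ m))), hmean, hmean, sub_self])
    rw [← h1, ← h2] at h3
    rw [dist_eq_norm, dist_eq_norm]
    refine (abs_le_of_sq_le_sq' ?_ (by positivity)).2
    rw [mul_pow]
    linarith
  have hcauchy : CauchySeq F := by
    have := hlim.cauchySeq
    rw [Metric.cauchySeq_iff] at this ⊢
    intro ε hε
    obtain ⟨N, hN⟩ := this (ε / 8) (by positivity)
    exact ⟨N, fun m hm n hn => (hdist m n).trans_lt (by linarith [hN m hm n hn])⟩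
  obtain ⟨f, hf⟩ := cauchySeq_tendsto_of_complete hcauchy
  refine ⟨f, ⟨Lp.memLp f, Lp.memLp k, ?_, fun Φ hΦ ht => ?_⟩, ?_⟩
  · have hmemk : MemLp (fun x : S2 => inner ℝ (k x) (x : E3)) 2 omega :=
      memLp_inner_of_continuous (Lp.memLp k) continuous_subtype_val
    simp only [real_inner_comm (k _)]
    refine ae_eq_zero_of_integral_contDiff hmemk fun ψ hψ => ?_
    have h1 := tendsto_integral_inner hlim
      ((continuous_coe_comp hψ).fun_smul continuous_subtype_val)
    have h2 (n : ℕ) : ∫ x : S2, inner ℝ (g n x) (ψ x • (x : E3)) ∂omega = 0 := by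
      rw [integral_eq_zero_of_ae]
      filter_upwards [hgφ n] with x hx
      rw [hx, inner_smul_right, real_inner_comm, inner_coe_surfGrad, mul_zero]; rfl
    simp only [h2] at h1
    rw [tendsto_nhds_unique tendsto_const_nhds h1]
    simp only [inner_smul_right, mul_comm]
  · refine tendsto_nhds_unique (tendsto_integral_mul hf (continuous_surfDiv hΦ)) ?_
    refine (tendsto_integral_inner hlim (continuous_coe_comp hΦ)).neg.congr fun n => ?_
    rw [integral_congr_ae (g := fun x : S2 => inner ℝ (surfGrad (φ n) x) (Φ x)),
      ← (isWeakGrad_of_contDiff (hφ n)).integral_eq Φ hΦ ht]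
    · refine integral_congr_ae ?_
      filter_upwards [hFφ n] with x hx
      rw [hx]
    · filter_upwards [hgφ n] with x hx
      rw [hx]
  · have h1 := tendsto_integral_mul hf (continuous_const (y := (1 : ℝ)))
    simp only [mul_one] at h1
    refine tendsto_nhds_unique h1 (tendsto_const_nhds.congr fun n => ?_)
    rw [integral_congr_ae (hFφ n), hmean]

/-- Every square-integrable field is the sum of a weak gradient and of a field that is orthogonal to
all gradients. -/
theorem exists_isWeakGrad_orthogonal {v : S2 → E3} (hv : MemLp v 2 omega) :
    ∃ (f : S2 → ℝ) (h : S2 → E3), IsWeakGrad f h ∧ ∫ x, f x ∂omega = 0 ∧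
      ∀ φ : E3 → ℝ, ContDiff ℝ ∞ φ → ∫ x, inner ℝ (v x - h x) (surfGrad φ x) ∂omega = 0 := by
  have : CompleteSpace gradSubmodule.topologicalClosure :=
    gradSubmodule.isClosed_topologicalClosure.completeSpace_coe
  set K := gradSubmodule.topologicalClosure
  set V : Lp E3 2 omega := hv.toLp v
  obtain ⟨f, hf, hf0⟩ := exists_isWeakGrad_of_mem_closure
    (K.starProjection_apply_mem V)
  refine ⟨f, _, hf, hf0, fun φ hφ => ?_⟩
  have hm : MemLp (surfGrad φ) 2 omega := memLp_of_continuous (continuous_surfGrad hφ) 2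
  have h1 : hm.toLp _ ∈ K :=
    gradSubmodule.le_topologicalClosure ⟨φ, hφ, hm.coeFn_toLp⟩
  have h2 := K.starProjection_inner_eq_zero V _ h1
  rw [L2.inner_def] at h2
  rw [← h2]
  refine integral_congr_ae ?_
  filter_upwards [Lp.coeFn_sub V (K.starProjection V), hv.coeFn_toLp, hm.coeFn_toLp] with x h3 h4 h5
  rw [h3, Pi.sub_apply, h4, h5]

/-- The Helmholtz decomposition of a tangential field. -/
theorem exists_helmholtz_tangential {v : S2 → E3} (hv : MemLp v 2 omega)
    (ht : ∀ᵐ x : S2 ∂omega, inner ℝ (x : E3) (v x) = 0) :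
    ∃ (f₂ f₃ : S2 → ℝ) (h₂ h₃ : S2 → E3), IsWeakGrad f₂ h₂ ∧ IsWeakGrad f₃ h₃ ∧
      ∫ x, f₂ x ∂omega = 0 ∧ ∫ x, f₃ x ∂omega = 0 ∧
      ∀ᵐ x : S2 ∂omega, v x = h₂ x + cross x (h₃ x) := by
  obtain ⟨f₂, h₂, H₂, h₂0, horth₂⟩ := exists_isWeakGrad_orthogonal hv
  have hw : MemLp (fun x => v x - h₂ x) 2 omega := hv.sub H₂.memLp_grad
  have hw' := (memLp_cross hw).neg
  obtain ⟨f₃, h₃, H₃, h₃0, horth₃⟩ := exists_isWeakGrad_orthogonal hw'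
  refine ⟨f₂, f₃, h₂, h₃, H₂, H₃, h₂0, h₃0, ?_⟩
  have hcross_add (a b c : E3) : cross a (-b - c) = -cross a b - cross a c := by
    ext i; fin_cases i <;> simp <;> ring
  have htw : ∀ᵐ x : S2 ∂omega, inner ℝ (x : E3) (v x - h₂ x) = 0 := by
    filter_upwards [ht, H₂.tangential] with x h1 h2
    rw [inner_sub_right, h1, h2, sub_zero]
  have hcr : ∀ᵐ x : S2 ∂omega, cross x ((-fun x : S2 => cross x (v x - h₂ x)) x - h₃ x)
      = v x - h₂ x - cross x (h₃ x) := by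
    filter_upwards [htw] with x h1
    rw [Pi.neg_apply, hcross_add, cross_cross_of_tangential h1, neg_neg]
  -- With `w = v - h₂`, the field `-(x × w) - h₃` is orthogonal to gradients by the choice of `h₃`.
  -- Its product with `x` is `w - x × h₃`, orthogonal to gradients because both terms are. So it
  -- vanishes, and this product gives `w = x × h₃`.
  have hzero := ae_eq_zero_of_orthogonal (hw'.sub H₃.memLp_grad) (by
      filter_upwards [H₃.tangential] with x h1
      rw [Pi.sub_apply, Pi.neg_apply, inner_sub_right, inner_neg_right, inner_self_cross, h1]; simp)
    horth₃ fun φ hφ => by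
      have h1 := H₃.rot.integral_eq φ hφ
      simp only [zero_mul, integral_zero, neg_zero] at h1
      have h2 := horth₂ φ hφ
      have h3 := integral_sub (integrable_inner_of_continuous hw (continuous_surfGrad hφ))
        (integrable_inner_of_continuous (memLp_cross H₃.memLp_grad) (continuous_surfGrad hφ))
      rw [h1, h2, sub_zero] at h3
      rw [← h3]
      refine integral_congr_ae ?_
      filter_upwards [hcr] with x hx
      rw [Pi.sub_apply, hx, inner_sub_left]
  filter_upwards [hzero, hcr] with x h1 h2
  rw [Pi.sub_apply] at h1
  have h3 : cross (x : E3) 0 = 0 := by ext i; fin_cases i <;> simp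
  rw [h1, h3, sub_sub, eq_comm, sub_eq_zero] at h2
  exact h2

/-! ### The maximum principle -/

/-- If `b > 0`, then `0` would also be a local minimum, so `g` would be locally constant and `b =
0`. -/
lemma nonpos_of_isLocalMax {g g' : ℝ → ℝ} {b : ℝ} (hg : ∀ᶠ t in 𝓝 0, HasDerivAt g (g' t) t)
    (hg' : HasDerivAt g' b 0) (hmax : IsLocalMax g 0) : b ≤ 0 := by
  by_contra! hb
  have hderiv : deriv g =ᶠ[𝓝 0] g' := hg.mono fun t ht => ht.deriv
  have h2 : deriv (deriv g) 0 = b := by rw [hderiv.deriv_eq, hg'.deriv]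
  have hmin : IsLocalMin g 0 := isLocalMin_of_deriv_deriv_pos (h2 ▸ hb) hmax.deriv_eq_zero
    hg.self_of_nhds.continuousAt
  have hconst : g =ᶠ[𝓝 0] fun _ => g 0 := by
    filter_upwards [hmax, hmin] with t h3 h4 using le_antisymm h3 h4
  have h3 : deriv (deriv g) 0 = 0 := by
    rw [hconst.deriv.deriv_eq]; simp
  linarith

/-- The maximum principle on the exterior of a ball. -/
theorem nonpos_of_harmonic_exterior {V : E3 → ℝ} {R : ℝ}
    (hcont : ContinuousOn V {x | R ≤ ‖x‖})
    (hdecay : ∀ ε > 0, ∃ R', ∀ x : E3, R' ≤ ‖x‖ → V x ≤ ε)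
    (h0 : ∀ x : E3, ‖x‖ = R → V x ≤ 0)
    (hharm : ∀ x : E3, R < ‖x‖ → ∃ (D : Fin 3 → ℝ → ℝ) (D2 : Fin 3 → ℝ),
      (∀ i, ∀ᶠ t : ℝ in 𝓝 0, HasDerivAt (fun t : ℝ => V (x + t • EuclideanSpace.single i 1)) (D i t) t) ∧
      (∀ i, HasDerivAt (D i) (D2 i) 0) ∧ ∑ i, D2 i = 0)
    {x : E3} (hx : R ≤ ‖x‖) : V x ≤ 0 := by
  refine le_of_forall_pos_le_add fun ε hε => ?_
  obtain ⟨R₀, hR₀⟩ := hdecay ε hε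
  set R' := max R₀ ‖x‖ with hR'
  -- Adding `η |z|²` makes the Laplacian equal to `6 η > 0`, which rules out an interior maximum on
  -- the shell `R ≤ |z| ≤ R'`. On its boundary `V ≤ 0` or `V ≤ ε`. Finally `η` tends to `0`.
  have key (η : ℝ) (hη : 0 < η) : V x ≤ ε + η * R' ^ 2 := by
    have hnorm : Continuous fun z : E3 => ‖z‖ := continuous_norm
    have hcomp : IsCompact {z : E3 | R ≤ ‖z‖ ∧ ‖z‖ ≤ R'} := by
      refine (isCompact_closedBall (0 : E3) R').of_isClosed_subset
        ((isClosed_le continuous_const hnorm).inter (isClosed_le hnorm continuous_const)) ?_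
      exact fun z hz => mem_closedBall_zero_iff.2 hz.2
    obtain ⟨z, hz, hmax⟩ := hcomp.exists_isMaxOn ⟨x, hx, le_max_right _ _⟩
      (f := fun z => V z + η * ‖z‖ ^ 2)
      ((hcont.mono fun z hz => hz.1).add (by fun_prop))
    have h1 : V x + η * ‖x‖ ^ 2 ≤ V z + η * ‖z‖ ^ 2 := hmax ⟨hx, le_max_right _ _⟩
    have h2 : V z ≤ ε := by
      rcases eq_or_lt_of_le hz.1 with h | h
      · linarith [h0 z h.symm]
      rcases eq_or_lt_of_le hz.2 with h' | h'
      · exact hR₀ z (h' ▸ le_max_left _ _)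
      exfalso
      obtain ⟨D, D2, hD, hD2, hsum⟩ := hharm z h
      have hloc : IsLocalMax (fun z => V z + η * ‖z‖ ^ 2) z :=
        hmax.isLocalMax (Filter.mem_of_superset (((isOpen_lt continuous_const hnorm).inter
          (isOpen_lt hnorm continuous_const)).mem_nhds ⟨h, h'⟩) fun w hw => ⟨hw.1.le, hw.2.le⟩)
      have h3 (i : Fin 3) : D2 i + 2 * η ≤ 0 := by
        refine nonpos_of_isLocalMax
          (g := fun t => V (z + t • EuclideanSpace.single i 1)
            + η * ‖z + t • (EuclideanSpace.single i 1 : E3)‖ ^ 2)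
          (g' := fun t => D i t + η * (2 * z i + 2 * t)) ?_ ?_ ?_
        · filter_upwards [hD i] with t ht
          refine ht.add (HasDerivAt.const_mul η ?_)
          have h4 : (fun t : ℝ => ‖z + t • (EuclideanSpace.single i 1 : E3)‖ ^ 2)
              = fun t => ‖z‖ ^ 2 + 2 * z i * t + t ^ 2 := by
            funext t
            rw [norm_add_sq_real, inner_smul_right, EuclideanSpace.inner_single_right, norm_smul]
            simp
            ring
          rw [h4]
          have := (((hasDerivAt_id t).const_mul (2 * z i)).const_add (‖z‖ ^ 2)).add
            (hasDerivAt_pow 2 t)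
          convert! this using 1
          simp
        · refine (hD2 i).add ?_
          have := (((hasDerivAt_id (0 : ℝ)).const_mul 2).const_add (2 * z i)).const_mul η
          convert! this using 1
          ring
        · have hline : Filter.Tendsto (fun t : ℝ => z + t • (EuclideanSpace.single i 1 : E3)) (𝓝 0)
              (𝓝 z) := by
            have : Continuous fun t : ℝ => z + t • (EuclideanSpace.single i 1 : E3) := by fun_prop
            simpa using this.tendsto 0
          have := hline.eventually hloc
          simpa [IsLocalMax, IsMaxFilter] using this
      have h4 := Finset.sum_le_sum fun i (_ : i ∈ Finset.univ) => h3 i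
      rw [Finset.sum_add_distrib, hsum] at h4
      simp at h4
      linarith
    have h3 : η * ‖z‖ ^ 2 ≤ η * R' ^ 2 := by gcongr; exact hz.2
    have h4 : 0 ≤ η * ‖x‖ ^ 2 := by positivity
    linarith
  rw [zero_add]
  refine le_of_forall_pos_le_add fun δ hδ => ?_
  refine (key (δ / (R' ^ 2 + 1)) (by positivity)).trans ?_
  have : δ / (R' ^ 2 + 1) * R' ^ 2 ≤ δ := by
    rw [div_mul_eq_mul_div, div_le_iff₀ (by positivity)]; nlinarith [sq_nonneg R']
  linarith

/-! ### The dipole potential outside the sphere -/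

/-- The potential of `u`, without the factor `1 / (4 π)`. -/
noncomputable def dipolePotential (u : S2 → E3) (x : E3) : ℝ :=
  ∫ y : S2, inner ℝ (u y) (x - y) / ‖x - y‖ ^ 3 ∂omega

lemma hasDerivAt_norm_line {z e : E3} {t : ℝ} (h : z + t • e ≠ 0) :
    HasDerivAt (fun t : ℝ => ‖z + t • e‖) (inner ℝ (z + t • e) e / ‖z + t • e‖) t := by
  have hl : HasDerivAt (fun t : ℝ => z + t • e) e t := by
    simpa using ((hasDerivAt_id t).smul_const e).const_add z
  have h1 := (hl.norm_sq).sqrt (by simpa using h)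
  simp only [Real.sqrt_sq (norm_nonneg _)] at h1
  convert! h1 using 1
  rw [mul_div_mul_left _ _ two_ne_zero]

lemma hasDerivAt_inner_line (v z e : E3) (t : ℝ) :
    HasDerivAt (fun t : ℝ => inner ℝ v (z + t • e)) (inner ℝ v e) t := by
  have : (fun t : ℝ => inner ℝ v (z + t • e)) = fun t => inner ℝ v z + t * inner ℝ v e := by
    funext t; rw [inner_add_right, inner_smul_right]
  rw [this]
  simpa using ((hasDerivAt_id t).mul_const (inner ℝ v e)).const_add (inner ℝ v z)

/-- The derivative in the direction `e` of the dipole kernel. -/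
noncomputable def kernelDeriv (v e z : E3) : ℝ :=
  inner ℝ v e / ‖z‖ ^ 3 - 3 * inner ℝ v z * inner ℝ e z / ‖z‖ ^ 5

/-- The second derivative in the direction `e` of the dipole kernel. -/
noncomputable def kernelDeriv2 (v e z : E3) : ℝ :=
  -6 * inner ℝ v e * inner ℝ e z / ‖z‖ ^ 5 - 3 * inner ℝ v z * inner ℝ e e / ‖z‖ ^ 5
    + 15 * inner ℝ v z * inner ℝ e z ^ 2 / ‖z‖ ^ 7

lemma hasDerivAt_kernel (v e z : E3) {t : ℝ} (h : z + t • e ≠ 0) :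
    HasDerivAt (fun t : ℝ => inner ℝ v (z + t • e) / ‖z + t • e‖ ^ 3)
      (kernelDeriv v e (z + t • e)) t := by
  have hn := norm_ne_zero_iff.2 h
  have := (hasDerivAt_inner_line v z e t).div ((hasDerivAt_norm_line h).pow 3) (pow_ne_zero 3 hn)
  convert! this using 1
  rw [kernelDeriv, real_inner_comm (z + t • e) e]
  simp
  field_simp

lemma hasDerivAt_kernelDeriv (v e z : E3) {t : ℝ} (h : z + t • e ≠ 0) :
    HasDerivAt (fun t : ℝ => kernelDeriv v e (z + t • e)) (kernelDeriv2 v e (z + t • e)) t := by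
  have hn := norm_ne_zero_iff.2 h
  have hN := hasDerivAt_norm_line h
  have h1 := (hasDerivAt_const t (inner ℝ v e)).div (hN.pow 3) (pow_ne_zero 3 hn)
  have h2 := (((hasDerivAt_inner_line v z e t).const_mul 3).mul (hasDerivAt_inner_line e z e t)).div
    (hN.pow 5) (pow_ne_zero 5 hn)
  convert! h1.sub h2 using 1
  have hc : inner ℝ (z + t • e) e = inner ℝ e (z + t • e) := real_inner_comm _ _
  rw [kernelDeriv2]
  simp [hc]
  field_simp
  ring

lemma sum_kernelDeriv2 (v z : E3) (hz : z ≠ 0) :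
    ∑ i : Fin 3, kernelDeriv2 v (EuclideanSpace.single i 1) z = 0 := by
  have hn := norm_ne_zero_iff.2 hz
  have h2 : ‖z‖ ^ 2 = z 0 ^ 2 + z 1 ^ 2 + z 2 ^ 2 := by
    rw [← real_inner_self_eq_norm_sq, inner_eq_sum]; ring
  simp [kernelDeriv2, Fin.sum_univ_three, EuclideanSpace.inner_single_left,
    EuclideanSpace.inner_single_right]
  field_simp
  rw [h2, inner_eq_sum]
  ring

/-- This bound and the next two dominate the kernel and its derivatives at distance at least `δ`
from the sphere, for passing limits and derivatives under the integral. -/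
lemma norm_kernel_le (v z : E3) {δ : ℝ} (hδ : 0 < δ) (hz : δ ≤ ‖z‖) :
    ‖inner ℝ v z / ‖z‖ ^ 3‖ ≤ (δ ^ 2)⁻¹ * ‖v‖ := by
  have hn : 0 < ‖z‖ := hδ.trans_le hz
  rw [norm_div, norm_pow, norm_norm, div_le_iff₀ (by positivity)]
  calc _ ≤ ‖v‖ * ‖z‖ := norm_inner_le_norm _ _
    _ = (‖z‖ ^ 2)⁻¹ * ‖v‖ * ‖z‖ ^ 3 := by field_simp
    _ ≤ _ := by gcongr

lemma norm_kernelDeriv_le (v e z : E3) (he : ‖e‖ = 1) {δ : ℝ} (hδ : 0 < δ) (hz : δ ≤ ‖z‖) :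
    ‖kernelDeriv v e z‖ ≤ 4 * (δ ^ 3)⁻¹ * ‖v‖ := by
  have hn : 0 < ‖z‖ := hδ.trans_le hz
  have h1 : ‖inner ℝ v e‖ ≤ ‖v‖ := by simpa [he] using norm_inner_le_norm (𝕜 := ℝ) v e
  have h2 : ‖inner ℝ v z‖ ≤ ‖v‖ * ‖z‖ := norm_inner_le_norm (𝕜 := ℝ) v z
  have h3 : ‖inner ℝ e z‖ ≤ ‖z‖ := by simpa [he] using norm_inner_le_norm (𝕜 := ℝ) e z
  calc ‖kernelDeriv v e z‖ ≤ ‖inner ℝ v e‖ / ‖z‖ ^ 3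
        + 3 * ‖inner ℝ v z‖ * ‖inner ℝ e z‖ / ‖z‖ ^ 5 := by
        refine (norm_sub_le _ _).trans (le_of_eq ?_)
        simp
    _ ≤ ‖v‖ / ‖z‖ ^ 3 + 3 * (‖v‖ * ‖z‖) * ‖z‖ / ‖z‖ ^ 5 := by gcongr
    _ = 4 * (‖z‖ ^ 3)⁻¹ * ‖v‖ := by field_simp; ring
    _ ≤ _ := by gcongr

lemma norm_kernelDeriv2_le (v e z : E3) (he : ‖e‖ = 1) {δ : ℝ} (hδ : 0 < δ) (hz : δ ≤ ‖z‖) :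
    ‖kernelDeriv2 v e z‖ ≤ 24 * (δ ^ 4)⁻¹ * ‖v‖ := by
  have hn : 0 < ‖z‖ := hδ.trans_le hz
  have h1 : ‖inner ℝ v e‖ ≤ ‖v‖ := by simpa [he] using norm_inner_le_norm (𝕜 := ℝ) v e
  have h2 : ‖inner ℝ v z‖ ≤ ‖v‖ * ‖z‖ := norm_inner_le_norm (𝕜 := ℝ) v z
  have h3 : ‖inner ℝ e z‖ ≤ ‖z‖ := by simpa [he] using norm_inner_le_norm (𝕜 := ℝ) e z
  have h4 : inner ℝ e e = 1 := by rw [real_inner_self_eq_norm_sq, he]; norm_num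
  calc ‖kernelDeriv2 v e z‖ ≤ 6 * ‖inner ℝ v e‖ * ‖inner ℝ e z‖ / ‖z‖ ^ 5
        + 3 * ‖inner ℝ v z‖ / ‖z‖ ^ 5 + 15 * ‖inner ℝ v z‖ * ‖inner ℝ e z‖ ^ 2 / ‖z‖ ^ 7 := by
        refine (norm_add_le _ _).trans (add_le_add ((norm_sub_le _ _).trans (le_of_eq ?_))
          (le_of_eq ?_))
        · simp [he]
        · simp
    _ ≤ 6 * ‖v‖ * ‖z‖ / ‖z‖ ^ 5 + 3 * (‖v‖ * ‖z‖) / ‖z‖ ^ 5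
        + 15 * (‖v‖ * ‖z‖) * ‖z‖ ^ 2 / ‖z‖ ^ 7 := by gcongr
    _ = 24 * (‖z‖ ^ 4)⁻¹ * ‖v‖ := by field_simp; ring
    _ ≤ _ := by gcongr

section Measurability

variable {u : S2 → E3}

lemma aestronglyMeasurable_inner_sub (hu : AEStronglyMeasurable u omega) (x : E3) :
    AEStronglyMeasurable (fun y : S2 => inner ℝ (u y) (x - y)) omega :=
  hu.inner (continuous_const.sub continuous_subtype_val).aestronglyMeasurable

lemma aestronglyMeasurable_inv_norm_sub (x : E3) (n : ℕ) :
    AEStronglyMeasurable (fun y : S2 => (‖x - y‖ ^ n)⁻¹) omega := by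
  have : Measurable fun y : S2 => (‖x - y‖ ^ n)⁻¹ :=
    (((continuous_const.sub continuous_subtype_val).norm.measurable).pow_const n).inv
  exact this.aestronglyMeasurable

lemma aestronglyMeasurable_kernel (hu : AEStronglyMeasurable u omega) (x : E3) :
    AEStronglyMeasurable (fun y : S2 => inner ℝ (u y) (x - y) / ‖x - y‖ ^ 3) omega := by
  simp only [div_eq_mul_inv]
  exact (aestronglyMeasurable_inner_sub hu x).mul (aestronglyMeasurable_inv_norm_sub x 3)

lemma aestronglyMeasurable_kernelDeriv (hu : AEStronglyMeasurable u omega) (e x : E3) :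
    AEStronglyMeasurable (fun y : S2 => kernelDeriv (u y) e (x - y)) omega := by
  have h1 := aestronglyMeasurable_inner_sub hu x
  have h2 := aestronglyMeasurable_inner_sub (u := fun _ => e) aestronglyMeasurable_const x
  simp only [kernelDeriv, div_eq_mul_inv]
  exact ((hu.inner aestronglyMeasurable_const).mul (aestronglyMeasurable_inv_norm_sub x 3)).sub
    (((h1.const_mul 3).mul h2).mul (aestronglyMeasurable_inv_norm_sub x 5))

lemma aestronglyMeasurable_kernelDeriv2 (hu : AEStronglyMeasurable u omega) (e x : E3) :
    AEStronglyMeasurable (fun y : S2 => kernelDeriv2 (u y) e (x - y)) omega := by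
  have h1 := aestronglyMeasurable_inner_sub hu x
  have h2 := aestronglyMeasurable_inner_sub (u := fun _ => e) aestronglyMeasurable_const x
  simp only [kernelDeriv2, div_eq_mul_inv]
  exact (((((hu.inner aestronglyMeasurable_const).const_mul (-6)).mul h2).mul
    (aestronglyMeasurable_inv_norm_sub x 5)).sub
    (((h1.const_mul 3).mul aestronglyMeasurable_const).mul (aestronglyMeasurable_inv_norm_sub x 5))).add
    (((h1.const_mul 15).mul (h2.pow 2)).mul (aestronglyMeasurable_inv_norm_sub x 7))

end Measurability

lemma le_norm_sub_coe {x : E3} {δ : ℝ} (h : 1 + δ ≤ ‖x‖) (y : S2) : δ ≤ ‖x - y‖ := by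
  have := norm_sub_norm_le x (y : E3)
  rw [norm_coe] at this
  linarith

/-- The potential is harmonic outside the unit ball. -/
lemma dipolePotential_harmonic {u : S2 → E3} (hu : Integrable u omega) {x : E3} (hx : 1 < ‖x‖) :
    ∃ (D : Fin 3 → ℝ → ℝ) (D2 : Fin 3 → ℝ),
      (∀ i, ∀ᶠ t : ℝ in 𝓝 0, HasDerivAt
        (fun t : ℝ => dipolePotential u (x + t • EuclideanSpace.single i 1)) (D i t) t) ∧
      (∀ i, HasDerivAt (D i) (D2 i) 0) ∧ ∑ i, D2 i = 0 := by
  -- Half the distance to the sphere: moving `x` by less than `δ` leaves it at distance at least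
  -- `δ`.
  obtain ⟨δ, hδ, hδx⟩ : ∃ δ, 0 < δ ∧ 1 + 2 * δ = ‖x‖ := ⟨(‖x‖ - 1) / 2, by linarith, by ring⟩
  have hball {e : E3} (he : ‖e‖ = 1) {t : ℝ} (ht : t ∈ Metric.ball (0 : ℝ) δ) (y : S2) :
      δ ≤ ‖x + t • e - y‖ := by
    refine le_norm_sub_coe ?_ y
    have h1 : ‖t • e‖ < δ := by
      rw [norm_smul, he, mul_one]; simpa using ht
    have h2 := norm_sub_le (x + t • e) (t • e)
    rw [add_sub_cancel_right] at h2
    linarith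
  have hre (e : E3) (t : ℝ) (y : S2) : x + t • e - y = x - y + t • e := by abel
  have h0 : (0 : ℝ) ∈ Metric.ball (0 : ℝ) δ := Metric.mem_ball_self hδ
  have he (i : Fin 3) : ‖(EuclideanSpace.single i 1 : E3)‖ = 1 := by simp
  have hne {e : E3} (he : ‖e‖ = 1) {t : ℝ} (ht : t ∈ Metric.ball (0 : ℝ) δ) (y : S2) :
      x - y + t • e ≠ 0 := by
    rw [← hre]; exact norm_pos_iff.1 (hδ.trans_le (hball he ht y))
  set b : Fin 3 → E3 := fun i => EuclideanSpace.single i 1 with hb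
  refine ⟨fun i t => ∫ y : S2, kernelDeriv (u y) (b i)
      (x + t • b i - (y : E3)) ∂omega,
    fun i => ∫ y : S2, kernelDeriv2 (u y) (b i) (x - (y : E3)) ∂omega,
    fun i => ?_, fun i => ?_, ?_⟩
  · filter_upwards [Metric.ball_mem_nhds (0 : ℝ) hδ] with t ht
    refine (hasDerivAt_integral_of_dominated_loc_of_deriv_le (s := Metric.ball (0 : ℝ) δ)
      (bound := fun y => 4 * (δ ^ 3)⁻¹ * ‖u y‖)
      (F := fun (t : ℝ) (y : S2) => inner ℝ (u y) (x + t • b i - (y : E3))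
        / ‖x + t • b i - (y : E3)‖ ^ 3)
      (F' := fun (t : ℝ) (y : S2) => kernelDeriv (u y) (b i)
        (x + t • b i - (y : E3)))
      (Metric.isOpen_ball.mem_nhds ht)
      (.of_forall fun t => aestronglyMeasurable_kernel hu.1 _)
      ((hu.norm.const_mul (δ ^ 2)⁻¹).mono' (aestronglyMeasurable_kernel hu.1 _)
        (.of_forall fun y => norm_kernel_le _ _ hδ (hball (he i) ht y)))
      (aestronglyMeasurable_kernelDeriv hu.1 _ _)
      (.of_forall fun y t ht => norm_kernelDeriv_le _ _ _ (he i) hδ (hball (he i) ht y))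
      (hu.norm.const_mul _) (.of_forall fun y t ht => ?_)).2
    simp only [hre]
    exact hasDerivAt_kernel (u y) _ _ (hne (he i) ht y)
  · have := (hasDerivAt_integral_of_dominated_loc_of_deriv_le (s := Metric.ball (0 : ℝ) δ)
      (bound := fun y => 24 * (δ ^ 4)⁻¹ * ‖u y‖)
      (F := fun (t : ℝ) (y : S2) => kernelDeriv (u y) (b i)
        (x + t • b i - (y : E3)))
      (F' := fun (t : ℝ) (y : S2) => kernelDeriv2 (u y) (b i)
        (x + t • b i - (y : E3)))
      (Metric.ball_mem_nhds (0 : ℝ) hδ)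
      (.of_forall fun t => aestronglyMeasurable_kernelDeriv hu.1 _ _)
      ((hu.norm.const_mul (4 * (δ ^ 3)⁻¹)).mono' (aestronglyMeasurable_kernelDeriv hu.1 _ _)
        (.of_forall fun y => norm_kernelDeriv_le _ _ _ (he i) hδ (hball (he i) h0 y)))
      (aestronglyMeasurable_kernelDeriv2 hu.1 _ _)
      (.of_forall fun y t ht => norm_kernelDeriv2_le _ _ _ (he i) hδ (hball (he i) ht y))
      (hu.norm.const_mul _) (.of_forall fun y t ht => by
        simp only [hre]
        exact hasDerivAt_kernelDeriv (u y) _ _ (hne (he i) ht y))).2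
    simpa using this
  · rw [← integral_finsetSum]
    · refine (integral_congr_ae (.of_forall fun y => sum_kernelDeriv2 (u y) (x - y)
        (norm_pos_iff.1 ?_))).trans (integral_zero _ _)
      simpa using hδ.trans_le (hball (he 0) h0 y)
    · intro i _
      refine (hu.norm.const_mul (24 * (δ ^ 4)⁻¹)).mono' (aestronglyMeasurable_kernelDeriv2 hu.1 _ _)
        (.of_forall fun y => norm_kernelDeriv2_le _ _ _ (he i) hδ ?_)
      simpa using hball (he i) h0 y

lemma continuousOn_dipolePotential {u : S2 → E3} (hu : Integrable u omega) {R : ℝ} (hR : 1 < R) :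
    ContinuousOn (dipolePotential u) {x | R ≤ ‖x‖} := by
  obtain ⟨δ, hδ, hδR⟩ : ∃ δ, 0 < δ ∧ 1 + δ = R := ⟨R - 1, by linarith, by ring⟩
  refine continuousOn_of_dominated (bound := fun y => (δ ^ 2)⁻¹ * ‖u y‖)
    (fun x _ => aestronglyMeasurable_kernel hu.1 x)
    (fun x hx => .of_forall fun y => norm_kernel_le _ _ hδ
      (le_norm_sub_coe (hδR.trans_le hx) y)) (hu.norm.const_mul _) (.of_forall fun y x hx => ?_)
  have hn : 0 < ‖x - y‖ := hδ.trans_le (le_norm_sub_coe (hδR.trans_le hx) y)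
  refine ContinuousAt.continuousWithinAt ?_
  exact ContinuousAt.div (by fun_prop) (by fun_prop) (by positivity)

lemma abs_dipolePotential_le {u : S2 → E3} (hu : Integrable u omega) {δ : ℝ} (hδ : 0 < δ) {x : E3}
    (hx : 1 + δ ≤ ‖x‖) : |dipolePotential u x| ≤ (δ ^ 2)⁻¹ * ∫ y, ‖u y‖ ∂omega := by
  rw [← integral_const_mul, ← Real.norm_eq_abs]
  exact norm_integral_le_of_norm_le (hu.norm.const_mul _)
    (.of_forall fun y => norm_kernel_le _ _ hδ (le_norm_sub_coe hx y))

lemma dipolePotential_neg (u : S2 → E3) (x : E3) :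
    dipolePotential (-u) x = - dipolePotential u x := by
  simp [dipolePotential, inner_neg_left, neg_div, integral_neg]

/-- A potential that vanishes on a sphere about the unit sphere vanishes outside it. -/
theorem dipolePotential_eq_zero_of_exterior {u : S2 → E3} (hu : Integrable u omega) {R : ℝ}
    (hR : 1 < R) (h0 : ∀ x : E3, ‖x‖ = R → dipolePotential u x = 0) {x : E3} (hx : R ≤ ‖x‖) :
    dipolePotential u x = 0 := by
  -- The maximum principle is one-sided, so it is applied to `u` and to `-u`.
  have main (u : S2 → E3) (hu : Integrable u omega)
      (h0 : ∀ x : E3, ‖x‖ = R → dipolePotential u x = 0) : dipolePotential u x ≤ 0 := by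
    refine nonpos_of_harmonic_exterior (continuousOn_dipolePotential hu hR) (fun ε hε => ?_)
      (fun x hx => (h0 x hx).le) (fun x hx => dipolePotential_harmonic hu (hR.trans hx)) hx
    have hex : ∀ I : ℝ, 0 ≤ I → ∃ δ, 0 < δ ∧ (δ ^ 2)⁻¹ * I ≤ ε := fun I hI =>
      ⟨√((I + 1) / ε), by positivity, by
        rw [Real.sq_sqrt (by positivity), inv_div, div_mul_eq_mul_div, div_le_iff₀ (by positivity)]
        nlinarith⟩
    obtain ⟨δ, hδ, hδI⟩ := hex (∫ y, ‖u y‖ ∂omega) (integral_nonneg fun y => norm_nonneg _)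
    exact ⟨1 + δ, fun x hx => (le_abs_self _).trans ((abs_dipolePotential_le hu hδ hx).trans hδI)⟩
  refine le_antisymm (main u hu h0) ?_
  have := main (-u) hu.neg fun x hx => by rw [dipolePotential_neg, h0 x hx, neg_zero]
  rw [dipolePotential_neg] at this
  linarith

/-! ### Analytic continuation through a hole in the support -/

/-- Integrals of holomorphic functions that depend on a parameter are holomorphic. -/
theorem differentiableOn_integral_of_bound {α : Type*} [MeasurableSpace α] {μ : Measure α}
    {D : Set ℂ} (hD : IsOpen D) {k : ℂ → α → ℂ} {bound : α → ℝ}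
    (hmeas : ∀ τ ∈ D, AEStronglyMeasurable (k τ) μ)
    (hdiff : ∀ᵐ y ∂μ, DifferentiableOn ℂ (fun τ => k τ y) D)
    (hbound : ∀ᵐ y ∂μ, ∀ τ ∈ D, ‖k τ y‖ ≤ bound y) (hint : Integrable bound μ) :
    DifferentiableOn ℂ (fun τ => ∫ y, k τ y ∂μ) D := by
  intro τ hτ
  obtain ⟨ρ, hρ, hρD⟩ := Metric.isOpen_iff.1 hD τ hτ
  -- Cauchy's estimate on these discs bounds the derivative by `bound y / (ρ / 4)`, so no bound on
  -- derivatives has to be assumed.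
  have hsub : ∀ w ∈ Metric.ball τ (ρ / 2), Metric.closedBall w (ρ / 4) ⊆ D := by
    intro w hw z hz
    refine hρD (Metric.mem_ball.2 ?_)
    have := dist_triangle z w τ
    rw [Metric.mem_ball] at hw
    rw [Metric.mem_closedBall] at hz
    linarith
  have hballD : Metric.ball τ (ρ / 2) ⊆ D := fun w hw =>
    hsub w hw (Metric.mem_closedBall_self (by positivity))
  refine (hasDerivAt_integral_of_dominated_loc_of_deriv_le (s := Metric.ball τ (ρ / 2))
    (F' := fun w y => deriv (fun τ => k τ y) w) (bound := fun y => bound y / (ρ / 4))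
    (Metric.ball_mem_nhds τ (by positivity)) ?_ ?_ ?_ ?_ (hint.div_const _) ?_).2.differentiableAt.differentiableWithinAt
  · filter_upwards [hD.mem_nhds hτ] with w hw using hmeas w hw
  · exact hint.mono' (hmeas τ hτ) (by filter_upwards [hbound] with y hy using hy τ hτ)
  -- The derivative is measurable in `y` as the limit of a sequence of difference quotients.
  · have hs : Filter.Tendsto (fun n : ℕ => τ + ((ρ / 4 / (n + 1) : ℝ) : ℂ)) Filter.atTop (𝓝[≠] τ) := by
      refine tendsto_nhdsWithin_iff.2 ⟨?_, .of_forall fun n => ?_⟩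
      · have h1 : Filter.Tendsto (fun n : ℕ => (ρ / 4 / (n + 1) : ℝ)) Filter.atTop (𝓝 0) := by
          have := (tendsto_one_div_add_atTop_nhds_zero_nat (𝕜 := ℝ)).const_mul (ρ / 4)
          simpa [div_eq_mul_inv] using this
        simpa using ((Complex.continuous_ofReal.tendsto 0).comp h1).const_add τ
      · have : (ρ / 4 / (n + 1) : ℝ) ≠ 0 := by positivity
        rw [Set.mem_compl_singleton_iff, add_ne_left]
        exact_mod_cast this
    refine aestronglyMeasurable_of_tendsto_ae Filter.atTop
      (f := fun (n : ℕ) y => slope (fun τ => k τ y) τ (τ + ((ρ / 4 / (n + 1) : ℝ) : ℂ))) (fun n => ?_) ?_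
    · simp only [slope, vsub_eq_sub]
      refine AEStronglyMeasurable.fun_const_smul (.fun_sub (hmeas _ (hballD ?_)) (hmeas τ hτ)) _
      rw [Metric.mem_ball, dist_eq_norm, add_sub_cancel_left, Complex.norm_real,
        Real.norm_of_nonneg (by positivity)]
      have : ρ / 4 / (n + 1) ≤ ρ / 4 := div_le_self (by positivity) (by simp)
      linarith
    · filter_upwards [hdiff] with y hy
      exact (hasDerivAt_iff_tendsto_slope.1
        ((hy τ hτ).differentiableAt (hD.mem_nhds hτ)).hasDerivAt).comp hs
  · filter_upwards [hbound, hdiff] with y hy hy' w hw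
    refine Complex.norm_deriv_le_of_forall_mem_sphere_norm_le (by positivity) ?_ fun z hz =>
      hy z (hsub w hw (Metric.sphere_subset_closedBall hz))
    exact (hy'.mono (hsub w hw)).diffContOnCl_ball Set.Subset.rfl
  · filter_upwards [hdiff] with y hy w hw
    exact ((hy w (hballD hw)).differentiableAt (hD.mem_nhds (hballD hw))).hasDerivAt

/-- The square of the distance along a complex line. -/
noncomputable def lineSq (z b : E3) (τ : ℂ) : ℂ :=
  ((‖z‖ ^ 2 : ℝ) : ℂ) + 2 * τ * ((inner ℝ z b : ℝ) : ℂ) + τ ^ 2 * ((‖b‖ ^ 2 : ℝ) : ℂ)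

/-- For small imaginary part `lineSq` stays in the right half plane, where the principal power in
`lineKernel` is holomorphic. -/
lemma lineSq_re (z b : E3) (τ : ℂ) :
    (lineSq z b τ).re = ‖z + τ.re • b‖ ^ 2 - τ.im ^ 2 * ‖b‖ ^ 2 := by
  rw [norm_add_sq_real, norm_smul, inner_smul_right, lineSq, mul_pow, Real.norm_eq_abs,
    sq_abs]
  simp [pow_two]
  ring

lemma lineSq_ofReal (z b : E3) (t : ℝ) : lineSq z b t = ((‖z + t • b‖ ^ 2 : ℝ) : ℂ) := by
  rw [norm_add_sq_real, norm_smul, inner_smul_right, lineSq, mul_pow, Real.norm_eq_abs, sq_abs]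
  push_cast
  ring

/-- The dipole kernel along a complex line. -/
noncomputable def lineKernel (v z b : E3) (τ : ℂ) : ℂ :=
  (((inner ℝ v z : ℝ) : ℂ) + τ * ((inner ℝ v b : ℝ) : ℂ)) * lineSq z b τ ^ ((-3 / 2 : ℝ) : ℂ)

/-- No condition `z + t • b ≠ 0` is needed: there both sides are `0` by convention. This matters
where the segment crosses the sphere. -/
lemma lineKernel_ofReal (v z b : E3) (t : ℝ) :
    lineKernel v z b t = ((inner ℝ v (z + t • b) / ‖z + t • b‖ ^ 3 : ℝ) : ℂ) := by
  have h (r : ℝ) (hr : 0 ≤ r) : (r ^ 2) ^ (-3 / 2 : ℝ) = (r ^ 3)⁻¹ := by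
    rw [← Real.rpow_natCast, ← Real.rpow_natCast, ← Real.rpow_mul hr, ← Real.rpow_neg hr]
    norm_num
  rw [lineKernel, lineSq_ofReal, ← Complex.ofReal_cpow (by positivity), h _ (norm_nonneg _),
    inner_add_right, inner_smul_right, div_eq_mul_inv]
  push_cast
  rfl

lemma differentiableAt_lineKernel {v z b : E3} {τ : ℂ} (h : 0 < (lineSq z b τ).re) :
    DifferentiableAt ℂ (lineKernel v z b) τ := by
  have h1 : DifferentiableAt ℂ (lineSq z b) τ := by unfold lineSq; fun_prop
  refine DifferentiableAt.mul (by fun_prop) (h1.cpow (by fun_prop) (Or.inl h))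

lemma norm_lineKernel_le {v z b : E3} {τ : ℂ} {κ : ℝ} (hκ : 0 < κ) (h : κ ≤ (lineSq z b τ).re) :
    ‖lineKernel v z b τ‖ ≤ (‖z‖ + ‖τ‖ * ‖b‖) * κ ^ (-3 / 2 : ℝ) * ‖v‖ := by
  have h1 : κ ≤ ‖lineSq z b τ‖ := h.trans (Complex.re_le_norm _)
  have h2 : ‖lineSq z b τ ^ ((-3 / 2 : ℝ) : ℂ)‖ ≤ κ ^ (-3 / 2 : ℝ) := by
    rw [Complex.norm_cpow_real]
    exact Real.rpow_le_rpow_of_nonpos hκ h1 (by norm_num)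
  have h3 : ‖((inner ℝ v z : ℝ) : ℂ) + τ * ((inner ℝ v b : ℝ) : ℂ)‖
      ≤ ‖v‖ * (‖z‖ + ‖τ‖ * ‖b‖) := by
    refine (norm_add_le _ _).trans ?_
    rw [norm_mul, Complex.norm_real, Complex.norm_real, mul_add]
    have := norm_inner_le_norm (𝕜 := ℝ) v z
    have := mul_le_mul_of_nonneg_left (norm_inner_le_norm (𝕜 := ℝ) v b) (norm_nonneg τ)
    linarith
  rw [lineKernel, norm_mul]
  calc _ ≤ ‖v‖ * (‖z‖ + ‖τ‖ * ‖b‖) * κ ^ (-3 / 2 : ℝ) := by gcongr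
    _ = _ := by ring

lemma aestronglyMeasurable_lineKernel {u : S2 → E3} (hu : AEStronglyMeasurable u omega) (a b : E3)
    (τ : ℂ) : AEStronglyMeasurable (fun y : S2 => lineKernel (u y) (a - y) b τ) omega := by
  have h1 : Continuous fun y : S2 => lineSq (a - y) b τ := by
    unfold lineSq
    fun_prop
  refine AEStronglyMeasurable.mul (.add ?_ (.const_mul ?_ _)) ?_
  · exact Complex.continuous_ofReal.comp_aestronglyMeasurable (aestronglyMeasurable_inner_sub hu a)
  · exact Complex.continuous_ofReal.comp_aestronglyMeasurable (hu.inner aestronglyMeasurable_const)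
  · exact (h1.measurable.pow_const _).aestronglyMeasurable

/-- Unique continuation of the potential along segments that do not meet the support of the
magnetization. -/
theorem dipolePotential_eq_zero_of_segment {u : S2 → E3} (hu : Integrable u omega) {O : Set S2}
    (hO : IsOpen O) (huO : ∀ᵐ y ∂omega, y ∈ O → u y = 0) {a b : E3}
    (hseg : ∀ t ∈ Set.Icc (0 : ℝ) 1, ∀ y ∉ O, a + t • b ≠ (y : E3)) {ε : ℝ} (hε : 0 < ε)
    (h0 : ∀ t, 0 < t → t < ε → dipolePotential u (a + t • b) = 0) :
    dipolePotential u (a + b) = 0 := by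
  obtain ⟨δ, hδ, hdist⟩ : ∃ δ, 0 < δ ∧ ∀ p ∈ Set.Icc (0 : ℝ) 1 ×ˢ Oᶜ, δ ≤ ‖a + p.1 • b - (p.2 : E3)‖ := by
    refine (isCompact_Icc.prod hO.isClosed_compl.isCompact).exists_forall_le' (by fun_prop) ?_
    rintro ⟨t, y⟩ ⟨ht, hy⟩
    exact norm_pos_iff.2 (sub_ne_zero.2 (hseg t ht y hy))
  -- On a rectangle of this margin about `[0, 1]` the real distance to points outside `O` is at
  -- least `3δ/4` and the imaginary part costs at most `(δ/4)²`. This leaves `9/16 - 1/16 = 1/2` of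
  -- `δ²`.
  obtain ⟨η, hη, hη1, hηb⟩ : ∃ η, 0 < η ∧ η ≤ 1 ∧ η * ‖b‖ ≤ δ / 4 := by
    refine ⟨min 1 (δ / 4 / (‖b‖ + 1)), by positivity, min_le_left _ _, ?_⟩
    calc _ ≤ δ / 4 / (‖b‖ + 1) * ‖b‖ := by gcongr; exact min_le_right _ _
      _ ≤ δ / 4 := by
        rw [div_mul_eq_mul_div, div_le_iff₀ (by positivity)]; nlinarith [norm_nonneg b]
  set D : Set ℂ := Set.Ioo (-η) (1 + η) ×ℂ Set.Ioo (-η) η with hDdef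
  have hDo : IsOpen D := isOpen_Ioo.reProdIm isOpen_Ioo
  have hDc : IsPreconnected D := by
    refine (Convex.inter ?_ ?_ : Convex ℝ D).isPreconnected
    · exact (convex_Ioo (-η) (1 + η)).linear_preimage Complex.reLm
    · exact (convex_Ioo (-η) η).linear_preimage Complex.imLm
  have hre : ∀ τ ∈ D, ∀ y ∉ O, δ ^ 2 / 2 ≤ (lineSq (a - y) b τ).re := by
    rintro τ ⟨h1, h2⟩ y hy
    rw [lineSq_re]
    simp only [Set.mem_preimage, Set.mem_Ioo] at h1 h2
    obtain ⟨t, ht, htτ⟩ : ∃ t ∈ Set.Icc (0 : ℝ) 1, |τ.re - t| ≤ η := by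
      rcases lt_or_ge τ.re 0 with h | h
      · exact ⟨0, by simp, abs_le.2 ⟨by linarith, by linarith⟩⟩
      rcases lt_or_ge 1 τ.re with h' | h'
      · exact ⟨1, by simp, abs_le.2 ⟨by linarith, by linarith⟩⟩
      · exact ⟨τ.re, ⟨h, h'⟩, by simpa using hη.le⟩
    have h3 : ‖(τ.re - t) • b‖ ≤ δ / 4 := by
      rw [norm_smul, Real.norm_eq_abs]
      exact (mul_le_mul_of_nonneg_right htτ (norm_nonneg b)).trans hηb
    have h4 := hdist (t, y) ⟨ht, hy⟩
    have h5 : δ * (3 / 4) ≤ ‖a - y + τ.re • b‖ := by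
      have h6 : a - (y : E3) + τ.re • b = (a + t • b - y) + (τ.re - t) • b := by
        rw [sub_smul]; abel
      have h7 := norm_sub_le ((a + t • b - y) + (τ.re - t) • b) ((τ.re - t) • b)
      rw [add_sub_cancel_right, ← h6] at h7
      simp only at h4
      linarith
    have h8 : (|τ.im| * ‖b‖) ^ 2 ≤ (δ / 4) ^ 2 := by
      gcongr
      refine (mul_le_mul_of_nonneg_right ?_ (norm_nonneg b)).trans hηb
      exact abs_le.2 ⟨h2.1.le, h2.2.le⟩
    have h9 : (δ * (3 / 4)) ^ 2 ≤ ‖a - y + τ.re • b‖ ^ 2 := by gcongr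
    rw [mul_pow, sq_abs] at h8
    nlinarith
  set F : ℂ → ℂ := fun τ => ∫ y : S2, lineKernel (u y) (a - y) b τ ∂omega with hF
  have hker : ∀ (v z : E3) (τ : ℂ), v = 0 → lineKernel v z b τ = 0 := by
    rintro v z τ rfl
    simp [lineKernel]
  have hFdiff : DifferentiableOn ℂ F D := by
    refine differentiableOn_integral_of_bound hDo
      (bound := fun y => ((‖a‖ + 1) + 4 * ‖b‖) * (δ ^ 2 / 2) ^ (-3 / 2 : ℝ) * ‖u y‖)
      (fun τ _ => aestronglyMeasurable_lineKernel hu.1 a b τ) ?_ ?_ (hu.norm.const_mul _)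
    · filter_upwards [huO] with y hy τ hτ
      by_cases hyO : y ∈ O
      · simp only [hker _ _ _ (hy hyO)]
        exact differentiableWithinAt_const _
      · exact (differentiableAt_lineKernel ((by positivity : (0 : ℝ) < δ ^ 2 / 2).trans_le
          (hre τ hτ y hyO))).differentiableWithinAt
    · filter_upwards [huO] with y hy τ hτ
      by_cases hyO : y ∈ O
      · rw [hker _ _ _ (hy hyO), norm_zero]
        positivity
      · refine (norm_lineKernel_le (by positivity) (hre τ hτ y hyO)).trans ?_
        gcongr
        · simpa [norm_coe] using norm_sub_le a (y : E3)
        · have h1 := Complex.norm_le_abs_re_add_abs_im τ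
          obtain ⟨h2, h3⟩ := hτ
          simp only [Set.mem_preimage, Set.mem_Ioo] at h2 h3
          have h4 : |τ.re| ≤ 2 := abs_le.2 ⟨by linarith, by linarith⟩
          have h5 : |τ.im| ≤ 1 := abs_le.2 ⟨by linarith, by linarith⟩
          linarith
  have hFreal (t : ℝ) : F t = ((dipolePotential u (a + t • b) : ℝ) : ℂ) := by
    rw [dipolePotential, ← integral_complex_ofReal]
    refine integral_congr_ae (.of_forall fun y => ?_)
    simp only
    rw [lineKernel_ofReal, sub_add_eq_add_sub]
  have hzero : (0 : ℂ) ∈ D := by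
    rw [hDdef, Complex.mem_reProdIm]
    simp only [Complex.zero_re, Complex.zero_im, Set.mem_Ioo]
    exact ⟨⟨by linarith, by linarith⟩, by linarith, hη⟩
  have hone : (1 : ℂ) ∈ D := by
    rw [hDdef, Complex.mem_reProdIm]
    simp only [Complex.one_re, Complex.one_im, Set.mem_Ioo]
    exact ⟨⟨by linarith, by linarith⟩, by linarith, hη⟩
  have hfreq : ∃ᶠ z in 𝓝[≠] (0 : ℂ), F z = 0 := by
    have htend : Filter.Tendsto (fun t : ℝ => (t : ℂ)) (𝓝[>] 0) (𝓝[≠] 0) := by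
      refine tendsto_nhdsWithin_iff.2 ⟨?_, ?_⟩
      · exact (Complex.continuous_ofReal.tendsto' 0 0 (by simp)).mono_left nhdsWithin_le_nhds
      · filter_upwards [self_mem_nhdsWithin] with t ht
        simpa using (Set.mem_Ioi.1 ht).ne'
    refine htend.frequently (Filter.Eventually.frequently ?_)
    filter_upwards [Ioo_mem_nhdsGT hε] with t ht
    rw [hFreal, h0 t ht.1 ht.2, Complex.ofReal_zero]
  have := (hFdiff.analyticOnNhd hDo).eqOn_zero_of_preconnected_of_frequently_eq_zero hDc hzero hfreq
    hone
  have h1 := hFreal 1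
  rw [Complex.ofReal_one, this, one_smul] at h1
  exact Complex.ofReal_eq_zero.1 h1.symm

/-- A potential that vanishes far away vanishes in the open unit ball, if the magnetization vanishes
on a nonempty open set. -/
theorem dipolePotential_eq_zero_of_ball {u : S2 → E3} (hu : Integrable u omega) {O : Set S2}
    (hO : IsOpen O) (hne : O.Nonempty) (huO : ∀ᵐ y ∂omega, y ∈ O → u y = 0) {R : ℝ} (hR : 1 < R)
    (h0 : ∀ x : E3, R ≤ ‖x‖ → dipolePotential u x = 0) {x : E3} (hx : ‖x‖ < 1) :
    dipolePotential u x = 0 := by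
  -- The radial segment from `(R + 1) y` to `s y` meets the sphere only at `y ∈ O`. The bound `1 /
  -- (R + 1 - s)` on the parameter keeps the points beyond radius `R`.
  have hray (y : S2) (hy : y ∈ O) (s : ℝ) (hs : 0 < s) (hs1 : s < 1) :
      dipolePotential u (s • (y : E3)) = 0 := by
    have := dipolePotential_eq_zero_of_segment hu hO huO (a := (R + 1) • (y : E3))
      (b := (s - (R + 1)) • (y : E3)) (ε := 1 / (R + 1 - s)) (fun t ht z hz heq => ?_)
      (by apply one_div_pos.2; linarith) (fun t ht ht1 => ?_)
    · rwa [← add_smul, add_sub_cancel] at this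
    · rw [smul_smul, ← add_smul] at heq
      have hpos : 0 < R + 1 + t * (s - (R + 1)) := by nlinarith [ht.1, ht.2]
      have hnorm := congrArg norm heq
      rw [norm_smul, norm_coe, norm_coe, mul_one, Real.norm_of_nonneg hpos.le] at hnorm
      rw [hnorm, one_smul] at heq
      exact hz (Subtype.ext heq ▸ hy)
    · refine h0 _ ?_
      rw [lt_div_iff₀ (by linarith)] at ht1
      rw [smul_smul, ← add_smul, norm_smul, norm_coe, mul_one, Real.norm_of_nonneg (by nlinarith)]
      nlinarith
  obtain ⟨y₀, hy₀⟩ := hne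
  set x₀ : E3 := (1 / 2 : ℝ) • (y₀ : E3) with hx₀
  have hx₀n : ‖x₀‖ = 1 / 2 := by rw [hx₀, norm_smul, norm_coe]; norm_num
  have hnear : ∀ᶠ z in 𝓝 x₀, dipolePotential u z = 0 := by
    have hx₀0 : x₀ ≠ 0 := norm_pos_iff.1 (by rw [hx₀n]; norm_num)
    obtain ⟨W, hW, hWO⟩ := isOpen_induced_iff.1 hO
    have hcont : ContinuousAt (fun z : E3 => ‖z‖⁻¹ • z) x₀ :=
      (continuousAt_id.norm.inv₀ (norm_ne_zero_iff.2 hx₀0)).smul continuousAt_id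
    have hval : ‖x₀‖⁻¹ • x₀ = y₀ := by rw [hx₀n, hx₀, smul_smul]; norm_num
    have h1 : ∀ᶠ z in 𝓝 x₀, ‖z‖⁻¹ • z ∈ W := by
      refine hcont.eventually (hW.mem_nhds ?_)
      simp only [hval]
      rw [← hWO] at hy₀
      exact hy₀
    have h2 : ∀ᶠ z in 𝓝 x₀, ‖z‖ < 1 :=
      continuous_norm.continuousAt.eventually (Iio_mem_nhds (by
        change ‖x₀‖ < 1; rw [hx₀n]; norm_num))
    have h3 : ∀ᶠ z in 𝓝 x₀, z ≠ 0 := isOpen_ne.mem_nhds hx₀0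
    filter_upwards [h1, h2, h3] with z hz1 hz2 hz3
    have hn := norm_pos_iff.2 hz3
    have hmem : ‖z‖⁻¹ • z ∈ Metric.sphere (0 : E3) 1 := by
      simp [norm_smul, hn.ne']
    have := hray ⟨_, hmem⟩ (by rw [← hWO]; exact hz1) ‖z‖ hn hz2
    simpa [smul_smul, hn.ne'] using this
  obtain ⟨ρ, hρ, hball⟩ := Metric.mem_nhds_iff.1 hnear
  -- The potential vanishes near `x₀`, by radial continuation over `O`; from there any `x` in the
  -- ball is reached by a segment inside the ball.
  have := dipolePotential_eq_zero_of_segment hu hO huO (a := x₀) (b := x - x₀)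
    (ε := ρ / (‖x - x₀‖ + 1)) (fun t ht z _ heq => ?_) (by positivity) (fun t ht ht1 => ?_)
  · rwa [add_sub_cancel] at this
  · have h1 : x₀ + t • (x - x₀) = (1 - t) • x₀ + t • x := by rw [smul_sub, sub_smul, one_smul]; abel
    have h2 := norm_add_le ((1 - t) • x₀) (t • x)
    rw [← h1, heq, norm_coe, norm_smul (1 - t), norm_smul t x, Real.norm_of_nonneg ht.1,
      Real.norm_of_nonneg (sub_nonneg.2 ht.2), hx₀n] at h2
    have h3 := mul_nonneg ht.1 (sub_nonneg.2 hx.le)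
    obtain rfl : t = 1 := by linarith [ht.2]
    linarith
  · refine hball ?_
    rw [Metric.mem_ball, dist_eq_norm, add_sub_cancel_left, norm_smul, Real.norm_of_nonneg ht.le]
    rw [lt_div_iff₀ (by positivity)] at ht1
    nlinarith

/-! ### Recovering a density from Riesz type potentials -/

lemma one_half_le_one_sub_mul {t s : ℝ} (ht : 0 ≤ t) (ht' : t ≤ 1 / 2) (hs : |s| ≤ 1) :
    1 / 2 ≤ 1 - t * s := by
  nlinarith [(abs_le.1 hs).2]

/-- If the integral transform with kernel `(1 - t s) ^ (-α)` vanishes for small positive `t`, then all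
moments vanish. -/
theorem integral_mul_pow_eq_zero {Ω : Type*} [MeasurableSpace Ω] {μ : Measure Ω} {s : Ω → ℝ}
    (hs : AEStronglyMeasurable s μ) (hs1 : ∀ y, |s y| ≤ 1) {T : ℝ} (hT : 0 < T) (hT' : T ≤ 1 / 2)
    (n : ℕ) {p : Ω → ℝ} (hp : Integrable p μ) {α : ℝ} (hα : 0 < α)
    (h0 : ∀ t, 0 < t → t < T → ∫ y, p y * (1 - t * s y) ^ (-α) ∂μ = 0) :
    ∫ y, p y * s y ^ n ∂μ = 0 := by
  have hmeas (t β : ℝ) : AEStronglyMeasurable (fun y => (1 - t * s y) ^ β) μ :=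
    ((hs.aemeasurable.const_mul t).const_sub 1).pow_const β |>.aestronglyMeasurable
  have hker (t : ℝ) (ht : 0 < t) (ht' : t < T) (β : ℝ) (hβ : 0 < β) (y : Ω) :
      |(1 - t * s y) ^ (-β)| ≤ (1 / 2 : ℝ) ^ (-β) := by
    have h1 := one_half_le_one_sub_mul ht.le (ht'.le.trans hT') (hs1 y)
    rw [abs_of_nonneg (by positivity)]
    exact Real.rpow_le_rpow_of_nonpos (by norm_num) h1 (by linarith)
  -- Differentiation in `t` replaces `p` by `p s` and `α` by `α + 1`; the limit `t → 0+` gives `∫ p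
  -- = 0`. Only positive `t` is used, as the potentials will be known only for `x ≠ 0`.
  induction n generalizing p α with
  | zero =>
    simp only [pow_zero, mul_one]
    have hlim : Filter.Tendsto (fun t => ∫ y, p y * (1 - t * s y) ^ (-α) ∂μ) (𝓝[>] 0)
        (𝓝 (∫ y, p y ∂μ)) := by
      refine tendsto_integral_filter_of_dominated_convergence
        (fun y => ‖p y‖ * (1 / 2 : ℝ) ^ (-α)) (.of_forall fun t => hp.1.mul (hmeas t _)) ?_
        (hp.norm.mul_const _) (.of_forall fun y => ?_)
      · filter_upwards [Ioo_mem_nhdsGT hT] with t ht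
        refine .of_forall fun y => ?_
        rw [norm_mul]
        exact mul_le_mul_of_nonneg_left (hker t ht.1 ht.2 α hα y) (norm_nonneg _)
      · have : ContinuousAt (fun t => p y * (1 - t * s y) ^ (-α)) 0 := by
          refine ContinuousAt.mul continuousAt_const (ContinuousAt.rpow_const ?_ (Or.inl (by simp)))
          fun_prop
        simpa using this.tendsto.mono_left nhdsWithin_le_nhds
    refine tendsto_nhds_unique hlim (tendsto_const_nhds.congr' ?_)
    filter_upwards [Ioo_mem_nhdsGT hT] with t ht
    exact (h0 t ht.1 ht.2).symm
  | succ n ih =>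
    have hps : Integrable (fun y => p y * s y) μ :=
      hp.mul_bdd (c := 1) hs (.of_forall hs1)
    have h1 : ∀ t, 0 < t → t < T → ∫ y, p y * s y * (1 - t * s y) ^ (-(α + 1)) ∂μ = 0 := by
      intro t ht ht'
      have hd := (hasDerivAt_integral_of_dominated_loc_of_deriv_le (μ := μ) (x₀ := t)
        (s := Set.Ioo 0 T)
        (F := fun t y => p y * (1 - t * s y) ^ (-α))
        (F' := fun t y => α * (p y * s y * (1 - t * s y) ^ (-(α + 1))))
        (bound := fun y => α * (‖p y * s y‖ * (1 / 2 : ℝ) ^ (-(α + 1))))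
        (Ioo_mem_nhds ht ht') (.of_forall fun t => hp.1.mul (hmeas t _)) ?_
        ((hps.1.mul (hmeas t _)).const_mul _) ?_ ((hps.norm.mul_const _).const_mul _) ?_).2
      · have hz : HasDerivAt (fun t => ∫ y, p y * (1 - t * s y) ^ (-α) ∂μ) 0 t := by
          refine (hasDerivAt_const t (0 : ℝ)).congr_of_eventuallyEq ?_
          filter_upwards [Ioo_mem_nhds ht ht'] with r hr using h0 r hr.1 hr.2
        have := hd.unique hz
        rw [integral_const_mul] at this
        exact (mul_eq_zero.1 this).resolve_left hα.ne'
      · exact hp.mul_bdd (hmeas t _) (.of_forall fun y => hker t ht ht' α hα y)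
      · refine .of_forall fun y r hr => ?_
        rw [norm_mul, norm_mul _ ((1 - r * s y) ^ (-(α + 1))), Real.norm_of_nonneg hα.le]
        exact mul_le_mul_of_nonneg_left (mul_le_mul_of_nonneg_left
          (hker r hr.1 hr.2 _ (by positivity) y) (norm_nonneg _)) hα.le
      · refine .of_forall fun y r hr => ?_
        have h2 := one_half_le_one_sub_mul hr.1.le (hr.2.le.trans hT') (hs1 y)
        have h3 := ((((hasDerivAt_id r).mul_const (s y)).const_sub 1).rpow_const (p := -α)
          (Or.inl (by simp only [id]; linarith))).const_mul (p y)
        refine h3.congr_deriv ?_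
        simp only [id]
        rw [neg_add']
        ring
    have := ih hps (by positivity : 0 < α + 1) h1
    simpa only [mul_assoc, ← pow_succ'] using this

lemma exists_eq_norm_smul_coe (ξ : E3) : ∃ e : S2, ξ = ‖ξ‖ • (e : E3) := by
  rcases eq_or_ne ξ 0 with rfl | h
  · exact ⟨⟨EuclideanSpace.single 0 1, by simp⟩, by simp⟩
  · exact ⟨⟨‖ξ‖⁻¹ • ξ, by simp [norm_smul, h]⟩, by simp [smul_smul, h]⟩

lemma norm_sub_coe_sq (x : E3) (y : S2) :
    ‖x - (y : E3)‖ ^ 2 = 1 + ‖x‖ ^ 2 - inner ℝ ((2 : ℝ) • x) (y : E3) := by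
  rw [norm_sub_sq_real, norm_coe, real_inner_smul_left]
  ring

lemma abs_inner_coe_le (e y : S2) : |inner ℝ (e : E3) (y : E3)| ≤ 1 := by
  simpa [norm_coe] using abs_inner_le (e : E3) y

/-- A density is determined by its Riesz type potential near the origin. -/
theorem ae_eq_zero_of_integral_norm_sub {p : S2 → ℝ} (hp : MemLp p 2 omega) {k : ℕ} (hk : 0 < k)
    {r : ℝ} (hr : 0 < r)
    (h0 : ∀ x : E3, 0 < ‖x‖ → ‖x‖ < r → ∫ y : S2, p y * (‖x - (y : E3)‖ ^ k)⁻¹ ∂omega = 0) :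
    ∀ᵐ y ∂omega, p y = 0 := by
  refine ae_eq_zero_of_moments hp fun ξ n => ?_
  obtain ⟨e, he⟩ := exists_eq_norm_smul_coe ξ
  have hmom : ∫ y : S2, p y * inner ℝ (e : E3) (y : E3) ^ n ∂omega = 0 := by
    refine integral_mul_pow_eq_zero (s := fun y : S2 => inner ℝ (e : E3) (y : E3))
      (continuous_inner_coe _).aestronglyMeasurable
      (abs_inner_coe_le e) (T := min r (1 / 2)) (by positivity)
      (min_le_right _ _) n (hp.integrable one_le_two) (α := k / 2) (by positivity) ?_
    intro t ht ht'
    obtain ⟨htr, ht2⟩ := lt_min_iff.1 ht'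
    set q := √(1 - t ^ 2)
    have hq : q ^ 2 = 1 - t ^ 2 := Real.sq_sqrt (by nlinarith)
    have hq0 : 0 ≤ q := Real.sqrt_nonneg _
    -- The small root of `2ρ / (1 + ρ²) = t`, so that `|ρ e - y|² = (1 + ρ²)(1 - t (e · y))`.
    set ρ := t / (1 + q) with hρ
    have hρ0 : 0 < ρ := by positivity
    have hρt : ρ ≤ t := div_le_self ht.le (by linarith)
    have hρe : (1 + ρ ^ 2) * t = 2 * ρ := by
      rw [hρ]; field_simp; linear_combination hq
    have hn : ‖ρ • (e : E3)‖ = ρ := by rw [norm_smul, norm_coe, mul_one, Real.norm_of_nonneg hρ0.le]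
    have h1 := h0 (ρ • (e : E3)) (by rwa [hn]) (by rw [hn]; linarith)
    have h2 (y : S2) : (‖ρ • (e : E3) - (y : E3)‖ ^ k)⁻¹
        = (1 + ρ ^ 2) ^ (-(k / 2 : ℝ)) * (1 - t * inner ℝ (e : E3) (y : E3)) ^ (-(k / 2 : ℝ)) := by
      have h3 := one_half_le_one_sub_mul ht.le ht2.le (abs_inner_coe_le e y)
      have h4 : ‖ρ • (e : E3) - (y : E3)‖ ^ 2 = (1 + ρ ^ 2) * (1 - t * inner ℝ (e : E3) (y : E3)) := by
        rw [norm_sub_coe_sq, hn, real_inner_smul_left, real_inner_smul_left]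
        linear_combination inner ℝ (e : E3) (y : E3) * hρe
      rw [← Real.mul_rpow (by positivity) (by linarith), ← h4, ← Real.rpow_natCast,
        ← Real.rpow_natCast, ← Real.rpow_mul (norm_nonneg _), ← Real.rpow_neg (norm_nonneg _)]
      congr 1
      push_cast
      ring
    simp only [h2, mul_left_comm _ ((1 + ρ ^ 2) ^ (-(k / 2 : ℝ))), integral_const_mul] at h1
    exact (mul_eq_zero.1 h1).resolve_left (by positivity)
  rw [he]
  simp only [real_inner_smul_left, mul_pow, mul_left_comm _ (‖ξ‖ ^ n), integral_const_mul, hmom,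
    mul_zero]

/-! ### Silent magnetizations: normal part and surface divergence -/

lemma norm_sub_coe_pos {x : E3} (hx : ‖x‖ ≠ 1) (y : S2) : 0 < ‖x - (y : E3)‖ :=
  norm_pos_iff.2 (sub_ne_zero.2 fun h => hx (by rw [h, norm_coe]))

lemma continuous_inv_norm_sub_pow {x : E3} (hx : ‖x‖ ≠ 1) (k : ℕ) :
    Continuous fun y : S2 => (‖x - (y : E3)‖ ^ k)⁻¹ :=
  Continuous.inv₀ (by fun_prop) fun y => (pow_pos (norm_sub_coe_pos hx y) k).ne'

/-- The potential in terms of the normal part of the magnetization and of the surface divergence of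
its tangential part. -/
theorem dipolePotential_eq {u : S2 → E3} (hu : MemLp u 2 omega) {w : S2 → ℝ}
    (hw : IsWeakDiv (fun y => u y - inner ℝ (y : E3) (u y) • (y : E3)) w) {x : E3} (hx : ‖x‖ ≠ 1) :
    dipolePotential u x
      = (‖x‖ ^ 2 - 1) / 2 * ∫ y : S2, inner ℝ (y : E3) (u y) * (‖x - (y : E3)‖ ^ 3)⁻¹ ∂omega
        - ∫ y : S2, (inner ℝ (y : E3) (u y) / 2 + w y) * (‖x - (y : E3)‖ ^ 1)⁻¹ ∂omega := by
  have hu1 : MemLp (fun y : S2 => inner ℝ (y : E3) (u y)) 2 omega := by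
    simpa only [real_inner_comm] using memLp_inner_of_continuous hu continuous_subtype_val
  have hc : ‖(2 : ℝ) • x‖ < 1 + ‖x‖ ^ 2 := by
    rw [norm_smul, Real.norm_of_nonneg zero_le_two]
    have := sq_pos_of_ne_zero (sub_ne_zero.2 hx)
    nlinarith
  -- As a function on the sphere, `1/|x - y|` is a ridge function with `ξ = 2x`, nonsingular because
  -- `2|x| < 1 + |x|²`.
  have hridge := hw.integral_ridge hc (f := fun s => (√(1 + ‖x‖ ^ 2 - s))⁻¹)
    (f' := fun s => 1 / 2 * ((√(1 + ‖x‖ ^ 2 - s)) ^ 3)⁻¹) ?_ ?_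
  · have hsq (y : S2) : √(1 + ‖x‖ ^ 2 - inner ℝ ((2 : ℝ) • x) (y : E3)) = ‖x - (y : E3)‖ := by
      rw [← norm_sub_coe_sq, Real.sqrt_sq (norm_nonneg _)]
    simp only [hsq] at hridge
    have i1 := integrable_mul_of_continuous hu1 (continuous_inv_norm_sub_pow hx 3)
    have i2 := integrable_mul_of_continuous hu1 (continuous_inv_norm_sub_pow hx 1)
    have i3 := integrable_mul_of_continuous hw.memLp_div (continuous_inv_norm_sub_pow hx 1)
    have i4 : Integrable (fun y : S2 => 1 / 2 * (‖x - (y : E3)‖ ^ 3)⁻¹ *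
        inner ℝ ((2 : ℝ) • x) (u y - inner ℝ (y : E3) (u y) • (y : E3))) omega := by
      have := integrable_inner_of_continuous hw.memLp_field
        ((continuous_inv_norm_sub_pow hx 3).fun_smul (continuous_const (y := x)))
      refine this.congr (.of_forall fun y => ?_)
      simp only [inner_smul_right, real_inner_smul_left, real_inner_comm x]
      ring
    -- The normal part enters through `y · (x - y) = (|x|² - 1 - |x - y|²)/2`; on the tangential
    -- part `x - y` acts as `x`.
    have e1 : dipolePotential u x = ∫ y : S2, ((‖x‖ ^ 2 - 1) / 2 *
          (inner ℝ (y : E3) (u y) * (‖x - (y : E3)‖ ^ 3)⁻¹)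
        + (-(1 / 2)) * (inner ℝ (y : E3) (u y) * (‖x - (y : E3)‖ ^ 1)⁻¹)
        + 1 / 2 * (‖x - (y : E3)‖ ^ 3)⁻¹ *
          inner ℝ ((2 : ℝ) • x) (u y - inner ℝ (y : E3) (u y) • (y : E3))) ∂omega := by
      refine integral_congr_ae (.of_forall fun y => ?_)
      have hn := norm_sub_coe_pos hx y
      have h1 := norm_sub_coe_sq x y
      simp only [inner_sub_right, inner_smul_right, real_inner_smul_left] at h1 ⊢
      rw [real_inner_comm x (u y), real_inner_comm (y : E3) (u y)]
      field_simp
      linear_combination inner ℝ (y : E3) (u y) * h1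
    rw [e1, integral_add ((i1.const_mul _).fun_add (i2.const_mul _)) i4,
      integral_add (i1.const_mul _) (i2.const_mul _), hridge, integral_const_mul,
      integral_const_mul]
    have e2 : ∫ y : S2, (inner ℝ (y : E3) (u y) / 2 + w y) * (‖x - (y : E3)‖ ^ 1)⁻¹ ∂omega
        = 1 / 2 * ∫ y : S2, inner ℝ (y : E3) (u y) * (‖x - (y : E3)‖ ^ 1)⁻¹ ∂omega
          + ∫ y : S2, w y * (‖x - (y : E3)‖ ^ 1)⁻¹ ∂omega := by
      rw [← integral_const_mul, ← integral_add (i2.const_mul _) i3]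
      refine integral_congr_ae (.of_forall fun y => ?_)
      ring
    rw [e2]
    simp only [pow_one]
    ring
  · refine ContDiffOn.inv (ContDiffOn.sqrt (by fun_prop) fun s hs => ?_) fun s hs => ?_
    · exact (sub_pos.2 (Set.mem_Iio.1 hs)).ne'
    · exact (Real.sqrt_pos.2 (sub_pos.2 (Set.mem_Iio.1 hs))).ne'
  · intro s hs
    have h1 : 0 < 1 + ‖x‖ ^ 2 - s := sub_pos.2 hs
    have h2 := Real.sqrt_pos.2 h1
    refine ((((hasDerivAt_id s).const_sub _).sqrt h1.ne').fun_inv h2.ne').congr_deriv ?_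
    simp only [id]
    field_simp

lemma norm_inversion {x : E3} (hx : x ≠ 0) : ‖(‖x‖ ^ 2)⁻¹ • x‖ = ‖x‖⁻¹ := by
  have := norm_pos_iff.2 hx
  rw [norm_smul, norm_inv, norm_pow, norm_norm]
  field_simp

/-- Inversion fixes the unit sphere and rescales all distances to its points by one factor, so the
integrals at `x/|x|²` are multiples of those at `x`. -/
lemma norm_inversion_sub {x : E3} (hx : x ≠ 0) (y : S2) :
    ‖(‖x‖ ^ 2)⁻¹ • x - (y : E3)‖ = ‖x‖⁻¹ * ‖x - (y : E3)‖ := by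
  have := norm_pos_iff.2 hx
  rw [← sq_eq_sq₀ (norm_nonneg _) (by positivity), mul_pow, norm_sub_coe_sq, norm_sub_coe_sq,
    norm_inversion hx, real_inner_smul_left, real_inner_smul_left, real_inner_smul_left]
  field_simp
  ring

/-- If a magnetization vanishes on a nonempty open set and is silent outside, then its normal part and
the surface divergence of its tangential part vanish. -/
theorem ae_eq_zero_of_dipolePotential_eq_zero {u : S2 → E3} (hu : MemLp u 2 omega) {w : S2 → ℝ}
    (hw : IsWeakDiv (fun y => u y - inner ℝ (y : E3) (u y) • (y : E3)) w) {O : Set S2}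
    (hO : IsOpen O) (hne : O.Nonempty) (huO : ∀ᵐ y ∂omega, y ∈ O → u y = 0) {R : ℝ} (hR : 1 < R)
    (h0 : ∀ x : E3, ‖x‖ = R → dipolePotential u x = 0) :
    (∀ᵐ y : S2 ∂omega, inner ℝ (y : E3) (u y) = 0) ∧ ∀ᵐ y ∂omega, w y = 0 := by
  have hu' := hu.integrable one_le_two
  have hext : ∀ x : E3, R ≤ ‖x‖ → dipolePotential u x = 0 := fun x hx =>
    dipolePotential_eq_zero_of_exterior hu' hR h0 hx
  have hu1 : MemLp (fun y : S2 => inner ℝ (y : E3) (u y)) 2 omega := by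
    simpa only [real_inner_comm] using memLp_inner_of_continuous hu continuous_subtype_val
  have key (x : E3) (hx : 0 < ‖x‖) (hxR : ‖x‖ < R⁻¹) :
      ∫ y : S2, inner ℝ (y : E3) (u y) * (‖x - (y : E3)‖ ^ 3)⁻¹ ∂omega = 0 ∧
      ∫ y : S2, (inner ℝ (y : E3) (u y) / 2 + w y) * (‖x - (y : E3)‖ ^ 1)⁻¹ ∂omega = 0 := by
    have hR0 : 0 < R := by linarith
    have hx1 : ‖x‖ < 1 := hxR.trans (inv_lt_one_of_one_lt₀ hR)
    have hx0 : x ≠ 0 := norm_pos_iff.1 hx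
    have hxR' : R < ‖x‖⁻¹ := (lt_inv_comm₀ hx hR0).1 hxR
    have h1 := dipolePotential_eq hu hw hx1.ne
    have h2 := dipolePotential_eq hu hw (x := (‖x‖ ^ 2)⁻¹ • x)
      (by rw [norm_inversion hx0]; linarith)
    rw [dipolePotential_eq_zero_of_ball hu' hO hne huO hR hext hx1] at h1
    rw [hext _ (by rw [norm_inversion hx0]; exact hxR'.le)] at h2
    simp only [norm_inversion hx0, norm_inversion_sub hx0, mul_pow, mul_inv, inv_inv, inv_pow,
      mul_left_comm _ (‖x‖ ^ 3), mul_left_comm _ (‖x‖ ^ 1), integral_const_mul] at h1 h2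
    generalize (∫ y : S2, inner ℝ (y : E3) (u y) * (‖x - (y : E3)‖ ^ 3)⁻¹ ∂omega) = A at h1 h2 ⊢
    generalize (∫ y : S2, (inner ℝ (y : E3) (u y) / 2 + w y) * (‖x - (y : E3)‖ ^ 1)⁻¹ ∂omega) = B
      at h1 h2 ⊢
    -- The interior equation reads `(|x|² - 1)/2 * A = B`, and the exterior one, after division by
    -- `|x|`, has the opposite sign on the left. Hence `A = B = 0`.
    have h3 : (1 - ‖x‖ ^ 2) / 2 * A = B := by
      have h2' : ‖x‖ * ((1 - ‖x‖ ^ 2) / 2 * A - B) = 0 := by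
        field_simp at h2 ⊢
        linarith
      exact sub_eq_zero.1 ((mul_eq_zero.1 h2').resolve_left hx.ne')
    have h4 : (1 - ‖x‖ ^ 2) * A = 0 := by linarith
    have h5 : A = 0 := (mul_eq_zero.1 h4).resolve_left (by nlinarith)
    exact ⟨h5, by rw [← h3, h5, mul_zero]⟩
  have hRinv : 0 < R⁻¹ := inv_pos.2 (by linarith)
  have hA := ae_eq_zero_of_integral_norm_sub hu1 (k := 3) (by norm_num) hRinv
    fun x hx hx' => (key x hx hx').1
  have hB := ae_eq_zero_of_integral_norm_sub
    (p := fun y => inner ℝ (y : E3) (u y) / 2 + w y) ((hu1.mul_const _).add hw.memLp_div)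
    (k := 1) one_pos hRinv fun x hx hx' => (key x hx hx').2
  refine ⟨hA, ?_⟩
  filter_upwards [hA, hB] with y h1 h2
  simpa [h1] using h2

theorem dipolePotential_eq_zero {u : S2 → E3} (hu : MemLp u 2 omega) {w : S2 → ℝ}
    (hw : IsWeakDiv (fun y => u y - inner ℝ (y : E3) (u y) • (y : E3)) w)
    (hu1 : ∀ᵐ y : S2 ∂omega, inner ℝ (y : E3) (u y) = 0) (hw0 : ∀ᵐ y ∂omega, w y = 0)
    {x : E3} (hx : ‖x‖ ≠ 1) : dipolePotential u x = 0 := by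
  rw [dipolePotential_eq hu hw hx, integral_eq_zero_of_ae, integral_eq_zero_of_ae, mul_zero,
    sub_zero] <;>
  · filter_upwards [hu1, hw0] with y h1 h2
    simp [h1, h2]

/-! ### Supports and existence of the polynomial data -/

/-- Each point of `O` has a neighbourhood where `f` vanishes almost everywhere; second countability
makes the union of the exceptional sets null. -/
lemma ae_eq_zero_of_disjoint_supp {F : Type*} [Zero F] {f : S2 → F} {O : Set S2}
    (h : Disjoint O (supp f)) : ∀ᵐ y ∂omega, y ∈ O → f y = 0 := by
  rw [ae_iff]
  refine measure_null_of_locally_null _ fun x hx => ?_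
  have hxO : x ∈ O := by
    simp only [Set.mem_ofPred_eq, Classical.not_imp] at hx
    exact hx.1
  have hxs : x ∉ supp f := fun hs => Set.disjoint_left.1 h hxO hs
  simp only [supp, Set.mem_ofPred_eq, not_forall, not_not] at hxs
  obtain ⟨U, hU, hU0⟩ := hxs
  refine ⟨_, inter_mem_nhdsWithin _ hU, measure_mono_null ?_ (ae_iff.1 hU0)⟩
  rintro y ⟨hy, hyU⟩
  simp only [Set.mem_ofPred_eq, Classical.not_imp] at hy ⊢
  exact ⟨hyU, hy.2⟩

lemma supp_subset_supp {F G : Type*} [Zero F] [Zero G] {f : S2 → F} {g : S2 → G}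
    (h : ∀ y, g y = 0 → f y = 0) : supp f ⊆ supp g := by
  intro x hx U hU hg
  exact hx U hU (hg.mono fun y hy hyU => h y (hy hyU))

lemma memH1_inner {m : S2 → E3} (hm : MemH1Vec m) :
    MemH1 (fun x : S2 => inner ℝ (x : E3) (m x)) := by
  choose h hh using hm
  have hc (i : Fin 3) : ContDiff ℝ ∞ fun y : E3 => y i :=
    (EuclideanSpace.proj (𝕜 := ℝ) i).contDiff
  refine ⟨_, ((((hh 0).mul_contDiff (hc 0)).add ((hh 1).mul_contDiff (hc 1))).add
    ((hh 2).mul_contDiff (hc 2))).congr (.of_forall fun x => ?_) (ae_eq_refl _)⟩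
  simp only [inner_eq_sum]

lemma memLp_of_memH1Vec {m : S2 → E3} (hm : MemH1Vec m) : MemLp m 2 omega := by
  choose h hh using hm
  exact memLp_of_coord fun i => (hh i).memLp_fun

/-- The functions that enter the polynomial exist. -/
theorem exists_isPolyData {m : S2 → E3} (hm : MemH1Vec m) : ∃ g h m₁, IsPolyData m g h m₁ := by
  obtain ⟨h₁, H₁⟩ := memH1_inner hm
  choose k hk using hm
  have hdiv := isWeakDiv_tangential hk
  obtain ⟨f₂, f₃, h₂, h₃, H₂, H₃, i₂, i₃, hdec⟩ :=
    exists_helmholtz_tangential hdiv.memLp_field hdiv.tangential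
  -- `∇* f₂` is the tangential part of `m` minus a divergence-free rotated gradient, so `Δ* f₂` is
  -- the divergence of that tangential part.
  refine ⟨_, h₁, _, f₂, f₃, _, ⟨H₁.memLp_fun, i₂, i₃, h₂, h₃, H₂, H₃, ?_⟩, H₁,
    ⟨h₂, H₂, (hdiv.sub H₃.rot).congr ?_ (ae_eq_refl _)⟩, rfl⟩
  · filter_upwards [hdec] with x hx
    rw [add_assoc, ← hx, add_sub_cancel]
  · filter_upwards [hdec] with x hx
    rw [hx, add_sub_cancel_right]

/-- The Beltrami derivative of the second Helmholtz scalar is the surface divergence of the tangential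
part. -/
theorem IsPolyData.exists_isWeakDiv {m : S2 → E3} (hm : MemH1Vec m) {g : S2 → ℝ} {h : S2 → E3}
    {m₁ : S2 → ℝ} (H : IsPolyData m g h m₁) :
    IsWeakGrad m₁ h ∧ (∀ᵐ x : S2 ∂omega, m₁ x = inner ℝ (x : E3) (m x)) ∧
      ∃ b, IsWeakDiv (fun x => m x - inner ℝ (x : E3) (m x) • (x : E3)) b ∧
        g = fun x => 2 * b x - m₁ x := by
  obtain ⟨m₂, m₃, b, ⟨-, -, -, h₂, h₃, H₂, H₃, hdec⟩, H₁, ⟨k₂, K₂, hb⟩, rfl⟩ := H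
  have hm₁ : ∀ᵐ x : S2 ∂omega, m₁ x = inner ℝ (x : E3) (m x) := by
    filter_upwards [hdec, H₂.tangential] with x hx ht
    rw [hx, inner_add_right, inner_add_right, inner_smul_right, inner_self_coe, ht,
      inner_self_cross]
    ring
  refine ⟨H₁, hm₁, b, ?_, rfl⟩
  choose k hk using hm
  have hdiv := isWeakDiv_tangential hk
  have hdiv₂ := (hdiv.sub H₃.rot).congr (h' := k₂) (by
    filter_upwards [hdec, hm₁, H₂.unique K₂] with x hx h1 hk
    rw [← hk, ← h1, hx]
    abel) (ae_eq_refl _)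
  refine hdiv.congr (ae_eq_refl _) ?_
  filter_upwards [hdiv₂.unique hb] with x hx
  rw [← hx, sub_zero]

/-! ### The polynomial as a squared norm -/

lemma integrable_continuous_mul {c F : S2 → ℝ} (hc : Continuous c) (hF : Integrable F omega) :
    Integrable (fun y => c y * F y) omega := by
  obtain ⟨C, hC⟩ := exists_norm_le_of_continuous hc
  exact hF.bdd_mul hc.aestronglyMeasurable (.of_forall hC)

lemma sum_sum_mul_integral {F : Fin 3 → Fin 3 → S2 → ℝ} (hF : ∀ i j, Integrable (F i j) omega)
    (a : Fin 3 → Fin 3 → ℝ) :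
    Integrable (fun y => ∑ i, ∑ j, a i j * F i j y) omega ∧
    ∑ i, ∑ j, a i j * ∫ y, F i j y ∂omega = ∫ y, ∑ i, ∑ j, a i j * F i j y ∂omega := by
  have h1 (i : Fin 3) : Integrable (fun y => ∑ j, a i j * F i j y) omega :=
    integrable_finsetSum _ fun j _ => (hF i j).const_mul _
  refine ⟨integrable_finsetSum _ fun i _ => h1 i, ?_⟩
  rw [integral_finsetSum _ fun i _ => h1 i]
  refine Finset.sum_congr rfl fun i _ => ?_
  rw [integral_finsetSum _ fun j _ => (hF i j).const_mul _]
  simp only [integral_const_mul]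

lemma sum_sum_sum_sum_mul_integral {F : Fin 3 → Fin 3 → Fin 3 → Fin 3 → S2 → ℝ}
    (hF : ∀ i j k l, Integrable (F i j k l) omega) (a : Fin 3 → Fin 3 → Fin 3 → Fin 3 → ℝ) :
    Integrable (fun y => ∑ i, ∑ j, ∑ k, ∑ l, a i j k l * F i j k l y) omega ∧
    ∑ i, ∑ j, ∑ k, ∑ l, a i j k l * ∫ y, F i j k l y ∂omega
      = ∫ y, ∑ i, ∑ j, ∑ k, ∑ l, a i j k l * F i j k l y ∂omega := by
  have h1 (i j : Fin 3) := sum_sum_mul_integral (hF i j) (a i j)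
  have h2 := sum_sum_mul_integral (fun i j => (h1 i j).1) fun _ _ => 1
  simp only [one_mul] at h2
  refine ⟨h2.1, ?_⟩
  rw [← h2.2]
  exact Finset.sum_congr rfl fun i _ => Finset.sum_congr rfl fun j _ => (h1 i j).2

lemma integral_combination {Ω : Type*} [MeasurableSpace Ω] {μ : Measure Ω} {A B C D E G : Ω → ℝ}
    (hA : Integrable A μ) (hB : Integrable B μ) (hC : Integrable C μ) (hD : Integrable D μ)
    (hE : Integrable E μ) (hG : Integrable G μ) :
    ∫ y, A y ∂μ + ∫ y, B y ∂μ + 2 * ∫ y, C y ∂μ - 2 * ∫ y, D y ∂μ - 2 * ∫ y, E y ∂μ + ∫ y, G y ∂μ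
      = ∫ y, (A y + B y + 2 * C y - 2 * D y - 2 * E y + G y) ∂μ := by
  have h1 : Integrable (fun y => A y + B y) μ := hA.add hB
  have h2 : Integrable (fun y => A y + B y + 2 * C y) μ := h1.add (hC.const_mul 2)
  have h3 : Integrable (fun y => A y + B y + 2 * C y - 2 * D y) μ := h2.sub (hD.const_mul 2)
  have h4 : Integrable (fun y => A y + B y + 2 * C y - 2 * D y - 2 * E y) μ :=
    h3.sub (hE.const_mul 2)
  rw [integral_add h4 hG, integral_sub h3 (hE.const_mul 2), integral_sub h2 (hD.const_mul 2),
    integral_add h1 (hC.const_mul 2), integral_add hA hB, integral_const_mul, integral_const_mul,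
    integral_const_mul]

/-- The polynomial is the squared norm of a function on the sphere. -/
theorem polyT_eq_integral_sq {g m₁ : S2 → ℝ} {h : S2 → E3} (hg : MemLp g 2 omega)
    (hh : MemLp h 2 omega) (hm : MemLp m₁ 2 omega) (d : E3) :
    polyT g h m₁ d = ∫ y : S2, (inner ℝ d (y : E3) ^ 2 * g y
      + inner ℝ d (y : E3) * inner ℝ d (h y) - m₁ y) ^ 2 ∂omega := by
  have hc (i : Fin 3) : Continuous fun y : S2 => y.1 i := by fun_prop
  have hh' (i : Fin 3) := memLp_coord hh i
  have I1 := sum_sum_sum_sum_mul_integral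
    (F := fun i j k l (y : S2) => y.1 i * y.1 j * y.1 k * y.1 l * |g y| ^ 2)
    (fun i j k l => integrable_continuous_mul ((((hc i).fun_mul (hc j)).fun_mul (hc k)).mul (hc l))
      (by simpa only [sq_abs] using hg.integrable_sq)) (fun i j k l => d i * d j * d k * d l)
  have I2 := sum_sum_sum_sum_mul_integral
    (F := fun i j k l (y : S2) => y.1 i * y.1 j * h y k * h y l)
    (fun i j k l => by
      simpa only [mul_assoc] using integrable_continuous_mul ((hc i).fun_mul (hc j))
        (integrable_mul_of_memLp (hh' k) (hh' l))) (fun i j k l => d i * d j * d k * d l)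
  have I3 := sum_sum_sum_sum_mul_integral
    (F := fun i j k l (y : S2) => y.1 i * y.1 j * y.1 k * h y l * g y)
    (fun i j k l => by
      simpa only [mul_assoc] using integrable_continuous_mul
        (((hc i).fun_mul (hc j)).fun_mul (hc k)) (integrable_mul_of_memLp (hh' l) hg))
    (fun i j k l => d i * d j * d k * d l)
  have I4 := sum_sum_mul_integral (F := fun i j (y : S2) => y.1 i * y.1 j * m₁ y * g y)
    (fun i j => by
      simpa only [mul_assoc] using integrable_continuous_mul ((hc i).fun_mul (hc j))
        (integrable_mul_of_memLp hm hg)) (fun i j => d i * d j)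
  have I5 := sum_sum_mul_integral (F := fun i j (y : S2) => y.1 i * h y j * m₁ y)
    (fun i j => by
      simpa only [mul_assoc] using integrable_continuous_mul (hc i)
        (integrable_mul_of_memLp (hh' j) hm)) (fun i j => d i * d j)
  have I6 : Integrable (fun y => |m₁ y| ^ 2) omega := by simpa only [sq_abs] using hm.integrable_sq
  rw [polyT, I1.2, I2.2, I3.2, I4.2, I5.2,
    integral_combination I1.1 I2.1 I3.1 I4.1 I5.1 I6]
  refine integral_congr_ae (.of_forall fun y => ?_)
  -- Under the integral each multiple sum factors into powers of `d · y` and `d · h`, and the six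
  -- terms are the expansion of the square.
  have four (a b c e : Fin 3 → ℝ) : ∑ i, ∑ j, ∑ k, ∑ l, a i * b j * c k * e l
      = (∑ i, a i) * (∑ j, b j) * (∑ k, c k) * ∑ l, e l := by
    simp only [← Finset.mul_sum, ← Finset.sum_mul]
  have two (a b : Fin 3 → ℝ) : ∑ i, ∑ j, a i * b j = (∑ i, a i) * ∑ j, b j := by
    simp only [← Finset.mul_sum, ← Finset.sum_mul]
  have hs : inner ℝ d (y : E3) = ∑ i, d i * y.1 i := by
    rw [inner_eq_sum, Fin.sum_univ_three]
  have ht : inner ℝ d (h y) = ∑ i, d i * h y i := by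
    rw [inner_eq_sum, Fin.sum_univ_three]
  have e1 := four (fun i => d i * y.1 i) (fun i => d i * y.1 i) (fun i => d i * y.1 i)
    (fun i => d i * y.1 i * |g y| ^ 2)
  have e2 := four (fun i => d i * y.1 i) (fun i => d i * y.1 i) (fun i => d i * h y i)
    (fun i => d i * h y i)
  have e3 := four (fun i => d i * y.1 i) (fun i => d i * y.1 i) (fun i => d i * y.1 i)
    (fun i => d i * h y i * g y)
  have e4 := two (fun i => d i * y.1 i) (fun i => d i * y.1 i * (m₁ y * g y))
  have e5 := two (fun i => d i * y.1 i) (fun i => d i * h y i * m₁ y)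
  rw [← Finset.sum_mul, ← hs] at e1 e3 e4 e5
  rw [← hs, ← ht] at e2
  rw [← ht] at e3 e5
  calc _ = inner ℝ d (y : E3) * inner ℝ d (y : E3) * inner ℝ d (y : E3) * (inner ℝ d (y : E3) * |g y| ^ 2)
        + inner ℝ d (y : E3) * inner ℝ d (y : E3) * inner ℝ d (h y) * inner ℝ d (h y)
        + 2 * (inner ℝ d (y : E3) * inner ℝ d (y : E3) * inner ℝ d (y : E3) * (inner ℝ d (h y) * g y))
        - 2 * (inner ℝ d (y : E3) * (inner ℝ d (y : E3) * (m₁ y * g y)))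
        - 2 * (inner ℝ d (y : E3) * (inner ℝ d (h y) * m₁ y)) + |m₁ y| ^ 2 := by
        rw [← e1, ← e2, ← e3, ← e4, ← e5]
        simp only [mul_assoc, mul_left_comm, mul_comm]
    _ = _ := by
      rw [sq_abs, sq_abs]
      ring

/-! ### The equivalence -/

lemma integrable_kernel {u : S2 → E3} (hu : Integrable u omega) {x : E3} (hx : 1 < ‖x‖) :
    Integrable (fun y : S2 => inner ℝ (u y) (x - y) / ‖x - y‖ ^ 3) omega := by
  refine (hu.norm.const_mul (((‖x‖ - 1) ^ 2)⁻¹)).mono' (aestronglyMeasurable_kernel hu.1 x)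
    (.of_forall fun y => ?_)
  exact norm_kernel_le _ _ (sub_pos.2 hx) (le_norm_sub_coe (by linarith) y)

lemma equivOn_iff {m m' : S2 → E3} (hm : Integrable m omega) (hm' : Integrable m' omega) {R : ℝ}
    (hR : 1 < R) :
    EquivOn R m m' ↔ ∀ x : E3, ‖x‖ = R → dipolePotential (fun y => m y - m' y) x = 0 := by
  refine forall₂_congr fun x hx => ?_
  have hsub : dipolePotential (fun y => m y - m' y) x = dipolePotential m x - dipolePotential m' x := by
    rw [dipolePotential, dipolePotential, dipolePotential,
      ← integral_sub (integrable_kernel hm (by rwa [hx])) (integrable_kernel hm' (by rwa [hx]))]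
    simp only [inner_sub_left, sub_div]
  rw [hsub, sub_eq_zero]
  exact mul_right_inj' (by positivity)

lemma inner_coe_induced (Q : S2 → ℝ) (d x : S2) :
    inner ℝ (x : E3) (induced Q d x) = 2 * inner ℝ (d : E3) (x : E3) * Q x := by
  rw [induced, inner_smul_right, inner_sub_right, inner_smul_right, inner_self_coe,
    real_inner_comm (x : E3)]
  ring

lemma memLp_induced {Q : S2 → ℝ} (hQ : MemLp Q 2 omega) (d : S2) : MemLp (induced Q d) 2 omega :=
  memLp_smul_of_continuous_right hQ (by fun_prop)

/-- Equivalence of a dipole induced magnetization with `m`, for magnetizations that vanish on a common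
nonempty open set, in terms of normal parts and surface divergences. -/
theorem equivOn_induced_iff {m : S2 → E3} (hm : MemLp m 2 omega) {b : S2 → ℝ}
    (hb : IsWeakDiv (fun x => m x - inner ℝ (x : E3) (m x) • (x : E3)) b)
    {Q : S2 → ℝ} {k : S2 → E3} (hQ : IsWeakGrad Q k) (d : S2) {O : Set S2} (hO : IsOpen O)
    (hne : O.Nonempty) (hmO : ∀ᵐ y ∂omega, y ∈ O → m y = 0) (hQO : ∀ᵐ y ∂omega, y ∈ O → Q y = 0)
    {R : ℝ} (hR : 1 < R) :
    EquivOn R (induced Q d) m ↔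
      (∀ᵐ x : S2 ∂omega, 2 * inner ℝ (d : E3) (x : E3) * Q x = inner ℝ (x : E3) (m x)) ∧
      ∀ᵐ x : S2 ∂omega, 2 * inner ℝ (d : E3) (x : E3) * Q x - inner ℝ (d : E3) (k x) = b x := by
  have hi := memLp_induced hQ.memLp_fun d
  have hu : MemLp (fun y => induced Q d y - m y) 2 omega := hi.sub hm
  -- The tangential part of the induced magnetization is `Q` times the tangential part of `-d`.
  have hw : IsWeakDiv (fun y : S2 => induced Q d y - m y
      - inner ℝ (y : E3) (induced Q d y - m y) • (y : E3))
      (fun x => 2 * inner ℝ (d : E3) (x : E3) * Q x - inner ℝ (d : E3) (k x) - b x) := by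
    refine ((hQ.isWeakDiv_smul_tangentField (-(d : E3))).sub hb).congr (.of_forall fun x => ?_)
      (.of_forall fun x => ?_)
    · simp only [inner_sub_right, inner_coe_induced]
      rw [tangentField_coe, induced, inner_neg_left, real_inner_comm (d : E3) (x : E3)]
      module
    · simp only [inner_neg_left]
      ring
  have hnormal (y : S2) : inner ℝ (y : E3) (induced Q d y - m y)
      = 2 * inner ℝ (d : E3) (y : E3) * Q y - inner ℝ (y : E3) (m y) := by
    rw [inner_sub_right, inner_coe_induced]
  rw [equivOn_iff (hi.integrable one_le_two) (hm.integrable one_le_two) hR]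
  simp only [← hnormal, ← sub_eq_zero (b := inner ℝ _ (m _)), ← sub_eq_zero (b := b _)]
  refine ⟨fun h => ae_eq_zero_of_dipolePotential_eq_zero hu hw hO hne ?_ hR h,
    fun h x hx => dipolePotential_eq_zero hu hw h.1 h.2 (by rw [hx]; exact hR.ne')⟩
  filter_upwards [hmO, hQO] with y h1 h2 hy
  rw [h1 hy, induced, h2 hy, zero_smul, sub_zero]

/-- The polynomial vanishes if and only if the surface divergences agree, provided that the normal parts
do. -/
theorem polyT_eq_zero_iff {b m₁ : S2 → ℝ} {h : S2 → E3} (hb : MemLp b 2 omega)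
    (H₁ : IsWeakGrad m₁ h) {Q : S2 → ℝ} {k : S2 → E3} (hQ : IsWeakGrad Q k) (d : S2)
    (hn : ∀ᵐ x : S2 ∂omega, 2 * inner ℝ (d : E3) (x : E3) * Q x = m₁ x) :
    polyT (fun x => 2 * b x - m₁ x) h m₁ d = 0 ↔
      ∀ᵐ x : S2 ∂omega, 2 * inner ℝ (d : E3) (x : E3) * Q x - inner ℝ (d : E3) (k x) = b x := by
  have hg : MemLp (fun x => 2 * b x - m₁ x) 2 omega := (hb.const_mul 2).sub H₁.memLp_fun
  have hF : MemLp (fun y : S2 => inner ℝ (d : E3) (y : E3) ^ 2 * (2 * b y - m₁ y)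
      + inner ℝ (d : E3) (y : E3) * inner ℝ (d : E3) (h y) - m₁ y) 2 omega :=
    ((memLp_mul_of_continuous (by fun_prop) hg).add (memLp_mul_of_continuous (by fun_prop)
      (H₁.memLp_grad.const_inner _))).sub H₁.memLp_fun
  have hc : ContDiff ℝ ∞ fun y : E3 => inner ℝ ((2 : ℝ) • (d : E3)) y :=
    contDiff_const.inner ℝ contDiff_id
  -- By the product rule for `m₁ = 2 (d · x) Q` and uniqueness of weak gradients, `h = 2 (d · x) k +
  -- 2 Q (d - (d · x) x)`.
  have hh : h =ᵐ[omega] _ := H₁.unique ((hQ.mul_contDiff hc).congr (by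
    filter_upwards [hn] with x hx
    rw [← hx, real_inner_smul_left]) (ae_eq_refl _))
  rw [polyT_eq_integral_sq hg H₁.memLp_grad H₁.memLp_fun,
    integral_eq_zero_iff_of_nonneg (fun y => sq_nonneg _) hF.integrable_sq]
  refine Filter.eventually_congr ?_
  filter_upwards [hn, hh, ae_inner_ne_zero d] with x h1 h2 h3
  have h4 : inner ℝ (d : E3) (x : E3) ≠ 0 := by rwa [real_inner_comm]
  have h5 : inner ℝ (d : E3) (x : E3) ^ 2 * (2 * b x - m₁ x)
      + inner ℝ (d : E3) (x : E3) * inner ℝ (d : E3) (h x) - m₁ x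
      = -2 * inner ℝ (d : E3) (x : E3) ^ 2 * (2 * inner ℝ (d : E3) (x : E3) * Q x
        - inner ℝ (d : E3) (k x) - b x) := by
    rw [h2, surfGrad_inner, tangentField_coe, ← h1]
    simp only [inner_add_right, inner_smul_right, inner_sub_right, real_inner_smul_left,
      inner_self_coe]
    ring
  rw [Pi.zero_apply, h5, sq_eq_zero_iff, mul_eq_zero, or_iff_right (by positivity), sub_eq_zero]

/-- For a magnetization supported in `Γ`, the equivalent dipole induced magnetizations supported in `Γ`
are described by the zeros of the polynomial. -/
theorem exists_equivOn_induced_iff {R : ℝ} (hR : 1 < R) {Γ : Set S2} (hΓ : closure Γ ≠ Set.univ)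
    {m : S2 → E3} (hm : MemH1Vec m) (hsupp : supp m ⊆ Γ) {g : S2 → ℝ} {h : S2 → E3} {m₁ : S2 → ℝ}
    (H : IsPolyData m g h m₁) :
    (∃ (Q : S2 → ℝ) (d : S2), MemH1 Q ∧ supp Q ⊆ Γ ∧ EquivOn R (induced Q d) m) ↔
      ∃ d : S2, polyT g h m₁ d = 0 ∧ MemH1 (ratioP m d) := by
  obtain ⟨H₁, hm₁, b, hb, rfl⟩ := H.exists_isWeakDiv hm
  have hmL := memLp_of_memH1Vec hm
  have hO : IsOpen (closure Γ)ᶜ := isClosed_closure.isOpen_compl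
  have hne : (closure Γ)ᶜ.Nonempty := Set.nonempty_compl.2 hΓ
  have hdisj {A : Set S2} (hA : A ⊆ Γ) : Disjoint (closure Γ)ᶜ A :=
    (disjoint_compl_left (a := closure Γ)).mono_right (hA.trans subset_closure)
  have hmO := ae_eq_zero_of_disjoint_supp (hdisj hsupp)
  constructor
  · rintro ⟨Q, d, ⟨k, hQ⟩, hQs, heq⟩
    obtain ⟨hn, ht⟩ := (equivOn_induced_iff hmL hb hQ d hO hne hmO
      (ae_eq_zero_of_disjoint_supp (hdisj hQs)) hR).1 heq
    have hn' : ∀ᵐ x : S2 ∂omega, 2 * inner ℝ (d : E3) (x : E3) * Q x = m₁ x := by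
      filter_upwards [hn, hm₁] with x h1 h2
      rw [h1, h2]
    refine ⟨d, (polyT_eq_zero_iff hb.memLp_div H₁ hQ d hn').2 ht, k, hQ.congr ?_ (ae_eq_refl _)⟩
    filter_upwards [hn, ae_inner_ne_zero d] with x h1 h2
    rw [ratioP, ← h1, real_inner_comm, mul_div_cancel_left₀ _ (by simpa using h2)]
  · rintro ⟨d, hT, k, hQ⟩
    have hn : ∀ᵐ x : S2 ∂omega,
        2 * inner ℝ (d : E3) (x : E3) * ratioP m d x = inner ℝ (x : E3) (m x) := by
      filter_upwards [ae_inner_ne_zero d] with x h2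
      rw [ratioP, real_inner_comm, mul_div_cancel₀ _ (by simpa using h2)]
    have hn' : ∀ᵐ x : S2 ∂omega, 2 * inner ℝ (d : E3) (x : E3) * ratioP m d x = m₁ x := by
      filter_upwards [hn, hm₁] with x h1 h2
      rw [h1, h2]
    -- The support condition is automatic, as the quotient vanishes wherever `m` does.
    have hs : supp (ratioP m d) ⊆ Γ :=
      (supp_subset_supp fun y hy => by rw [ratioP, hy, inner_zero_right, zero_div]).trans hsupp
    exact ⟨ratioP m d, d, ⟨k, hQ⟩, hs, (equivOn_induced_iff hmL hb hQ d hO hne hmO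
      (ae_eq_zero_of_disjoint_supp (hdisj hs)) hR).2
      ⟨hn, (polyT_eq_zero_iff hb.memLp_div H₁ hQ d hn').1 hT⟩⟩

end DipoleSphere

/-- The first conjunct says that the functions entering the polynomial exist for `m`; the second one
is the equivalence, for every choice of these functions (they are unique up to null sets). -/
theorem theorem3p3 (R : ℝ) (hR : 1 < R) (Γ : Set DipoleSphere.S2) (hΓ : closure Γ ≠ Set.univ)
    (m : DipoleSphere.S2 → DipoleSphere.E3) (hm : DipoleSphere.MemH1Vec m)
    (hsupp : DipoleSphere.supp m ⊆ Γ) :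
    (∃ g h m₁, DipoleSphere.IsPolyData m g h m₁) ∧
    ∀ g h m₁, DipoleSphere.IsPolyData m g h m₁ →
      ((∃ (Q : DipoleSphere.S2 → ℝ) (d : DipoleSphere.S2),
          DipoleSphere.MemH1 Q ∧ DipoleSphere.supp Q ⊆ Γ ∧
          DipoleSphere.EquivOn R (DipoleSphere.induced Q d) m) ↔
        ∃ d : DipoleSphere.S2,
          DipoleSphere.polyT g h m₁ d = 0 ∧ DipoleSphere.MemH1 (DipoleSphere.ratioP m d)) := by
  exact ⟨DipoleSphere.exists_isPolyData hm, fun _ _ _ H =>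
    DipoleSphere.exists_equivOn_induced_iff hR hΓ hm hsupp H⟩
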